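/- **Setting.** Let $(X_n)_{n\ge 1}$ be a strictly stationary sequence of real random variables with marginal distribution function $F$, and put $\bar F=1-F$. For integers $0\le s<r$ put $M_{s,r}=\max_{s<i\le r}X_i$, $M_r=M_{0,r}$, and put $F_r(u)=\Pr(M_r\le u)$, $\tau_r(u)=r\bar F(u)$, $N_s(u)=\sum_{i=1}^s I(X_i>u)$. Assume that the sequence has extremal index $\theta\in(0,1]$: for each $x>0$ there are levels $v_n$ with $n\bar F(v_n)\to x$ and $\Pr(M_n\le v_n)\to e^{-\theta x}$ as $n\to\infty$. Let $(u_r)_{r\ge1}$ be real thresholds with $r\bar F(u_r)\to\tau\in(0,\infty)$ as $r\to\infty$. **Estimators.** For $k=\lfloor n/r\rfloor$ put $$\hat F^{\mathrm{dj}}_{n,r}(u)=\frac1k\sum_{i=1}^k I(M_{(i-1)r,ir}\le u),\quad \hat F^{\mathrm{sl}}_{n,r}(u)=\frac1{n-r+1}\sum_{i=0}^{n-r} I(M_{i,i+r}\le u),\quad \hat\tau_{n,r}(u)=\frac1k\sum_{i=1}^{rk}I(X_i>u).$$ **Mixing.** Let $\mathcal F_{a,b}(u)$ be the σ-field generated by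 the events $\{X_i\le u\}$, $a\le i\le b$, and let $$\rho_{n,l}(u)=\max_{1\le t\le n-l}\ \sup_{\xi,\eta}|\mathrm{corr}(\xi,\eta)|,$$ where $\xi,\eta$ range over the square-integrable random variables of positive variance such that $\xi$ is $\mathcal F_{1,t}(u)$-measurable and $\eta$ is $\mathcal F_{t+l,n}(u)$-measurable (the value is $0$ if there are none). **Assumptions.** Let $(r_n),(l_n),(s_n)$ be sequences of positive integers, $(\pi_j)_{j\ge1}$ a probability distribution on the positive integers and $p>1$ a real number such that, as $n\to\infty$: 1. $l_n=o(r_n)$, $r_n=o(n)$ and $\sum_{l=l_n}^n\rho_{n,l}(u_{r_n})=o(r_n)$; 2. $\sum_{l=1}^n\rho_{n,l}(u_{r_n})=o(r_n^{1/2})$; 3. $l_n=o(s_n)$, $s_n=o(r_n)$ and $\rho_{n,l_n}(u_{r_n})=o(s_n/n)$; 4. $\Pr\{N_{s_n}(u_{r_n})=j\mid M_{s_n}>u_{r_n}\}\to\pi_j$ for all $j\ge1$, and $\mathbb E[N_{s_n}^2(u_{r_n})\mid M_{s_n}>u_{r_n}]\to m_2:=\sum_{j\ge1}j^2\pi_j<\infty$;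 5. $\mathbb E[N_{r_n}^{2p}(u_{r_n})]=O(1)$. **Theorem 4.2.** Put $k_n=\lfloor n/r_n\rfloor$ and $\alpha=\tau\theta$. Then, as $n\to\infty$, $$\sqrt{k_n}\begin{pmatrix}\hat F^{\mathrm{dj}}_{n,r_n}(u_{r_n})-F_{r_n}(u_{r_n})\\ \hat F^{\mathrm{sl}}_{n,r_n}(u_{r_n})-F_{r_n}(u_{r_n})\\ \hat\tau_{n,r_n}(u_{r_n})-\tau_{r_n}(u_{r_n})\end{pmatrix}\xrightarrow{d}N(\mathbf 0,\Sigma),$$ where $\Sigma=(\sigma_{ij})_{i,j=1}^3$ is the symmetric, positive semidefinite matrix with $$\sigma_{11}=e^{-\alpha}(1-e^{-\alpha}),\qquad \sigma_{22}=\sigma_{12}=2\alpha^{-1}e^{-\alpha}\bigl(1-(1+\alpha)e^{-\alpha}\bigr),\qquad \sigma_{31}=\sigma_{32}=-\tau e^{-\alpha},\qquad \sigma_{33}=\alpha m_2.$$ -/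

import Mathlib

open MeasureTheory ProbabilityTheory Filter Asymptotics
open scoped Topology

namespace ExtremalBlocks

noncomputable section

variable {Ω : Type*} [MeasurableSpace Ω]

/-- Strict stationarity of the sequence `X 1, X 2, …` (the value `X 0` plays no role): for every
shift `h` the sequences `(X 1, X 2, …)` and `(X (1 + h), X (2 + h), …)` have the same law on
the product space of real sequences. -/
def StrictlyStationary (P : Measure Ω) (X : ℕ → Ω → ℝ) : Prop :=
  ∀ h : ℕ, P.map (fun ω (i : ℕ) => X (i + 1 + h) ω) = P.map (fun ω (i : ℕ) => X (i + 1) ω)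

/-- The tail function `1 - F` of the marginal distribution function `F u = Pr (X 1 ≤ u)`. -/
def tail (P : Measure Ω) (X : ℕ → Ω → ℝ) (u : ℝ) : ℝ :=
  1 - P.real {ω | X 1 ω ≤ u}

/-- The block maximum `max {X i : a < i ≤ b}`, for `a < b`. -/
def blockMax (X : ℕ → Ω → ℝ) (a b : ℕ) (ω : Ω) : ℝ :=
  sSup ((fun i => X i ω) '' Set.Ioc a b)

/-- The distribution function of the maximum of `X 1, …, X r`. -/
def maxCDF (P : Measure Ω) (X : ℕ → Ω → ℝ) (r : ℕ) (u : ℝ) : ℝ :=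
  P.real {ω | blockMax X 0 r ω ≤ u}

/-- The expected number of exceedances of `u` among `r` consecutive variables. -/
def tauBlock (P : Measure Ω) (X : ℕ → Ω → ℝ) (r : ℕ) (u : ℝ) : ℝ :=
  r * tail P X u

/-- The sequence `X 1, X 2, …` has extremal index `θ ∈ (0, 1]`. -/
def HasExtremalIndex (P : Measure Ω) (X : ℕ → Ω → ℝ) (θ : ℝ) : Prop :=
  0 < θ ∧ θ ≤ 1 ∧ ∀ τ : ℝ, 0 < τ → ∃ v : ℕ → ℝ,
    Tendsto (fun n : ℕ => (n : ℝ) * tail P X (v n)) atTop (𝓝 τ) ∧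
    Tendsto (fun n : ℕ => maxCDF P X n (v n)) atTop (𝓝 (Real.exp (-(θ * τ))))

/-- The indicator `I (A)` as a real random variable. -/
def ind (A : Set Ω) (ω : Ω) : ℝ := A.indicator (fun _ => (1 : ℝ)) ω

/-- The number of exceedances `∑ i = 1, …, s` of `I (X i > u)`. -/
def exceedances (X : ℕ → Ω → ℝ) (s : ℕ) (u : ℝ) (ω : Ω) : ℝ :=
  ∑ i ∈ Finset.Icc 1 s, ind {ω' | u < X i ω'} ω

/-- Disjoint blocks estimator of the distribution function of the block maximum. -/
def estDisjoint (X : ℕ → Ω → ℝ) (n r : ℕ) (u : ℝ) (ω : Ω) : ℝ :=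
  (1 / ((n / r : ℕ) : ℝ)) *
    ∑ i ∈ Finset.Icc 1 (n / r), ind {ω' | blockMax X ((i - 1) * r) (i * r) ω' ≤ u} ω

/-- Sliding blocks estimator of the distribution function of the block maximum. -/
def estSliding (X : ℕ → Ω → ℝ) (n r : ℕ) (u : ℝ) (ω : Ω) : ℝ :=
  (1 / ((n - r + 1 : ℕ) : ℝ)) *
    ∑ i ∈ Finset.Icc 0 (n - r), ind {ω' | blockMax X i (i + r) ω' ≤ u} ω

/-- Mean number of exceedances per block. -/
def estTau (X : ℕ → Ω → ℝ) (n r : ℕ) (u : ℝ) (ω : Ω) : ℝ :=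
  (1 / ((n / r : ℕ) : ℝ)) * exceedances X (r * (n / r)) u ω

/-- The σ-field generated by the events `{X i ≤ u}`, `a ≤ i ≤ b`. -/
abbrev sigmaField (X : ℕ → Ω → ℝ) (u : ℝ) (a b : ℕ) : MeasurableSpace Ω :=
  MeasurableSpace.generateFrom {A | ∃ i ∈ Set.Icc a b, A = {ω | X i ω ≤ u}}

/-- Correlation of two random variables of positive variance. -/
def corr (P : Measure Ω) (ξ η : Ω → ℝ) : ℝ :=
  cov[ξ, η; P] / (Real.sqrt (Var[ξ; P]) * Real.sqrt (Var[η; P]))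

/-- The maximal correlation coefficient: the supremum of `|corr (ξ, η)|` over `1 ≤ t ≤ n - l` and
over the square-integrable `ξ`, `η` of positive variance that are measurable with respect to the
σ-fields of the indices `1, …, t` and `t + l, …, n`. The set is bounded by `1`; the supremum is `0`
if the set is empty. -/
def maxCorr (P : Measure Ω) (X : ℕ → Ω → ℝ) (n l : ℕ) (u : ℝ) : ℝ :=
  sSup {c : ℝ | ∃ t : ℕ, 1 ≤ t ∧ t + l ≤ n ∧ ∃ ξ η : Ω → ℝ,
    Measurable[sigmaField X u 1 t] ξ ∧ MemLp ξ 2 P ∧ 0 < Var[ξ; P] ∧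
    Measurable[sigmaField X u (t + l) n] η ∧ MemLp η 2 P ∧ 0 < Var[η; P] ∧
    c = |corr P ξ η|}

/-- A probability distribution on the positive integers. -/
def IsPosIntDistribution (π : ℕ → ℝ) : Prop :=
  π 0 = 0 ∧ (∀ j, 0 ≤ π j) ∧ HasSum π 1

/-- The asymptotic covariance matrix, for `α = τ θ` and `m₂` the second moment of the cluster size
distribution. -/
def asympCov (θ τ m₂ : ℝ) : Matrix (Fin 3) (Fin 3) ℝ :=
  let α := τ * θ
  let σ₁₁ := Real.exp (-α) * (1 - Real.exp (-α))
  let σ₂₂ := 2 * α⁻¹ * Real.exp (-α) * (1 - (1 + α) * Real.exp (-α))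
  let σ₃₁ := -(τ * Real.exp (-α))
  let σ₃₃ := α * m₂
  !![σ₁₁, σ₂₂, σ₃₁;
     σ₂₂, σ₂₂, σ₃₁;
     σ₃₁, σ₃₁, σ₃₃]

/-- The centred vector of the three estimators, scaled by the square root of the number `⌊n / r⌋`
of disjoint blocks. -/
def scaledVector (P : Measure Ω) (X : ℕ → Ω → ℝ) (n r : ℕ) (u : ℝ) (ω : Ω) :
    EuclideanSpace ℝ (Fin 3) :=
  Real.sqrt ((n / r : ℕ) : ℝ) •
    !₂[estDisjoint X n r u ω - maxCDF P X r u,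
       estSliding X n r u ω - maxCDF P X r u,
       estTau X n r u ω - tauBlock P X r u]

end

end ExtremalBlocks

open ExtremalBlocks

/-! Asymptotic normality of the disjoint blocks, sliding blocks and exceedance count estimators.

By Lévy's continuity theorem and the Cramér–Wold device it is enough to find the limit of the
characteristic functions of the linear combinations of the three estimators. Cut the sample into
blocks of length `r`. Up to terms of order `1 / √k` (`integral_abs_inner_sub_le`) such a linear
combination is the normalized sum of a stationary sequence of block statistics (`centredBlock`):
whether the block is empty of exceedances, the proportion of empty windows among those that start in
the block, and the number of exceedances in the block. The statistic of block `j` depends on the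
blocks `j` and `j + 1` only, so statistics at lag at least `3` are separated by a full block and are
nearly independent, with an error of the order of the maximal correlation coefficient at distance
`l`. This coefficient is `o(s / n)`, hence negligible even after multiplication by the number `k` of
blocks. A central limit theorem for such rows (`WeaklyDependentRow`, `tendsto_expect_sum`) follows
from the classical splitting into long groups of blocks with three blocks left out in between; the
moment of order `2 p > 2` of the exceedance count replaces the Lindeberg condition.

It remains to compute the asymptotic variance `γ 0 + 2 γ 1 + 2 γ 2` of the block statistics, which
expands into the covariances `lagCov` of a block with the five blocks around it
(`Regime.tendsto_lagCov`). Three facts enter.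

* The extremal index gives probability `exp (-α y)` in the limit to an empty window of length
  `m ~ y r` (`HasExtremalIndex.tendsto_integral_emp`). Two overlapping windows are both empty if and
  only if their union is, so the covariances between windows are explicit, and their averages are
  Riemann sums of `exp (-α (1 + x)) - exp (-2 α)` over `[0, 1]`.
* An empty window is nearly uncorrelated with what happens before and after it, at the price of
  trimming `l` indices. Since no exceedance occurs inside an empty window, its covariance with the
  number of exceedances around it tends to `-τ exp (-α)`.
* The number of exceedances in a block is the sum of the counts in `r / s` nearly uncorrelated
  intermediate blocks of length `s`. Each of these has an exceedance with probability `~ α s / r`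
  (`Regime.q_one_sub_emp`), and then the second moment of its count is `~ m₂`, so that the variance
  tends to `α m₂` (`Regime.variance_exc`).

That the limit covariance matrix is positive semidefinite is a by-product: its quadratic form is a
limit of variances.
-/

namespace ExtremalBlocks

set_option linter.unusedSectionVars false

/-! ### Characteristic functions -/

lemma norm_exp_taylor_two_le {q : ℝ} (hq : 2 ≤ q) (hq3 : q ≤ 3) (x : ℝ) :
    ‖Complex.exp (x * Complex.I) - (1 + x * Complex.I - ((x ^ 2 / 2 : ℝ) : ℂ))‖ ≤ 4 * |x| ^ q := by
  rcases le_total |x| 1 with hx | hx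
  · have hz : ‖(x * Complex.I : ℂ)‖ = |x| := by simp
    have h := Complex.exp_bound (x := (x * Complex.I : ℂ)) (by rw [hz]; exact hx)
      (n := 3) (by norm_num)
    have e : ∑ m ∈ Finset.range 3, (x * Complex.I : ℂ) ^ m / (m.factorial : ℂ)
        = 1 + x * Complex.I - ((x ^ 2 / 2 : ℝ) : ℂ) := by
      simp [Finset.sum_range_succ, mul_pow]
      ring
    rw [e, hz] at h
    refine h.trans ?_
    have h3 : |x| ^ 3 ≤ |x| ^ q := by
      rw [← Real.rpow_natCast]
      rcases eq_or_lt_of_le (abs_nonneg x) with h0 | h0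
      · rw [← h0, Real.zero_rpow (by norm_num), Real.zero_rpow (by linarith)]
      · exact Real.rpow_le_rpow_of_exponent_ge h0 hx (by simpa using hq3)
    norm_num [Nat.factorial]
    nlinarith [pow_nonneg (abs_nonneg x) 3]
  · have h1 : ‖Complex.exp (x * Complex.I)‖ = 1 := Complex.norm_exp_ofReal_mul_I x
    have h2 : ‖(1 + x * Complex.I - ((x ^ 2 / 2 : ℝ) : ℂ))‖ ≤ 1 + |x| + x ^ 2 / 2 := by
      refine (norm_sub_le _ _).trans (add_le_add ((norm_add_le _ _).trans (by simp)) ?_)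
      rw [Complex.norm_real, Real.norm_eq_abs, abs_of_nonneg (by positivity)]
    have h3 : |x| ^ 2 ≤ |x| ^ q := by
      rw [← Real.rpow_natCast]
      exact Real.rpow_le_rpow_of_exponent_le hx (by simpa using hq)
    refine (norm_sub_le _ _).trans ?_
    rw [h1]
    have : x ^ 2 = |x| ^ 2 := (sq_abs x).symm
    nlinarith

lemma norm_pow_sub_pow_le_of_norm_le_one {a b : ℂ} (ha : ‖a‖ ≤ 1) (hb : ‖b‖ ≤ 1) (n : ℕ) :
    ‖a ^ n - b ^ n‖ ≤ n * ‖a - b‖ := by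
  induction n with
  | zero => simp
  | succ n ih =>
    have e : a ^ (n + 1) - b ^ (n + 1) = (a ^ n - b ^ n) * a + b ^ n * (a - b) := by ring
    rw [e]
    refine (norm_add_le _ _).trans ?_
    rw [norm_mul, norm_mul, norm_pow]
    have : ‖b‖ ^ n ≤ 1 := pow_le_one₀ (norm_nonneg _) hb
    push_cast
    nlinarith [norm_nonneg (a - b), norm_nonneg (a ^ n - b ^ n), norm_nonneg a]

/-- The value at `1` of the characteristic function of the random variable `Z`. -/
noncomputable def expect {Ω : Type*} [MeasurableSpace Ω] (P : Measure Ω) (Z : Ω → ℝ) : ℂ :=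
  ∫ ω, Complex.exp (Z ω * Complex.I) ∂P

section
variable {Ω : Type*} [MeasurableSpace Ω] {P : Measure Ω} [IsProbabilityMeasure P]

lemma measurable_exp_mul_I {Ω : Type*} {m : MeasurableSpace Ω} {Z : Ω → ℝ} (hZ : Measurable[m] Z) :
    Measurable[m] fun ω => Complex.exp (Z ω * Complex.I) :=
  Complex.measurable_exp.comp ((Complex.measurable_ofReal.comp hZ).mul_const _)

lemma integrable_exp_mul_I {Z : Ω → ℝ} (hZ : Measurable Z) :
    Integrable (fun ω => Complex.exp (Z ω * Complex.I)) P :=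
  Integrable.of_bound (measurable_exp_mul_I hZ).aestronglyMeasurable 1
    (ae_of_all _ fun _ => (Complex.norm_exp_ofReal_mul_I _).le)

lemma norm_expect_le (Z : Ω → ℝ) : ‖expect P Z‖ ≤ 1 := by
  refine (norm_integral_le_integral_norm _).trans ?_
  simp [Complex.norm_exp_ofReal_mul_I]

lemma norm_exp_mul_I_sub_le (x y : ℝ) :
    ‖Complex.exp (x * Complex.I) - Complex.exp (y * Complex.I)‖ ≤ |x - y| := by
  have e : Complex.exp (x * Complex.I) - Complex.exp (y * Complex.I)
      = Complex.exp (y * Complex.I) * (Complex.exp (Complex.I * ((x - y : ℝ) : ℂ)) - 1) := by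
    rw [mul_sub, ← Complex.exp_add]
    push_cast
    ring_nf
  rw [e, norm_mul, Complex.norm_exp_ofReal_mul_I, one_mul]
  exact Real.norm_exp_I_mul_ofReal_sub_one_le

lemma norm_expect_sub_le {Z Z' : Ω → ℝ} (hZ : Measurable Z) (hZ' : Measurable Z')
    (hint : Integrable (fun ω => Z ω - Z' ω) P) :
    ‖expect P Z - expect P Z'‖ ≤ ∫ ω, |Z ω - Z' ω| ∂P := by
  unfold expect
  rw [← integral_sub (integrable_exp_mul_I hZ) (integrable_exp_mul_I hZ')]
  refine (norm_integral_le_integral_norm _).trans ?_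
  refine integral_mono ((integrable_exp_mul_I hZ).sub (integrable_exp_mul_I hZ')).norm hint.abs ?_
  intro ω
  exact norm_exp_mul_I_sub_le _ _

lemma integral_abs_le_sqrt {Z : Ω → ℝ} (hZ : MemLp Z 2 P) :
    ∫ ω, |Z ω| ∂P ≤ Real.sqrt (∫ ω, Z ω ^ 2 ∂P) := by
  apply Real.le_sqrt_of_sq_le
  have h := variance_nonneg (fun ω => |Z ω|) P
  rw [variance_eq_sub (X := fun ω => |Z ω|) hZ.abs] at h
  simp only [Pi.pow_apply, sq_abs] at h
  linarith

/-- A centred variable with a moment of order `q ∈ [2, 3]` has nearly the characteristic function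
of a Gaussian variable of the same variance. -/
lemma norm_expect_sub_gaussian_le {q : ℝ} (hq : 2 ≤ q) (hq3 : q ≤ 3) {Z : Ω → ℝ}
    (hZ : Measurable Z) (hZ2 : MemLp Z 2 P) (h0 : ∫ ω, Z ω ∂P = 0)
    (hint : Integrable (fun ω => |Z ω| ^ q) P) :
    ‖expect P Z - ((Real.exp (-(∫ ω, Z ω ^ 2 ∂P) / 2) : ℝ) : ℂ)‖
      ≤ 4 * ∫ ω, |Z ω| ^ q ∂P + (∫ ω, Z ω ^ 2 ∂P) ^ 2 := by
  set v := ∫ ω, Z ω ^ 2 ∂P with hv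
  have hv0 : 0 ≤ v := integral_nonneg fun ω => sq_nonneg _
  have hZi : Integrable Z P := hZ2.integrable (by norm_num)
  have hZsq : Integrable (fun ω => Z ω ^ 2) P := hZ2.integrable_sq
  have hT : ∫ ω, (1 + (Z ω : ℂ) * Complex.I - ((Z ω ^ 2 / 2 : ℝ) : ℂ)) ∂P
      = ((1 - v / 2 : ℝ) : ℂ) := by
    rw [integral_sub, integral_add, integral_mul_const, integral_complex_ofReal, integral_complex_ofReal,
      integral_div, ← hv, h0]
    · simp
    · exact integrable_const _
    · exact hZi.ofReal.mul_const _
    · exact (integrable_const _).add (hZi.ofReal.mul_const _)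
    · exact (hZsq.div_const 2).ofReal
  have hA : ‖expect P Z - ((1 - v / 2 : ℝ) : ℂ)‖ ≤ 4 * ∫ ω, |Z ω| ^ q ∂P := by
    unfold expect
    have hTi : Integrable (fun ω => (1 + (Z ω : ℂ) * Complex.I - ((Z ω ^ 2 / 2 : ℝ) : ℂ))) P :=
      ((integrable_const _).add (hZi.ofReal.mul_const _)).sub (hZsq.div_const 2).ofReal
    rw [← hT, ← integral_sub (integrable_exp_mul_I hZ) hTi, ← integral_const_mul]
    refine (norm_integral_le_integral_norm _).trans ?_
    refine integral_mono ((integrable_exp_mul_I hZ).sub hTi).norm (hint.const_mul 4) ?_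
    intro ω
    exact norm_exp_taylor_two_le hq hq3 _
  have hB : ‖((1 - v / 2 : ℝ) : ℂ) - ((Real.exp (-v / 2) : ℝ) : ℂ)‖ ≤ v ^ 2 := by
    rw [← Complex.ofReal_sub, Complex.norm_real, Real.norm_eq_abs]
    rcases le_total v 2 with h2 | h2
    · have h := Real.abs_exp_sub_one_sub_id_le (x := -v / 2)
        (by rw [abs_le]; constructor <;> linarith)
      rw [abs_sub_comm]
      have e : Real.exp (-v / 2) - (1 - v / 2) = Real.exp (-v / 2) - 1 - (-v / 2) := by ring
      rw [e]
      refine h.trans ?_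
      nlinarith
    · have h1 : Real.exp (-v / 2) ≤ 1 := Real.exp_le_one_iff.2 (by linarith)
      have h3 := Real.exp_pos (-v / 2)
      rw [abs_le]
      constructor <;> nlinarith
  calc _ = ‖(expect P Z - ((1 - v / 2 : ℝ) : ℂ))
        + (((1 - v / 2 : ℝ) : ℂ) - ((Real.exp (-v / 2) : ℝ) : ℂ))‖ := by congr 1; ring
    _ ≤ _ := (norm_add_le _ _).trans (add_le_add hA hB)

end

/-! ### A central limit theorem for weakly dependent arrays -/

section
variable {Ω : Type*} [MeasurableSpace Ω] {P : Measure Ω} [IsProbabilityMeasure P]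

/-- Moment and mixing properties of one row `Y 0, …, Y (N - 1)` of a triangular array of centred
variables: the covariances `γ h` depend on the lag `h` only, and indices at distance at least `3`
are nearly independent, with error `ρ`. -/
structure WeaklyDependentRow (P : Measure Ω) (Y : ℕ → Ω → ℝ) (γ : ℕ → ℝ) (N : ℕ) (ρ C q : ℝ) :
    Prop where
  measurable : ∀ j, Measurable (Y j)
  bounded : ∃ B, ∀ j ω, |Y j ω| ≤ B
  centred : ∀ j, ∫ ω, Y j ω ∂P = 0
  integral_mul : ∀ i h, ∫ ω, Y i ω * Y (i + h) ω ∂P = γ h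
  expect_shift : ∀ (b h : ℕ) (t : ℝ), expect P (fun ω => t * ∑ j ∈ Finset.Ico h (h + b), Y j ω)
    = expect P (fun ω => t * ∑ j ∈ Finset.range b, Y j ω)
  moment : ∀ j, ∫ ω, |Y j ω| ^ q ∂P ≤ C
  cov_le : ∀ h, |γ h| ≤ C
  rho_nonneg : 0 ≤ ρ
  cov_le_rho : ∀ h, 3 ≤ h → h < N → |γ h| ≤ ρ
  expect_mul : ∀ (A B : Finset ℕ) (t : ℝ), (∀ i ∈ A, ∀ j ∈ B, i + 3 ≤ j) → (∀ j ∈ B, j < N) →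
    ‖expect P (fun ω => t * (∑ j ∈ A, Y j ω + ∑ j ∈ B, Y j ω)) -
      expect P (fun ω => t * ∑ j ∈ A, Y j ω) * expect P (fun ω => t * ∑ j ∈ B, Y j ω)‖ ≤ ρ

namespace WeaklyDependentRow
variable {Y : ℕ → Ω → ℝ} {γ : ℕ → ℝ} {N : ℕ} {ρ C q : ℝ}

lemma C_nonneg (h : WeaklyDependentRow P Y γ N ρ C q) : 0 ≤ C :=
  (abs_nonneg _).trans (h.cov_le 0)

lemma measurable_sum (h : WeaklyDependentRow P Y γ N ρ C q) (A : Finset ℕ) :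
    Measurable fun ω => ∑ j ∈ A, Y j ω :=
  Finset.measurable_fun_sum _ fun j _ => h.measurable j

lemma sum_bounded (h : WeaklyDependentRow P Y γ N ρ C q) (A : Finset ℕ) :
    ∃ B, ∀ ω, |∑ j ∈ A, Y j ω| ≤ B := by
  obtain ⟨B, hB⟩ := h.bounded
  refine ⟨∑ j ∈ A, B, fun ω => (Finset.abs_sum_le_sum_abs _ _).trans ?_⟩
  exact Finset.sum_le_sum fun j _ => hB j ω

lemma memLp_sum (h : WeaklyDependentRow P Y γ N ρ C q) (A : Finset ℕ) (p : ENNReal) :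
    MemLp (fun ω => ∑ j ∈ A, Y j ω) p P := by
  obtain ⟨B, hB⟩ := h.sum_bounded A
  exact MemLp.of_bound (h.measurable_sum A).aestronglyMeasurable B (ae_of_all _ hB)

lemma memLp (h : WeaklyDependentRow P Y γ N ρ C q) (j : ℕ) (p : ENNReal) :
    MemLp (Y j) p P := by
  simpa using h.memLp_sum {j} p

lemma integral_mul_eq (h : WeaklyDependentRow P Y γ N ρ C q) {i j : ℕ} (hij : i ≤ j) :
    ∫ ω, Y i ω * Y j ω ∂P = γ (j - i) := by
  rw [← h.integral_mul i (j - i), Nat.add_sub_cancel' hij]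

lemma abs_integral_mul_le (h : WeaklyDependentRow P Y γ N ρ C q) {i j : ℕ}
    (hi : i < N) (hj : j < N) :
    |∫ ω, Y i ω * Y j ω ∂P| ≤ (if j ∈ Finset.Icc (i - 2) (i + 2) then C else 0) + ρ := by
  have key : ∃ d, ∫ ω, Y i ω * Y j ω ∂P = γ d ∧ d < N ∧
      (3 ≤ d ∨ j ∈ Finset.Icc (i - 2) (i + 2)) := by
    rcases le_total i j with hij | hij
    · refine ⟨j - i, h.integral_mul_eq hij, by omega, ?_⟩
      rw [Finset.mem_Icc]; omega
    · refine ⟨i - j, ?_, by omega, ?_⟩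
      · rw [← h.integral_mul_eq hij]
        simp_rw [mul_comm]
      · rw [Finset.mem_Icc]; omega
  obtain ⟨d, hd, hdN, h3 | hmem⟩ := key
  · rw [hd]
    refine (h.cov_le_rho d h3 hdN).trans ?_
    split_ifs
    · linarith [h.C_nonneg]
    · linarith
  · rw [hd, if_pos hmem]
    linarith [h.cov_le d, h.rho_nonneg]

lemma integral_sum_sq_le (h : WeaklyDependentRow P Y γ N ρ C q) {A : Finset ℕ}
    (hA : A ⊆ Finset.range N) :
    ∫ ω, (∑ j ∈ A, Y j ω) ^ 2 ∂P ≤ A.card * (5 * C + N * ρ) := by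
  have hmul : ∀ i j, Integrable (fun ω => Y i ω * Y j ω) P := fun i j =>
    (h.memLp i 2).integrable_mul (h.memLp j 2)
  have e : ∫ ω, (∑ j ∈ A, Y j ω) ^ 2 ∂P = ∑ i ∈ A, ∑ j ∈ A, ∫ ω, Y i ω * Y j ω ∂P := by
    simp_rw [sq, Finset.sum_mul_sum]
    rw [integral_finsetSum _ fun i _ => integrable_finsetSum _ fun j _ => hmul i j]
    refine Finset.sum_congr rfl fun i _ => ?_
    rw [integral_finsetSum _ fun j _ => hmul i j]
  rw [e, ← nsmul_eq_mul]
  refine Finset.sum_le_card_nsmul _ _ _ fun i hi => ?_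
  calc ∑ j ∈ A, ∫ ω, Y i ω * Y j ω ∂P
      ≤ ∑ j ∈ A, ((if j ∈ Finset.Icc (i - 2) (i + 2) then C else 0) + ρ) :=
        Finset.sum_le_sum fun j hj => (le_abs_self _).trans
          (h.abs_integral_mul_le (Finset.mem_range.1 (hA hi)) (Finset.mem_range.1 (hA hj)))
    _ ≤ 5 * C + N * ρ := by
      rw [Finset.sum_add_distrib, Finset.sum_ite_mem, Finset.sum_const, Finset.sum_const,
        nsmul_eq_mul, nsmul_eq_mul]
      have h1 : (A ∩ Finset.Icc (i - 2) (i + 2)).card ≤ 5 := by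
        refine (Finset.card_le_card Finset.inter_subset_right).trans ?_
        rw [Nat.card_Icc]; omega
      have h2 : A.card ≤ N := by simpa using Finset.card_le_card hA
      have h1' : ((A ∩ Finset.Icc (i - 2) (i + 2)).card : ℝ) ≤ 5 := by exact_mod_cast h1
      have h2' : (A.card : ℝ) ≤ N := by exact_mod_cast h2
      exact add_le_add (mul_le_mul_of_nonneg_right h1' h.C_nonneg)
        (mul_le_mul_of_nonneg_right h2' h.rho_nonneg)

/-- The variance of a partial sum is its length times `γ 0 + 2 * γ 1 + 2 * γ 2`, up to the bounded
effect of the two ends and the terms of lag at least `3`. -/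
lemma abs_integral_sum_sq_sub_le (h : WeaklyDependentRow P Y γ N ρ C q) {b : ℕ} (hb : 2 ≤ b)
    (hbN : b ≤ N) :
    |∫ ω, (∑ j ∈ Finset.range b, Y j ω) ^ 2 ∂P - b * (γ 0 + 2 * γ 1 + 2 * γ 2)|
      ≤ 14 * C + 2 * b ^ 2 * ρ := by
  have hstep : ∀ b, ∫ ω, (∑ j ∈ Finset.range (b + 1), Y j ω) ^ 2 ∂P
      = ∫ ω, (∑ j ∈ Finset.range b, Y j ω) ^ 2 ∂P
        + 2 * ∑ i ∈ Finset.range b, γ (i + 1) + γ 0 := by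
    intro b
    have e : ∀ ω, (∑ j ∈ Finset.range (b + 1), Y j ω) ^ 2
        = ((∑ j ∈ Finset.range b, Y j ω) ^ 2 + 2 * ∑ j ∈ Finset.range b, Y j ω * Y b ω)
          + Y b ω * Y b ω := by
      intro ω
      rw [Finset.sum_range_succ, ← Finset.sum_mul]; ring
    simp_rw [e]
    have hmul : ∀ i j, Integrable (fun ω => Y i ω * Y j ω) P := fun i j =>
      (h.memLp i 2).integrable_mul (h.memLp j 2)
    have hs : Integrable (fun ω => ∑ j ∈ Finset.range b, Y j ω * Y b ω) P :=
      integrable_finsetSum _ fun j _ => hmul j b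
    have hq := (h.memLp_sum (Finset.range b) 2).integrable_sq
    have hqs : Integrable (fun ω => (∑ j ∈ Finset.range b, Y j ω) ^ 2
        + 2 * ∑ j ∈ Finset.range b, Y j ω * Y b ω) P := hq.add (hs.const_mul 2)
    rw [integral_add hqs (hmul b b), integral_add hq (hs.const_mul 2),
      integral_const_mul, integral_finsetSum _ fun j _ => hmul j b, h.integral_mul_eq le_rfl,
      Nat.sub_self, ← Finset.sum_range_reflect (fun i => γ (i + 1))]
    congr 3
    refine Finset.sum_congr rfl fun j hj => ?_
    rw [Finset.mem_range] at hj
    rw [h.integral_mul_eq hj.le]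
    congr 1; omega
  have hb0 := abs_le.1 (h.cov_le 0)
  have hb1 := abs_le.1 (h.cov_le 1)
  have hb2 := abs_le.1 (h.cov_le 2)
  induction b, hb using Nat.le_induction with
  | base =>
    rw [hstep, hstep]
    simp only [Finset.range_zero, Finset.sum_empty, Finset.sum_range_one, zero_add]
    have := h.rho_nonneg
    rw [abs_le]
    norm_num
    constructor <;> linarith
  | succ b hb ih =>
    have ih := abs_le.1 (ih (by omega))
    rw [hstep]
    obtain ⟨c, rfl⟩ := Nat.exists_eq_add_of_le hb
    rw [Finset.sum_range_add]
    simp only [Finset.sum_range_succ, Finset.range_zero, Finset.sum_empty, zero_add]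
    have hs : |∑ x ∈ Finset.range c, γ (2 + x + 1)| ≤ c * ρ := by
      refine (Finset.abs_sum_le_sum_abs _ _).trans ?_
      refine (Finset.sum_le_card_nsmul _ _ ρ fun x hx => ?_).trans (by simp)
      rw [Finset.mem_range] at hx
      exact h.cov_le_rho _ (by omega) (by omega)
    have hs := abs_le.1 hs
    have hr := h.rho_nonneg
    have hcr : 0 ≤ (c : ℝ) * ρ := by positivity
    push_cast at ih ⊢
    norm_num at ih ⊢
    rw [abs_le]
    constructor <;> nlinarith

/-- The indices of `g` groups of `b` consecutive ones, with three indices left out after each. -/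
def groups (b g : ℕ) : Finset ℕ :=
  (Finset.range g).biUnion fun i => Finset.Ico (i * (b + 3)) (i * (b + 3) + b)

lemma groups_succ (b g : ℕ) : groups b (g + 1)
    = Finset.Ico (g * (b + 3)) (g * (b + 3) + b) ∪ groups b g := by
  rw [groups, Finset.range_add_one, Finset.biUnion_insert, groups]

lemma add_three_le_of_mem_groups {b g i : ℕ} (hi : i ∈ groups b g) : i + 3 < g * (b + 3) := by
  rw [groups, Finset.mem_biUnion] at hi
  obtain ⟨a, ha, hi⟩ := hi
  rw [Finset.mem_range] at ha
  rw [Finset.mem_Ico] at hi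
  have : (a + 1) * (b + 3) ≤ g * (b + 3) := Nat.mul_le_mul_right _ ha
  rw [add_mul] at this
  omega

lemma disjoint_groups (b g : ℕ) :
    Disjoint (Finset.Ico (g * (b + 3)) (g * (b + 3) + b)) (groups b g) := by
  rw [Finset.disjoint_right]
  intro i hi h'
  have := add_three_le_of_mem_groups hi
  rw [Finset.mem_Ico] at h'
  omega

lemma card_groups (b g : ℕ) : (groups b g).card = g * b := by
  induction g with
  | zero => simp [groups]
  | succ g ih =>
    rw [groups_succ, Finset.card_union_of_disjoint (disjoint_groups b g), ih, Nat.card_Ico]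
    ring_nf; omega

lemma norm_expect_groups_sub_le (h : WeaklyDependentRow P Y γ N ρ C q) (b : ℕ) (t : ℝ) {g : ℕ}
    (hg : g * (b + 3) ≤ N) :
    ‖expect P (fun ω => t * ∑ j ∈ groups b g, Y j ω)
      - expect P (fun ω => t * ∑ j ∈ Finset.range b, Y j ω) ^ g‖ ≤ g * ρ := by
  induction g with
  | zero => simp [groups, expect]
  | succ g ih =>
    have hg' : g * (b + 3) + (b + 3) ≤ N := by rw [add_mul, one_mul] at hg; exact hg
    have ih := ih (by omega)
    have hm := h.expect_mul (groups b g) (Finset.Ico (g * (b + 3)) (g * (b + 3) + b)) t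
      (fun i hi j hj => by
        have := add_three_le_of_mem_groups hi
        rw [Finset.mem_Ico] at hj; omega)
      (fun j hj => by rw [Finset.mem_Ico] at hj; omega)
    have e : (fun ω => t * ∑ j ∈ groups b (g + 1), Y j ω) = fun ω => t * (∑ j ∈ groups b g, Y j ω
        + ∑ j ∈ Finset.Ico (g * (b + 3)) (g * (b + 3) + b), Y j ω) := by
      funext ω
      rw [groups_succ, Finset.sum_union (disjoint_groups b g), add_comm]
    rw [e]
    rw [h.expect_shift b (g * (b + 3)) t] at hm
    set φ := expect P (fun ω => t * ∑ j ∈ Finset.range b, Y j ω) with hφ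
    set ψ := expect P (fun ω => t * ∑ j ∈ groups b g, Y j ω)
    set χ := expect P (fun ω => t * (∑ j ∈ groups b g, Y j ω
        + ∑ j ∈ Finset.Ico (g * (b + 3)) (g * (b + 3) + b), Y j ω))
    have e2 : χ - φ ^ (g + 1) = (χ - ψ * φ) + (ψ - φ ^ g) * φ := by ring
    rw [e2]
    refine (norm_add_le _ _).trans ?_
    rw [norm_mul]
    have h1 : ‖φ‖ ≤ 1 := norm_expect_le _
    have h2 : ‖ψ - φ ^ g‖ * ‖φ‖ ≤ g * ρ :=
      (mul_le_of_le_one_right (norm_nonneg _) h1).trans ih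
    push_cast
    linarith

lemma integral_abs_sum_rpow_le (h : WeaklyDependentRow P Y γ N ρ C q) (hq : 1 ≤ q) (b : ℕ) :
    ∫ ω, |∑ j ∈ Finset.range b, Y j ω| ^ q ∂P ≤ (b : ℝ) ^ (q - 1) * (b * C) := by
  have hint : ∀ A : Finset ℕ, Integrable (fun ω => |∑ j ∈ A, Y j ω| ^ q) P := fun A => by
    obtain ⟨B, hB⟩ := h.sum_bounded A
    refine Integrable.of_bound
      (((h.measurable_sum A).norm.pow_const q).aestronglyMeasurable) (B ^ q) (ae_of_all _ fun ω => ?_)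
    rw [Real.norm_eq_abs, abs_of_nonneg (by positivity)]
    exact Real.rpow_le_rpow (abs_nonneg _) (hB ω) (by linarith)
  have hint1 : ∀ j, Integrable (fun ω => |Y j ω| ^ q) P := fun j => by
    simpa using hint {j}
  calc ∫ ω, |∑ j ∈ Finset.range b, Y j ω| ^ q ∂P
      ≤ ∫ ω, (b : ℝ) ^ (q - 1) * ∑ j ∈ Finset.range b, |Y j ω| ^ q ∂P := by
        refine integral_mono (hint _) ((integrable_finsetSum _ fun j _ => hint1 j).const_mul _) ?_
        intro ω
        have := Real.rpow_sum_le_const_mul_sum_rpow (Finset.range b) (fun j => Y j ω) hq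
        rw [Finset.card_range] at this
        refine le_trans ?_ this
        exact Real.rpow_le_rpow (abs_nonneg _) (Finset.abs_sum_le_sum_abs _ _) (by linarith)
    _ ≤ (b : ℝ) ^ (q - 1) * (b * C) := by
        rw [integral_const_mul, integral_finsetSum _ fun j _ => hint1 j]
        refine mul_le_mul_of_nonneg_left ?_ (by positivity)
        refine (Finset.sum_le_card_nsmul _ _ C fun j _ => h.moment j).trans (by simp)

/-- Error bound in the normal approximation of `c * ∑ j < N, Y j`, from `N / (b + 3)` groups of `b`
consecutive terms. -/
lemma norm_expect_sum_sub_le (h : WeaklyDependentRow P Y γ N ρ C q) (hq : 2 ≤ q) (hq3 : q ≤ 3)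
    {b : ℕ} (hb : 2 ≤ b) (hbN : b ≤ N) {c V : ℝ} (hc : 0 ≤ c) (hV : 0 ≤ V) :
    ‖expect P (fun ω => c * ∑ j ∈ Finset.range N, Y j ω) - ((Real.exp (-V / 2) : ℝ) : ℂ)‖
      ≤ Real.sqrt ((N * c ^ 2 - b * ((N / (b + 3) : ℕ) * c ^ 2)) * (5 * C + N * ρ))
        + N * ρ
        + (4 * ((N * c ^ q) * ((b : ℝ) ^ (q - 1) * (b * C)))
          + (N * c ^ 4) * (b * (5 * C + N * ρ)) ^ 2)
        + (((N / (b + 3) : ℕ) * c ^ 2) * (14 * C + 2 * b ^ 2 * ρ)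
          + |b * ((N / (b + 3) : ℕ) * c ^ 2) * (γ 0 + 2 * γ 1 + 2 * γ 2) - V|) := by
  set m := N / (b + 3) with hm
  have hmN : m * (b + 3) ≤ N := Nat.div_mul_le_self _ _
  have hmN' : (m : ℝ) ≤ N := by exact_mod_cast Nat.div_le_self _ _
  set A := groups b m with hA
  have hAN : A ⊆ Finset.range N := fun i hi => by
    have := add_three_le_of_mem_groups hi
    rw [Finset.mem_range]; omega
  have hρ := h.rho_nonneg
  set S := fun ω => ∑ j ∈ Finset.range b, Y j ω with hS
  have hSm : Measurable S := h.measurable_sum _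
  set v := ∫ ω, S ω ^ 2 ∂P with hv
  have hv0 : 0 ≤ v := integral_nonneg fun ω => sq_nonneg _
  have hvle : v ≤ b * (5 * C + N * ρ) := by
    have := h.integral_sum_sq_le (A := Finset.range b)
      (Finset.range_subset_range.2 hbN)
    rwa [Finset.card_range] at this
  -- the terms left out
  have h1 : ‖expect P (fun ω => c * ∑ j ∈ Finset.range N, Y j ω)
      - expect P (fun ω => c * ∑ j ∈ A, Y j ω)‖
      ≤ Real.sqrt ((N * c ^ 2 - b * (m * c ^ 2)) * (5 * C + N * ρ)) := by
    have e : ∀ ω, c * ∑ j ∈ Finset.range N, Y j ω - c * ∑ j ∈ A, Y j ω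
        = c * ∑ j ∈ Finset.range N \ A, Y j ω := fun ω => by
      rw [← Finset.sum_sdiff hAN]; ring
    have hL : MemLp (fun ω => c * ∑ j ∈ Finset.range N \ A, Y j ω) 2 P :=
      (h.memLp_sum _ 2).const_mul c
    refine (norm_expect_sub_le ((h.measurable_sum _).const_mul c)
      ((h.measurable_sum _).const_mul c) ?_).trans ?_
    · simp_rw [e]; exact hL.integrable (by norm_num)
    · simp_rw [e]
      refine (integral_abs_le_sqrt hL).trans (Real.sqrt_le_sqrt ?_)
      simp_rw [mul_pow]
      rw [integral_const_mul]
      have hsq := h.integral_sum_sq_le (A := Finset.range N \ A) Finset.sdiff_subset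
      have hcard : ((Finset.range N \ A).card : ℝ) = N - m * b := by
        rw [Finset.cast_card_sdiff hAN, card_groups]; push_cast; simp
      rw [hcard] at hsq
      calc _ ≤ c ^ 2 * ((N - m * b) * (5 * C + N * ρ)) :=
            mul_le_mul_of_nonneg_left hsq (sq_nonneg c)
        _ = _ := by ring
  have h2 : ‖expect P (fun ω => c * ∑ j ∈ A, Y j ω) - expect P (fun ω => c * S ω) ^ m‖ ≤ N * ρ :=
    (h.norm_expect_groups_sub_le b c hmN).trans (mul_le_mul_of_nonneg_right hmN' hρ)
  have hcS : ∫ ω, (c * S ω) ^ 2 ∂P = c ^ 2 * v := by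
    simp_rw [mul_pow]; rw [integral_const_mul]
  have h3 : ‖expect P (fun ω => c * S ω) ^ m - ((Real.exp (-(c ^ 2 * v) / 2) : ℝ) : ℂ) ^ m‖
      ≤ 4 * ((N * c ^ q) * ((b : ℝ) ^ (q - 1) * (b * C)))
          + (N * c ^ 4) * (b * (5 * C + N * ρ)) ^ 2 := by
    have hexp : ‖((Real.exp (-(c ^ 2 * v) / 2) : ℝ) : ℂ)‖ ≤ 1 := by
      rw [Complex.norm_real, Real.norm_eq_abs, abs_of_pos (Real.exp_pos _)]
      exact Real.exp_le_one_iff.2 (by nlinarith [sq_nonneg c, mul_nonneg (sq_nonneg c) hv0])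
    refine (norm_pow_sub_pow_le_of_norm_le_one (norm_expect_le _) hexp m).trans ?_
    have habs : ∀ ω, |c * S ω| ^ q = c ^ q * |S ω| ^ q := fun ω => by
      rw [abs_mul, abs_of_nonneg hc, Real.mul_rpow hc (abs_nonneg _)]
    have hT := norm_expect_sub_gaussian_le (P := P) hq hq3 (hSm.const_mul c)
      ((h.memLp_sum _ 2).const_mul c)
      (by rw [integral_const_mul, hS, integral_finsetSum _ fun j _ =>
            (h.memLp j 2).integrable (by norm_num)]
          simp [h.centred])
      (by
        obtain ⟨B, hB⟩ := h.sum_bounded (Finset.range b)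
        refine Integrable.of_bound
          (((hSm.const_mul c).norm.pow_const q).aestronglyMeasurable) ((c * B) ^ q)
          (ae_of_all _ fun ω => ?_)
        rw [Real.norm_eq_abs, abs_of_nonneg (by positivity)]
        refine Real.rpow_le_rpow (abs_nonneg _) ?_ (by linarith)
        rw [abs_mul, abs_of_nonneg hc]
        exact mul_le_mul_of_nonneg_left (hB ω) hc)
    rw [hcS] at hT
    simp_rw [habs] at hT
    rw [integral_const_mul] at hT
    have hmom := h.integral_abs_sum_rpow_le (by linarith : 1 ≤ q) b
    have hcq : 0 ≤ c ^ q := Real.rpow_nonneg hc q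
    have hint0 : 0 ≤ ∫ ω, |S ω| ^ q ∂P := integral_nonneg fun ω => by positivity
    calc (m : ℝ) * _ ≤ N * (4 * (c ^ q * ∫ ω, |S ω| ^ q ∂P) + (c ^ 2 * v) ^ 2) :=
          mul_le_mul hmN' hT (norm_nonneg _) (by positivity)
      _ ≤ N * (4 * (c ^ q * ((b : ℝ) ^ (q - 1) * (b * C)))
          + (c ^ 2 * (b * (5 * C + N * ρ))) ^ 2) := by gcongr
      _ = _ := by ring
  have h4 : ‖((Real.exp (-(c ^ 2 * v) / 2) : ℝ) : ℂ) ^ m - ((Real.exp (-V / 2) : ℝ) : ℂ)‖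
      ≤ (m * c ^ 2) * (14 * C + 2 * b ^ 2 * ρ)
          + |b * (m * c ^ 2) * (γ 0 + 2 * γ 1 + 2 * γ 2) - V| := by
    rw [← Complex.ofReal_pow, ← Complex.ofReal_sub, Complex.norm_real, Real.norm_eq_abs,
      ← Real.exp_nat_mul]
    have hlip : ∀ x y : ℝ, 0 ≤ x → 0 ≤ y → |Real.exp (-x) - Real.exp (-y)| ≤ |x - y| := by
      have aux : ∀ x y : ℝ, 0 ≤ x → x ≤ y → |Real.exp (-x) - Real.exp (-y)| ≤ |x - y| := by
        intro x y hx hxy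
        have e1 : Real.exp (-y) = Real.exp (-x) * Real.exp (-(y - x)) := by
          rw [← Real.exp_add]; congr 1; ring
        have e2 : Real.exp (-y) ≤ Real.exp (-x) := Real.exp_le_exp.2 (by linarith)
        have e3 : Real.exp (-x) ≤ 1 := Real.exp_le_one_iff.2 (by linarith)
        have e4 := Real.add_one_le_exp (-(y - x))
        rw [abs_of_nonneg (by linarith), abs_of_nonpos (by linarith), e1]
        nlinarith [Real.exp_pos (-x)]
      intro x y hx hy
      rcases le_total x y with hxy | hxy
      · exact aux x y hx hxy
      · rw [abs_sub_comm, abs_sub_comm x y]; exact aux y x hy hxy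
    have e1 : (m : ℝ) * (-(c ^ 2 * v) / 2) = -(m * c ^ 2 * v / 2) := by ring
    rw [e1, neg_div]
    refine (hlip _ _ (by positivity) (by positivity)).trans ?_
    have hvar := h.abs_integral_sum_sq_sub_le hb hbN
    have e2 : m * c ^ 2 * v / 2 - V / 2
        = (m * c ^ 2 * (v - b * (γ 0 + 2 * γ 1 + 2 * γ 2))
          + (b * (m * c ^ 2) * (γ 0 + 2 * γ 1 + 2 * γ 2) - V)) / 2 := by ring
    rw [e2, abs_div, abs_of_pos (by norm_num : (0 : ℝ) < 2)]
    have hmc : 0 ≤ m * c ^ 2 := by positivity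
    have h5 : |m * c ^ 2 * (v - b * (γ 0 + 2 * γ 1 + 2 * γ 2))|
        ≤ m * c ^ 2 * (14 * C + 2 * b ^ 2 * ρ) := by
      rw [abs_mul, abs_of_nonneg hmc]
      exact mul_le_mul_of_nonneg_left hvar hmc
    have h6 := abs_add_le (m * c ^ 2 * (v - b * (γ 0 + 2 * γ 1 + 2 * γ 2)))
      (b * (m * c ^ 2) * (γ 0 + 2 * γ 1 + 2 * γ 2) - V)
    have h7 := abs_nonneg (m * c ^ 2 * (v - b * (γ 0 + 2 * γ 1 + 2 * γ 2))
      + (b * (m * c ^ 2) * (γ 0 + 2 * γ 1 + 2 * γ 2) - V))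
    linarith
  calc _ = ‖(expect P (fun ω => c * ∑ j ∈ Finset.range N, Y j ω)
          - expect P (fun ω => c * ∑ j ∈ A, Y j ω))
        + (expect P (fun ω => c * ∑ j ∈ A, Y j ω) - expect P (fun ω => c * S ω) ^ m)
        + (expect P (fun ω => c * S ω) ^ m - ((Real.exp (-(c ^ 2 * v) / 2) : ℝ) : ℂ) ^ m)
        + (((Real.exp (-(c ^ 2 * v) / 2) : ℝ) : ℂ) ^ m - ((Real.exp (-V / 2) : ℝ) : ℂ))‖ := by
        congr 1; ring
    _ ≤ _ := (norm_add_le _ _).trans (add_le_add ((norm_add_le _ _).trans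
        (add_le_add ((norm_add_le _ _).trans (add_le_add h1 h2)) h3)) h4)

end WeaklyDependentRow

lemma tendsto_natDiv_mul {N : ℕ → ℕ} {d : ℕ → ℝ} (hN : Tendsto N atTop atTop)
    (hd : Tendsto (fun n => N n * d n) atTop (𝓝 1)) (K : ℕ) (hK : 0 < K) :
    Tendsto (fun n => ((N n / K : ℕ) : ℝ) * d n) atTop (𝓝 (1 / K)) := by
  have hN' : Tendsto (fun n => (N n : ℝ)) atTop atTop := tendsto_natCast_atTop_atTop.comp hN
  have h1 : Tendsto (fun n => ((N n / K : ℕ) : ℝ) / N n) atTop (𝓝 (1 / K)) := by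
    have := (tendsto_nat_floor_mul_div_atTop (R := ℝ) (a := 1 / K) (by positivity)).comp hN'
    refine this.congr fun n => ?_
    simp only [Function.comp]
    congr 2
    rw [one_div, inv_mul_eq_div, Nat.floor_div_natCast, Nat.floor_natCast]
  have h2 := h1.mul hd
  rw [mul_one] at h2
  refine h2.congr' ?_
  filter_upwards [hN.eventually_gt_atTop 0] with n hn
  have : (N n : ℝ) ≠ 0 := by positivity
  field_simp

/-- **Central limit theorem** for the rows of a triangular array that are weakly dependent beyond
lag `2`: a nonnegative limit variance and convergence of the characteristic functions. -/
theorem tendsto_expect_sum {Y : ℕ → ℕ → Ω → ℝ} {γ : ℕ → ℕ → ℝ} {N : ℕ → ℕ} {c ρ : ℕ → ℝ}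
    {C q V : ℝ} (hq : 2 < q) (hq3 : q ≤ 3) (hN : Tendsto N atTop atTop) (hc : ∀ n, 0 ≤ c n)
    (hNc : Tendsto (fun n => N n * c n ^ 2) atTop (𝓝 1))
    (hNρ : Tendsto (fun n => N n * ρ n) atTop (𝓝 0))
    (hV : Tendsto (fun n => γ n 0 + 2 * γ n 1 + 2 * γ n 2) atTop (𝓝 V))
    (h : ∀ᶠ n in atTop, WeaklyDependentRow P (Y n) (γ n) (N n) (ρ n) C q) :
    0 ≤ V ∧ Tendsto (fun n => expect P (fun ω => c n * ∑ j ∈ Finset.range (N n), Y n j ω)) atTop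
      (𝓝 ((Real.exp (-V / 2) : ℝ) : ℂ)) := by
  have hN' : Tendsto (fun n => (N n : ℝ)) atTop atTop := tendsto_natCast_atTop_atTop.comp hN
  have hC : 0 ≤ C := let ⟨_, hn⟩ := h.exists; hn.C_nonneg
  have hρ : Tendsto ρ atTop (𝓝 0) := by
    have := hNρ.mul (tendsto_inv_atTop_zero.comp hN')
    rw [zero_mul] at this
    refine this.congr' ?_
    filter_upwards [hN.eventually_gt_atTop 0] with n hn
    have : (N n : ℝ) ≠ 0 := by positivity
    simp only [Function.comp]; field_simp
  have hc2 : Tendsto (fun n => c n ^ 2) atTop (𝓝 0) := by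
    have := hNc.mul (tendsto_inv_atTop_zero.comp hN')
    rw [mul_zero] at this
    refine this.congr' ?_
    filter_upwards [hN.eventually_gt_atTop 0] with n hn
    have : (N n : ℝ) ≠ 0 := by positivity
    simp only [Function.comp]; field_simp
  have hc0 : Tendsto c atTop (𝓝 0) := by
    have := (Real.continuous_sqrt.tendsto 0).comp hc2
    rw [Real.sqrt_zero] at this
    exact this.congr fun n => Real.sqrt_sq (hc n)
  have hNcq : Tendsto (fun n => N n * c n ^ q) atTop (𝓝 0) := by
    have h1 : Tendsto (fun n => c n ^ (q - 2)) atTop (𝓝 0) := by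
      have := hc0.rpow_const (p := q - 2) (Or.inr (by linarith))
      rwa [Real.zero_rpow (by linarith)] at this
    have := hNc.mul h1
    rw [mul_zero] at this
    refine this.congr fun n => ?_
    rw [mul_assoc, ← Real.rpow_natCast (c n) 2]
    rcases eq_or_lt_of_le (hc n) with h0 | h0
    · rw [← h0, Real.zero_rpow (by linarith : q ≠ 0)]; simp
    · rw [← Real.rpow_add h0]; norm_num
  have hNc4 : Tendsto (fun n => N n * c n ^ 4) atTop (𝓝 0) := by
    have := hNc.mul hc2
    rw [mul_zero] at this
    exact this.congr fun n => by ring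
  have hV0 : 0 ≤ V := by
    have key : ∀ b : ℕ, 2 ≤ b → -(14 * C) ≤ b * V := by
      intro b hb
      have h1 : Tendsto (fun n => -(14 * C + 2 * b ^ 2 * ρ n)) atTop (𝓝 (-(14 * C))) := by
        have := ((hρ.const_mul (2 * (b : ℝ) ^ 2)).const_add (14 * C)).neg
        simpa using this
      refine le_of_tendsto_of_tendsto h1 (hV.const_mul (b : ℝ)) ?_
      filter_upwards [h, hN.eventually_ge_atTop b] with n hn hbn
      have h2 := abs_le.1 (hn.abs_integral_sum_sq_sub_le hb hbn)
      have h3 : 0 ≤ ∫ ω, (∑ j ∈ Finset.range b, Y n j ω) ^ 2 ∂P :=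
        integral_nonneg fun ω => sq_nonneg _
      linarith [h2.2]
    by_contra hneg
    push Not at hneg
    obtain ⟨b, hb⟩ := exists_nat_gt (14 * C / (-V))
    have := key (b + 2) (by omega)
    rw [div_lt_iff₀ (by linarith)] at hb
    push_cast at this
    nlinarith
  refine ⟨hV0, ?_⟩
  rw [Metric.tendsto_atTop']
  have hlim : ∀ b : ℕ, Tendsto (fun n =>
      Real.sqrt ((N n * c n ^ 2 - b * ((N n / (b + 3) : ℕ) * c n ^ 2)) * (5 * C + N n * ρ n))
        + N n * ρ n
        + (4 * ((N n * c n ^ q) * ((b : ℝ) ^ (q - 1) * (b * C)))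
          + (N n * c n ^ 4) * (b * (5 * C + N n * ρ n)) ^ 2)
        + (((N n / (b + 3) : ℕ) * c n ^ 2) * (14 * C + 2 * b ^ 2 * ρ n)
          + |b * ((N n / (b + 3) : ℕ) * c n ^ 2) * (γ n 0 + 2 * γ n 1 + 2 * γ n 2) - V|)) atTop
      (𝓝 (Real.sqrt ((1 - b * (1 / (b + 3 : ℕ))) * (5 * C + 0)) + 0
        + (4 * (0 * ((b : ℝ) ^ (q - 1) * (b * C))) + 0 * (b * (5 * C + 0)) ^ 2)
        + ((1 / (b + 3 : ℕ)) * (14 * C + 2 * b ^ 2 * 0)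
          + |b * (1 / (b + 3 : ℕ)) * V - V|))) := by
    intro b
    have hm := tendsto_natDiv_mul hN hNc (b + 3) (by omega)
    have h5 := hNρ.const_add (5 * C)
    refine (((((Real.continuous_sqrt.tendsto _).comp
      ((hNc.sub (hm.const_mul _)).mul h5)).add hNρ).add ?_)).add ?_
    · exact ((hNcq.mul_const _).const_mul 4).add (hNc4.mul ((h5.const_mul _).pow 2))
    · exact (hm.mul ((hρ.const_mul _).const_add _)).add (((hm.const_mul _).mul hV).sub_const V).abs
  have hb : Tendsto (fun b : ℕ => Real.sqrt ((1 - b * (1 / (b + 3 : ℕ))) * (5 * C + 0)) + 0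
        + (4 * (0 * ((b : ℝ) ^ (q - 1) * (b * C))) + 0 * (b * (5 * C + 0)) ^ 2)
        + ((1 / (b + 3 : ℕ)) * (14 * C + 2 * b ^ 2 * 0)
          + |b * (1 / (b + 3 : ℕ)) * V - V|)) atTop (𝓝 0) := by
    have hinv : Tendsto (fun b : ℕ => (1 : ℝ) / (b + 3 : ℕ)) atTop (𝓝 0) :=
      tendsto_one_div_atTop_nhds_zero_nat.comp (tendsto_add_atTop_nat 3)
    have hb1 : Tendsto (fun b : ℕ => (b : ℝ) * (1 / (b + 3 : ℕ))) atTop (𝓝 1) := by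
      have := (hinv.const_mul 3).const_sub 1
      rw [mul_zero, sub_zero] at this
      refine this.congr fun b => ?_
      have : ((b + 3 : ℕ) : ℝ) ≠ 0 := by positivity
      field_simp
      push_cast; ring
    have h1 := ((Real.continuous_sqrt.tendsto _).comp ((hb1.const_sub 1).mul_const (5 * C)))
    have h2 := (hinv.mul_const (14 * C)).add (((hb1.mul_const V).sub_const V).abs)
    have := h1.add h2
    simpa using this
  intro ε hε
  obtain ⟨b, hbε, hb2⟩ := ((hb.eventually (gt_mem_nhds hε)).and (eventually_ge_atTop 2)).exists
  have hev := ((hlim b).eventually (gt_mem_nhds hbε)).and (h.and (hN.eventually_ge_atTop b))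
  obtain ⟨n₀, hn₀⟩ := eventually_atTop.1 hev
  refine ⟨n₀, fun n hn => ?_⟩
  obtain ⟨h1, h2, h3⟩ := hn₀ n hn.le
  rw [dist_eq_norm]
  exact (h2.norm_expect_sum_sub_le hq.le hq3 hb2 h3 (hc n) hV0).trans_lt h1

end

/-! ### Exceedances and empty blocks of a sequence -/

/-- The number of exceedances of `u` by the terms `x i`, `a ≤ i < b`. -/
noncomputable def exc (u : ℝ) (a b : ℕ) (x : ℕ → ℝ) : ℝ :=
  ∑ i ∈ Finset.Ico a b, if u < x i then 1 else 0

/-- The indicator that no term `x i`, `a ≤ i < b`, exceeds `u`. -/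
noncomputable def emp (u : ℝ) (a b : ℕ) (x : ℕ → ℝ) : ℝ :=
  ∏ i ∈ Finset.Ico a b, if x i ≤ u then 1 else 0

/-- The sequence `x` shifted by `h`. -/
def shiftSeq (h : ℕ) (x : ℕ → ℝ) : ℕ → ℝ := fun i => x (i + h)

/-- The path `X 1, X 2, …` of the process, indexed from `0`. -/
def path {Ω : Type*} (X : ℕ → Ω → ℝ) (ω : Ω) : ℕ → ℝ := fun i => X (i + 1) ω

section
variable {u : ℝ} {a b c d : ℕ} {x : ℕ → ℝ}

lemma exc_nonneg : 0 ≤ exc u a b x :=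
  Finset.sum_nonneg fun i _ => by split_ifs <;> norm_num

lemma exc_le : exc u a b x ≤ (b - a : ℕ) := by
  refine (Finset.sum_le_card_nsmul _ _ 1 fun i _ => ?_).trans (by simp)
  split_ifs <;> norm_num

lemma exc_add (hab : a ≤ b) (hbc : b ≤ c) : exc u a c x = exc u a b x + exc u b c x :=
  (Finset.sum_Ico_consecutive _ hab hbc).symm

lemma exc_mono (hca : c ≤ a) (hbd : b ≤ d) : exc u a b x ≤ exc u c d x :=
  Finset.sum_le_sum_of_subset_of_nonneg (Finset.Ico_subset_Ico hca hbd)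
    fun i _ _ => by split_ifs <;> norm_num

lemma exc_le_sq : exc u a b x ≤ exc u a b x ^ 2 := by
  have : exc u a b x = ((∑ i ∈ Finset.Ico a b, if u < x i then 1 else 0 : ℕ) : ℝ) := by
    rw [exc]; push_cast; rfl
  rw [this, sq]
  exact_mod_cast Nat.le_mul_self _

lemma exc_shift (h : ℕ) : exc u (a + h) (b + h) x = exc u a b (shiftSeq h x) :=
  (Finset.sum_Ico_add' (fun i => if u < x i then (1 : ℝ) else 0) a b h).symm

lemma emp_shift (h : ℕ) : emp u (a + h) (b + h) x = emp u a b (shiftSeq h x) :=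
  (Finset.prod_Ico_add' (fun i => if x i ≤ u then (1 : ℝ) else 0) a b h).symm

lemma emp_mul (hab : a ≤ b) (hbc : b ≤ c) : emp u a b x * emp u b c x = emp u a c x :=
  Finset.prod_Ico_consecutive _ hab hbc

lemma emp_eq_ite : emp u a b x = if ∀ i ∈ Finset.Ico a b, x i ≤ u then 1 else 0 := by
  rw [emp, Finset.prod_ite_zero]; simp

lemma emp_nonneg : 0 ≤ emp u a b x := by rw [emp_eq_ite]; split_ifs <;> norm_num

lemma emp_le_one : emp u a b x ≤ 1 := by rw [emp_eq_ite]; split_ifs <;> norm_num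

lemma abs_emp_le_one : |emp u a b x| ≤ 1 := by
  rw [abs_of_nonneg emp_nonneg]; exact emp_le_one

lemma emp_sq : emp u a b x ^ 2 = emp u a b x := by rw [emp_eq_ite]; split_ifs <;> norm_num

lemma emp_self : emp u a a x = 1 := by simp [emp]

lemma emp_mul_exc : emp u a b x * exc u a b x = 0 := by
  rw [emp_eq_ite]
  split_ifs with h
  · rw [one_mul, exc]
    exact Finset.sum_eq_zero fun i hi => if_neg (not_lt.2 (h i hi))
  · simp

/-- Overlapping windows are simultaneously empty if and only if their union is. -/
lemma emp_mul_overlap (hac : a ≤ c) (hcb : c ≤ b) (hbd : b ≤ d) :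
    emp u a b x * emp u c d x = emp u a d x := by
  rw [← emp_mul hac hcb, ← emp_mul hcb hbd, ← emp_mul hac (hcb.trans hbd), ← emp_mul hcb hbd]
  have : emp u c b x * emp u c b x = emp u c b x := by rw [← sq, emp_sq]
  linear_combination (emp u a c x * emp u b d x) * this

lemma one_sub_emp_le_exc : 1 - emp u a b x ≤ exc u a b x := by
  rw [emp_eq_ite]
  split_ifs with h
  · simpa using exc_nonneg
  · push Not at h
    obtain ⟨i, hi, hu⟩ := h
    have := Finset.single_le_sum (f := fun i => if u < x i then (1 : ℝ) else 0)
      (fun i _ => by split_ifs <;> norm_num) hi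
    simp only [if_pos hu] at this
    simpa [exc] using this

lemma emp_anti (hca : c ≤ a) (hbd : b ≤ d) : emp u c d x ≤ emp u a b x := by
  rw [emp_eq_ite, emp_eq_ite]
  split_ifs with h1 h2
  · norm_num
  · exact absurd (fun i hi => h1 i (Finset.Ico_subset_Ico hca hbd hi)) h2
  · norm_num
  · norm_num

/-- Trimming `l` indices at the left end of a window changes its state only if one of them is an
exceedance. -/
lemma abs_emp_sub_emp_le (l : ℕ) : |emp u c d x - emp u (c + l) d x| ≤ exc u c (c + l) x := by
  rw [abs_sub_comm, abs_of_nonneg (sub_nonneg.2 (emp_anti (by omega) le_rfl))]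
  rcases le_total (c + l) d with h | h
  · rw [← emp_mul (a := c) (b := c + l) (c := d) (by omega) h]
    nlinarith [one_sub_emp_le_exc (u := u) (a := c) (b := c + l) (x := x),
      emp_nonneg (u := u) (a := c) (b := c + l) (x := x), exc_nonneg (u := u) (a := c) (b := c + l)
      (x := x), emp_nonneg (u := u) (a := c + l) (b := d) (x := x),
      emp_le_one (u := u) (a := c + l) (b := d) (x := x),
      emp_le_one (u := u) (a := c) (b := c + l) (x := x)]
  · have h1 := emp_le_one (u := u) (a := c + l) (b := d) (x := x)
    have h2 := one_sub_emp_le_exc (u := u) (a := c) (b := d) (x := x)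
    have h3 := exc_mono (u := u) (x := x) (le_refl c) h
    linarith

lemma measurable_exc (u : ℝ) (a b : ℕ) : Measurable (exc u a b) :=
  Finset.measurable_fun_sum _ fun i _ =>
    Measurable.ite (measurableSet_lt measurable_const (measurable_pi_apply i))
      measurable_const measurable_const

lemma measurable_emp (u : ℝ) (a b : ℕ) : Measurable (emp u a b) :=
  Finset.measurable_fun_prod _ fun i _ =>
    Measurable.ite (measurableSet_le (measurable_pi_apply i) measurable_const)
      measurable_const measurable_const

lemma measurable_shiftSeq (h : ℕ) : Measurable (shiftSeq h) :=
  measurable_pi_iff.2 fun i => measurable_pi_apply (i + h)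

lemma shiftSeq_shiftSeq (h k : ℕ) (x : ℕ → ℝ) :
    shiftSeq h (shiftSeq k x) = shiftSeq (h + k) x := by
  funext i; simp [shiftSeq, add_assoc]

end

section
variable {Ω : Type*} [MeasurableSpace Ω] {P : Measure Ω} [IsProbabilityMeasure P]
  {X : ℕ → Ω → ℝ} {u : ℝ}

lemma measurable_path (hX : ∀ i, Measurable (X i)) : Measurable (path X) :=
  measurable_pi_iff.2 fun i => hX (i + 1)

lemma exceedances_eq (s : ℕ) (ω : Ω) : exceedances X s u ω = exc u 0 s (path X ω) := by
  exact (Finset.sum_Ico_add' (fun i => ind {ω' | u < X i ω'} ω) 0 s 1).symm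

lemma blockMax_le_iff {a b : ℕ} (hab : a < b) (ω : Ω) :
    blockMax X a b ω ≤ u ↔ ∀ i ∈ Finset.Ico a b, path X ω i ≤ u := by
  rw [blockMax, csSup_le_iff ((Set.finite_Ioc a b).image _).bddAbove
    (Set.Nonempty.image _ ⟨b, by simp [hab]⟩)]
  constructor
  · intro h i hi
    rw [Finset.mem_Ico] at hi
    exact h _ ⟨i + 1, by simp; omega, rfl⟩
  · rintro h _ ⟨i, hi, rfl⟩
    rw [Set.mem_Ioc] at hi
    have := h (i - 1) (by rw [Finset.mem_Ico]; omega)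
    rwa [path, Nat.sub_add_cancel (by omega)] at this

lemma ind_blockMax_eq {a b : ℕ} (hab : a < b) (ω : Ω) :
    ind {ω' | blockMax X a b ω' ≤ u} ω = emp u a b (path X ω) := by
  rw [emp_eq_ite, ind, Set.indicator_apply]
  simp only [Set.mem_ofPred_eq, blockMax_le_iff hab]

lemma measurable_emp_path (hX : ∀ i, Measurable (X i)) (a b : ℕ) :
    Measurable fun ω => emp u a b (path X ω) :=
  (measurable_emp u a b).comp (measurable_path hX)

lemma measurable_exc_path (hX : ∀ i, Measurable (X i)) (a b : ℕ) :
    Measurable fun ω => exc u a b (path X ω) :=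
  (measurable_exc u a b).comp (measurable_path hX)

lemma memLp_emp (hX : ∀ i, Measurable (X i)) (a b : ℕ) (p : ENNReal) :
    MemLp (fun ω => emp u a b (path X ω)) p P :=
  MemLp.of_bound (measurable_emp_path hX a b).aestronglyMeasurable 1
    (ae_of_all _ fun _ => abs_emp_le_one)

lemma memLp_exc (hX : ∀ i, Measurable (X i)) (a b : ℕ) (p : ENNReal) :
    MemLp (fun ω => exc u a b (path X ω)) p P :=
  MemLp.of_bound (measurable_exc_path hX a b).aestronglyMeasurable (b - a : ℕ)
    (ae_of_all _ fun _ => by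
      rw [Real.norm_eq_abs, abs_of_nonneg exc_nonneg]
      exact exc_le)

lemma integrable_emp (hX : ∀ i, Measurable (X i)) (a b : ℕ) :
    Integrable (fun ω => emp u a b (path X ω)) P :=
  memLp_one_iff_integrable.1 (memLp_emp hX a b 1)

lemma integrable_exc (hX : ∀ i, Measurable (X i)) (a b : ℕ) :
    Integrable (fun ω => exc u a b (path X ω)) P :=
  memLp_one_iff_integrable.1 (memLp_exc hX a b 1)

lemma integrable_exc_sq (hX : ∀ i, Measurable (X i)) (a b : ℕ) :
    Integrable (fun ω => exc u a b (path X ω) ^ 2) P :=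
  (memLp_exc hX a b 2).integrable_sq

/-! ### Stationarity -/

lemma integral_shift {E : Type*} [NormedAddCommGroup E] [NormedSpace ℝ E]
    (hX : ∀ i, Measurable (X i)) (hstat : StrictlyStationary P X) {F : (ℕ → ℝ) → E}
    (hF : StronglyMeasurable F) (h : ℕ) :
    ∫ ω, F (shiftSeq h (path X ω)) ∂P = ∫ ω, F (path X ω) ∂P := by
  have h1 : P.map (fun ω => shiftSeq h (path X ω)) = P.map (path X) := by
    refine Eq.trans ?_ (hstat h)
    congr 1
    funext ω i
    simp only [shiftSeq, path]
    congr 1; omega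
  rw [← integral_map (φ := path X) (measurable_path hX).aemeasurable hF.aestronglyMeasurable, ← h1,
    integral_map (φ := fun ω => shiftSeq h (path X ω))
      ((measurable_shiftSeq h).comp (measurable_path hX)).aemeasurable hF.aestronglyMeasurable]

lemma covariance_shift (hX : ∀ i, Measurable (X i)) (hstat : StrictlyStationary P X)
    {F G : (ℕ → ℝ) → ℝ} (hF : Measurable F) (hG : Measurable G) (h : ℕ) :
    cov[fun ω => F (shiftSeq h (path X ω)), fun ω => G (shiftSeq h (path X ω)); P]
      = cov[fun ω => F (path X ω), fun ω => G (path X ω); P] := by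
  simp only [covariance]
  rw [integral_shift hX hstat hF.stronglyMeasurable, integral_shift hX hstat hG.stronglyMeasurable]
  exact integral_shift hX hstat (F := fun x => (F x - ∫ ω, F (path X ω) ∂P)
    * (G x - ∫ ω, G (path X ω) ∂P))
    ((hF.sub_const _).mul (hG.sub_const _)).stronglyMeasurable h

/-- The number of exceedances in a window depends in law on its length only. -/
lemma integral_exc_sq (hX : ∀ i, Measurable (X i)) (hstat : StrictlyStationary P X) (a m : ℕ) :
    ∫ ω, exc u a (a + m) (path X ω) ^ 2 ∂P = ∫ ω, exc u 0 m (path X ω) ^ 2 ∂P := by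
  rw [← integral_shift hX hstat (F := fun x => exc u 0 m x ^ 2)
    ((measurable_exc u 0 m).pow_const 2).stronglyMeasurable a]
  simp_rw [← exc_shift]
  rw [zero_add, add_comm]

lemma integral_emp (hX : ∀ i, Measurable (X i)) (hstat : StrictlyStationary P X) (a m : ℕ) :
    ∫ ω, emp u a (a + m) (path X ω) ∂P = ∫ ω, emp u 0 m (path X ω) ∂P := by
  rw [← integral_shift hX hstat (measurable_emp u 0 m).stronglyMeasurable a]
  simp_rw [← emp_shift]
  rw [zero_add, add_comm]

lemma tail_eq (hX : ∀ i, Measurable (X i)) : tail P X u = P.real {ω | u < X 1 ω} := by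
  rw [tail, ← probReal_compl_eq_one_sub (measurableSet_le (hX 1) measurable_const)]
  congr 1
  ext ω
  simp

lemma tail_nonneg (hX : ∀ i, Measurable (X i)) : 0 ≤ tail P X u := by
  rw [tail_eq hX]; exact measureReal_nonneg

lemma integral_exc (hX : ∀ i, Measurable (X i)) (hstat : StrictlyStationary P X) (a m : ℕ) :
    ∫ ω, exc u a (a + m) (path X ω) ∂P = m * tail P X u := by
  have h1 : ∀ i, ∫ ω, (if u < path X ω i then (1 : ℝ) else 0) ∂P = tail P X u := by
    intro i
    have hF : Measurable fun x : ℕ → ℝ => if u < x 0 then (1 : ℝ) else 0 :=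
      Measurable.ite (measurableSet_lt measurable_const (measurable_pi_apply 0))
        measurable_const measurable_const
    have h := integral_shift hX hstat hF.stronglyMeasurable i
    simp only [shiftSeq, zero_add] at h
    rw [h, tail_eq hX, ← integral_indicator_one (measurableSet_lt measurable_const (hX 1))]
    congr 1
  simp only [exc]
  rw [integral_finsetSum]
  · simp [h1]
  · intro i _
    refine Integrable.of_bound (Measurable.ite (measurableSet_lt measurable_const (hX (i + 1)))
      measurable_const measurable_const).aestronglyMeasurable 1 (ae_of_all _ fun ω => ?_)
    split_ifs <;> simp

lemma maxCDF_eq (hX : ∀ i, Measurable (X i)) {r : ℕ} (hr : 0 < r) :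
    maxCDF P X r u = ∫ ω, emp u 0 r (path X ω) ∂P := by
  have h1 : ∀ ω, emp u 0 r (path X ω) = {ω' | blockMax X 0 r ω' ≤ u}.indicator 1 ω := fun ω =>
    (ind_blockMax_eq hr ω).symm
  have hm : MeasurableSet {ω' | blockMax X 0 r ω' ≤ u} := by
    have : {ω' | blockMax X 0 r ω' ≤ u} = ⋂ i ∈ Finset.Ico 0 r, {ω' | path X ω' i ≤ u} := by
      ext ω
      simp only [Set.mem_ofPred_eq, blockMax_le_iff hr, Set.mem_iInter]
    rw [this]
    exact Finset.measurableSet_biInter _ fun i _ => measurableSet_le (hX (i + 1)) measurable_const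
  simp_rw [h1]
  rw [integral_indicator_one hm, maxCDF]

lemma integral_one_sub_emp_le (hX : ∀ i, Measurable (X i)) (hstat : StrictlyStationary P X)
    (m : ℕ) : 1 - ∫ ω, emp u 0 m (path X ω) ∂P ≤ m * tail P X u := by
  have h := integral_exc (u := u) hX hstat 0 m
  rw [zero_add] at h
  rw [← h]
  have e : 1 - ∫ ω, emp u 0 m (path X ω) ∂P = ∫ ω, (1 - emp u 0 m (path X ω)) ∂P := by
    rw [integral_sub (integrable_const _) (integrable_emp hX 0 m)]; simp
  rw [e]
  exact integral_mono ((integrable_const _).sub (integrable_emp hX 0 m)) (integrable_exc hX 0 m)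
    fun ω => one_sub_emp_le_exc

/-! ### The maximal correlation coefficient -/

lemma abs_covariance_le {ξ η : Ω → ℝ} (hξ : MemLp ξ 2 P) (hη : MemLp η 2 P) :
    |cov[ξ, η; P]| ≤ Real.sqrt (Var[ξ; P]) * Real.sqrt (Var[η; P]) := by
  rw [← Real.sqrt_mul (variance_nonneg _ _)]
  refine Real.abs_le_sqrt ?_
  have h : ∀ t : ℝ, 0 ≤ Var[ξ; P] * (t * t) + 2 * cov[ξ, η; P] * t + Var[η; P] := by
    intro t
    have h0 := variance_nonneg (fun ω => t * ξ ω + η ω) P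
    rw [variance_fun_add (hξ.const_mul t) hη, variance_const_mul, covariance_const_mul_left] at h0
    linarith
  have := discrim_le_zero h
  rw [discrim] at this
  nlinarith

lemma variance_le_integral_sq {ξ : Ω → ℝ} (hξ : MemLp ξ 2 P) :
    Var[ξ; P] ≤ ∫ ω, ξ ω ^ 2 ∂P :=
  variance_le_expectation_sq hξ.aestronglyMeasurable

lemma abs_covariance_le_integral_sq {ξ η : Ω → ℝ} (hξ : MemLp ξ 2 P) (hη : MemLp η 2 P) :
    |cov[ξ, η; P]| ≤ Real.sqrt (∫ ω, ξ ω ^ 2 ∂P) * Real.sqrt (∫ ω, η ω ^ 2 ∂P) :=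
  (abs_covariance_le hξ hη).trans (mul_le_mul (Real.sqrt_le_sqrt (variance_le_integral_sq hξ))
    (Real.sqrt_le_sqrt (variance_le_integral_sq hη)) (Real.sqrt_nonneg _) (Real.sqrt_nonneg _))

lemma sigmaField_le (hX : ∀ i, Measurable (X i)) (a b : ℕ) :
    sigmaField X u a b ≤ (inferInstance : MeasurableSpace Ω) := by
  refine MeasurableSpace.generateFrom_le ?_
  rintro _ ⟨i, _, rfl⟩
  exact measurableSet_le (hX i) measurable_const

lemma measurableSet_sigmaField {a b i : ℕ} (ha : a ≤ i) (hb : i ≤ b) :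
    MeasurableSet[sigmaField X u a b] {ω | X i ω ≤ u} :=
  MeasurableSpace.measurableSet_generateFrom ⟨i, ⟨ha, hb⟩, rfl⟩

lemma measurable_emp_sigmaField {a b c d : ℕ} (hac : c ≤ a + 1) (hbd : b ≤ d) :
    Measurable[sigmaField X u c d] fun ω => emp u a b (path X ω) := by
  refine Finset.measurable_fun_prod _ fun i hi => ?_
  rw [Finset.mem_Ico] at hi
  exact Measurable.ite (measurableSet_sigmaField (by omega) (by omega))
    measurable_const measurable_const

lemma measurable_exc_sigmaField {a b c d : ℕ} (hac : c ≤ a + 1) (hbd : b ≤ d) :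
    Measurable[sigmaField X u c d] fun ω => exc u a b (path X ω) := by
  refine Finset.measurable_fun_sum _ fun i hi => ?_
  rw [Finset.mem_Ico] at hi
  have e : {ω | u < path X ω i} = {ω | X (i + 1) ω ≤ u}ᶜ := by ext ω; simp [path]
  refine Measurable.ite ?_ measurable_const measurable_const
  rw [e]
  exact (measurableSet_sigmaField (by omega) (by omega)).compl

lemma maxCorr_nonneg (n l : ℕ) : 0 ≤ maxCorr P X n l u := by
  refine Real.sSup_nonneg ?_
  rintro _ ⟨_, _, _, _, _, _, _, _, _, _, _, rfl⟩
  exact abs_nonneg _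

lemma abs_covariance_le_maxCorr {n l t t' : ℕ} (ht : 1 ≤ t) (htt' : t + l ≤ t') (htn : t' ≤ n)
    {ξ η : Ω → ℝ} (hξ : Measurable[sigmaField X u 1 t] ξ)
    (hη : Measurable[sigmaField X u t' n] η) (hξ2 : MemLp ξ 2 P) (hη2 : MemLp η 2 P) :
    |cov[ξ, η; P]| ≤ maxCorr P X n l u * (Real.sqrt (Var[ξ; P]) * Real.sqrt (Var[η; P])) := by
  have hcs := abs_covariance_le hξ2 hη2
  rcases eq_or_lt_of_le (variance_nonneg ξ P) with h0 | h0
  · rw [← h0] at hcs ⊢; simpa using hcs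
  rcases eq_or_lt_of_le (variance_nonneg η P) with h1 | h1
  · rw [← h1] at hcs ⊢; simpa using hcs
  have hpos : 0 < Real.sqrt (Var[ξ; P]) * Real.sqrt (Var[η; P]) :=
    mul_pos (Real.sqrt_pos.2 h0) (Real.sqrt_pos.2 h1)
  rw [← div_le_iff₀ hpos]
  have e : |cov[ξ, η; P]| / (Real.sqrt (Var[ξ; P]) * Real.sqrt (Var[η; P])) = |corr P ξ η| := by
    rw [corr, abs_div, abs_of_pos hpos]
  rw [e]
  refine le_csSup ⟨1, ?_⟩ ⟨t, ht, by omega, ξ, η, hξ, hξ2, h0, ?_, hη2, h1, rfl⟩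
  · rintro _ ⟨_, _, _, ξ', η', _, h2, h3, _, h4, h5, rfl⟩
    rw [corr, abs_div, abs_of_pos (mul_pos (Real.sqrt_pos.2 h3) (Real.sqrt_pos.2 h5)),
      div_le_one (mul_pos (Real.sqrt_pos.2 h3) (Real.sqrt_pos.2 h5))]
    exact abs_covariance_le h2 h4
  · refine hη.mono (MeasurableSpace.generateFrom_mono ?_) le_rfl
    rintro _ ⟨i, hi, rfl⟩
    exact ⟨i, ⟨htt'.trans hi.1, hi.2⟩, rfl⟩

lemma abs_covariance_le_maxCorr_integral_sq {n l t t' : ℕ} (ht : 1 ≤ t) (htt' : t + l ≤ t')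
    (htn : t' ≤ n) {ξ η : Ω → ℝ} (hξ : Measurable[sigmaField X u 1 t] ξ)
    (hη : Measurable[sigmaField X u t' n] η) (hξ2 : MemLp ξ 2 P) (hη2 : MemLp η 2 P) :
    |cov[ξ, η; P]| ≤ maxCorr P X n l u *
      (Real.sqrt (∫ ω, ξ ω ^ 2 ∂P) * Real.sqrt (∫ ω, η ω ^ 2 ∂P)) := by
  refine (abs_covariance_le_maxCorr ht htt' htn hξ hη hξ2 hη2).trans
    (mul_le_mul_of_nonneg_left ?_ (maxCorr_nonneg n l))
  exact mul_le_mul (Real.sqrt_le_sqrt (variance_le_integral_sq hξ2))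
    (Real.sqrt_le_sqrt (variance_le_integral_sq hη2)) (Real.sqrt_nonneg _) (Real.sqrt_nonneg _)

lemma abs_covariance_le_of_abs_le_one {n l t t' : ℕ} (hX : ∀ i, Measurable (X i)) (ht : 1 ≤ t)
    (htt' : t + l ≤ t') (htn : t' ≤ n) {ξ η : Ω → ℝ} (hξ : Measurable[sigmaField X u 1 t] ξ)
    (hη : Measurable[sigmaField X u t' n] η) (hξ1 : ∀ ω, |ξ ω| ≤ 1) (hη1 : ∀ ω, |η ω| ≤ 1) :
    |cov[ξ, η; P]| ≤ maxCorr P X n l u := by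
  have hξ2 : MemLp ξ 2 P := MemLp.of_bound
    (hξ.mono (sigmaField_le hX _ _) le_rfl).aestronglyMeasurable 1 (ae_of_all _ hξ1)
  have hη2 : MemLp η 2 P := MemLp.of_bound
    (hη.mono (sigmaField_le hX _ _) le_rfl).aestronglyMeasurable 1 (ae_of_all _ hη1)
  have key : ∀ ζ : Ω → ℝ, MemLp ζ 2 P → (∀ ω, |ζ ω| ≤ 1) → Real.sqrt (∫ ω, ζ ω ^ 2 ∂P) ≤ 1 := by
    intro ζ hζ hζ1
    rw [Real.sqrt_le_one]
    calc ∫ ω, ζ ω ^ 2 ∂P ≤ ∫ _, 1 ∂P := integral_mono hζ.integrable_sq (integrable_const _)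
          fun ω => (sq_le_one_iff_abs_le_one _).2 (hζ1 ω)
      _ = 1 := by simp
  refine (abs_covariance_le_maxCorr_integral_sq ht htt' htn hξ hη hξ2 hη2).trans ?_
  refine mul_le_of_le_one_right (maxCorr_nonneg n l) ?_
  exact mul_le_one₀ (key ξ hξ2 hξ1) (Real.sqrt_nonneg _) (key η hη2 hη1)

lemma norm_expect_add_sub_mul_le {n l t t' : ℕ} (hX : ∀ i, Measurable (X i)) (ht : 1 ≤ t)
    (htt' : t + l ≤ t') (htn : t' ≤ n) {ξ η : Ω → ℝ} (hξ : Measurable[sigmaField X u 1 t] ξ)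
    (hη : Measurable[sigmaField X u t' n] η) :
    ‖expect P (fun ω => ξ ω + η ω) - expect P ξ * expect P η‖ ≤ 4 * maxCorr P X n l u := by
  have hξm : Measurable ξ := hξ.mono (sigmaField_le hX _ _) le_rfl
  have hηm : Measurable η := hη.mono (sigmaField_le hX _ _) le_rfl
  have hexp : ∀ ζ : Ω → ℝ, Measurable ζ → expect P ζ
      = ((∫ ω, Real.cos (ζ ω) ∂P : ℝ) : ℂ) + ((∫ ω, Real.sin (ζ ω) ∂P : ℝ) : ℂ) * Complex.I := by
    intro ζ hζ
    have hc : Integrable (fun ω => ((Real.cos (ζ ω) : ℝ) : ℂ)) P :=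
      (Integrable.of_bound (Real.measurable_cos.comp hζ).aestronglyMeasurable 1
        (ae_of_all _ fun ω => Real.abs_cos_le_one _)).ofReal
    have hs : Integrable (fun ω => ((Real.sin (ζ ω) : ℝ) : ℂ) * Complex.I) P :=
      (Integrable.of_bound (Real.measurable_sin.comp hζ).aestronglyMeasurable 1
        (ae_of_all _ fun ω => Real.abs_sin_le_one _)).ofReal.mul_const _
    rw [expect, ← integral_complex_ofReal, ← integral_complex_ofReal, ← integral_mul_const,
      ← integral_add hc hs]
    congr 1
    funext ω
    rw [Complex.exp_mul_I, Complex.ofReal_cos, Complex.ofReal_sin]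
  have cb : ∀ ζ : Ω → ℝ, Measurable ζ → MemLp (fun ω => Real.cos (ζ ω)) 2 P := fun ζ hζ =>
    MemLp.of_bound (Real.measurable_cos.comp hζ).aestronglyMeasurable 1
      (ae_of_all _ fun ω => Real.abs_cos_le_one _)
  have sb : ∀ ζ : Ω → ℝ, Measurable ζ → MemLp (fun ω => Real.sin (ζ ω)) 2 P := fun ζ hζ =>
    MemLp.of_bound (Real.measurable_sin.comp hζ).aestronglyMeasurable 1
      (ae_of_all _ fun ω => Real.abs_sin_le_one _)
  have hcξ : Measurable[sigmaField X u 1 t] fun ω => Real.cos (ξ ω) := Real.measurable_cos.comp hξ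
  have hsξ : Measurable[sigmaField X u 1 t] fun ω => Real.sin (ξ ω) := Real.measurable_sin.comp hξ
  have hcη : Measurable[sigmaField X u t' n] fun ω => Real.cos (η ω) := Real.measurable_cos.comp hη
  have hsη : Measurable[sigmaField X u t' n] fun ω => Real.sin (η ω) := Real.measurable_sin.comp hη
  have h1 := abs_covariance_le_of_abs_le_one (P := P) hX ht htt' htn hcξ hcη
    (fun ω => Real.abs_cos_le_one _) (fun ω => Real.abs_cos_le_one _)
  have h2 := abs_covariance_le_of_abs_le_one (P := P) hX ht htt' htn hsξ hsη
    (fun ω => Real.abs_sin_le_one _) (fun ω => Real.abs_sin_le_one _)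
  have h3 := abs_covariance_le_of_abs_le_one (P := P) hX ht htt' htn hcξ hsη
    (fun ω => Real.abs_cos_le_one _) (fun ω => Real.abs_sin_le_one _)
  have h4 := abs_covariance_le_of_abs_le_one (P := P) hX ht htt' htn hsξ hcη
    (fun ω => Real.abs_sin_le_one _) (fun ω => Real.abs_cos_le_one _)
  rw [covariance_eq_sub (cb ξ hξm) (cb η hηm)] at h1
  rw [covariance_eq_sub (sb ξ hξm) (sb η hηm)] at h2
  rw [covariance_eq_sub (cb ξ hξm) (sb η hηm)] at h3
  rw [covariance_eq_sub (sb ξ hξm) (cb η hηm)] at h4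
  simp only [Pi.mul_apply] at h1 h2 h3 h4
  rw [hexp (fun ω => ξ ω + η ω) (hξm.add hηm), hexp _ hξm, hexp _ hηm]
  have ec : ∫ ω, Real.cos (ξ ω + η ω) ∂P
      = ∫ ω, Real.cos (ξ ω) * Real.cos (η ω) ∂P - ∫ ω, Real.sin (ξ ω) * Real.sin (η ω) ∂P := by
    simp_rw [Real.cos_add]
    exact integral_sub ((cb ξ hξm).integrable_mul (cb η hηm))
      ((sb ξ hξm).integrable_mul (sb η hηm))
  have es : ∫ ω, Real.sin (ξ ω + η ω) ∂P
      = ∫ ω, Real.sin (ξ ω) * Real.cos (η ω) ∂P + ∫ ω, Real.cos (ξ ω) * Real.sin (η ω) ∂P := by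
    simp_rw [Real.sin_add]
    exact integral_add ((sb ξ hξm).integrable_mul (cb η hηm))
      ((cb ξ hξm).integrable_mul (sb η hηm))
  rw [ec, es]
  set A := ∫ ω, Real.cos (ξ ω) * Real.cos (η ω) ∂P
  set B := ∫ ω, Real.sin (ξ ω) * Real.sin (η ω) ∂P
  set C := ∫ ω, Real.sin (ξ ω) * Real.cos (η ω) ∂P
  set D := ∫ ω, Real.cos (ξ ω) * Real.sin (η ω) ∂P
  set a := ∫ ω, Real.cos (ξ ω) ∂P
  set b := ∫ ω, Real.sin (ξ ω) ∂P
  set a' := ∫ ω, Real.cos (η ω) ∂P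
  set b' := ∫ ω, Real.sin (η ω) ∂P
  have e : ((A - B : ℝ) : ℂ) + ((C + D : ℝ) : ℂ) * Complex.I
      - ((a : ℂ) + b * Complex.I) * (a' + b' * Complex.I)
      = (((A - a * a') - (B - b * b') : ℝ) : ℂ)
        + (((D - a * b') + (C - b * a') : ℝ) : ℂ) * Complex.I := by
    push_cast
    linear_combination (-(b : ℂ) * b') * Complex.I_sq
  rw [e]
  refine (norm_add_le _ _).trans ?_
  rw [norm_mul, Complex.norm_I, mul_one, Complex.norm_real, Complex.norm_real, Real.norm_eq_abs,
    Real.norm_eq_abs]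
  have := abs_sub (A - a * a') (B - b * b')
  have := abs_add_le (D - a * b') (C - b * a')
  linarith

end

section
variable {Ω : Type*} [MeasurableSpace Ω] {P : Measure Ω} [IsProbabilityMeasure P]
  {X : ℕ → Ω → ℝ}

/-! ### Second moments of exceedance counts -/

lemma integral_exc_sq_mono (hX : ∀ i, Measurable (X i)) {u : ℝ} {a b c d : ℕ} (hca : c ≤ a)
    (hbd : b ≤ d) :
    ∫ ω, exc u a b (path X ω) ^ 2 ∂P ≤ ∫ ω, exc u c d (path X ω) ^ 2 ∂P :=
  integral_mono (integrable_exc_sq hX a b) (integrable_exc_sq hX c d)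
    fun _ => pow_le_pow_left₀ exc_nonneg (exc_mono hca hbd) 2

lemma integral_exc_sq_nonneg (u : ℝ) (a b : ℕ) : 0 ≤ ∫ ω, exc u a b (path X ω) ^ 2 ∂P :=
  integral_nonneg fun _ => sq_nonneg _

lemma mul_integral_exc_sq_le (hX : ∀ i, Measurable (X i)) (hstat : StrictlyStationary P X) (u : ℝ)
    (m g : ℕ) :
    g * ∫ ω, exc u 0 m (path X ω) ^ 2 ∂P ≤ ∫ ω, exc u 0 (g * m) (path X ω) ^ 2 ∂P := by
  induction g with
  | zero => simpa using integral_exc_sq_nonneg u 0 (0 * m)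
  | succ g ih =>
    rw [add_mul, one_mul]
    have : ∫ ω, exc u 0 (g * m) (path X ω) ^ 2 ∂P + ∫ ω, exc u (g * m) (g * m + m) (path X ω) ^ 2 ∂P
        ≤ ∫ ω, exc u 0 (g * m + m) (path X ω) ^ 2 ∂P := by
      rw [← integral_add (integrable_exc_sq hX _ _) (integrable_exc_sq hX _ _)]
      refine integral_mono ((integrable_exc_sq hX _ _).add (integrable_exc_sq hX _ _))
        (integrable_exc_sq hX _ _) fun ω => ?_
      simp only
      rw [exc_add (a := 0) (b := g * m) (c := g * m + m) (Nat.zero_le _) (by omega)]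
      nlinarith [mul_nonneg (exc_nonneg (u := u) (a := 0) (b := g * m) (x := path X ω))
        (exc_nonneg (u := u) (a := g * m) (b := g * m + m) (x := path X ω))]
    have e := integral_exc_sq (u := u) hX hstat (g * m) m
    push_cast
    linarith

lemma integral_exc_sq_le_mul (hX : ∀ i, Measurable (X i)) (hstat : StrictlyStationary P X) (u : ℝ)
    (m g : ℕ) :
    ∫ ω, exc u 0 (g * m) (path X ω) ^ 2 ∂P ≤ g ^ 2 * ∫ ω, exc u 0 m (path X ω) ^ 2 ∂P := by
  have hsum : ∀ (g : ℕ) (x : ℕ → ℝ), exc u 0 (g * m) x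
      = ∑ j ∈ Finset.range g, exc u (j * m) (j * m + m) x := by
    intro g x
    induction g with
    | zero => simp [exc]
    | succ g ih =>
      rw [Finset.sum_range_succ, ← ih, add_mul, one_mul, ← exc_add (Nat.zero_le _) (by omega)]
  calc ∫ ω, exc u 0 (g * m) (path X ω) ^ 2 ∂P
      ≤ ∫ ω, g * ∑ j ∈ Finset.range g, exc u (j * m) (j * m + m) (path X ω) ^ 2 ∂P := by
        refine integral_mono (integrable_exc_sq hX _ _)
          ((integrable_finsetSum _ fun j _ => integrable_exc_sq hX _ _).const_mul _) fun ω => ?_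
        simp only
        rw [hsum]
        simpa using sq_sum_le_card_mul_sum_sq (s := Finset.range g)
          (f := fun j => exc u (j * m) (j * m + m) (path X ω))
    _ = g ^ 2 * ∫ ω, exc u 0 m (path X ω) ^ 2 ∂P := by
        rw [integral_const_mul, integral_finsetSum _ fun j _ => integrable_exc_sq hX _ _]
        simp_rw [integral_exc_sq hX hstat]
        rw [Finset.sum_const, Finset.card_range, nsmul_eq_mul]
        ring

lemma integral_emp_sq_le_one (hX : ∀ i, Measurable (X i)) (u : ℝ) (a b : ℕ) :
    ∫ ω, emp u a b (path X ω) ^ 2 ∂P ≤ 1 := by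
  calc ∫ ω, emp u a b (path X ω) ^ 2 ∂P ≤ ∫ _, 1 ∂P :=
        integral_mono (memLp_emp hX a b 2).integrable_sq (integrable_const _)
          fun ω => by simp only [emp_sq]; exact emp_le_one
    _ = 1 := by simp

/-! ### Nearly independent adjacent windows -/

lemma abs_covariance_le_of_trim {u : ℝ} {n l b : ℕ} (hb : 1 ≤ b) (hbn : b + l ≤ n)
    {A B B' : Ω → ℝ} (hA : Measurable[sigmaField X u 1 b] A)
    (hB' : Measurable[sigmaField X u (b + l) n] B') (hA2 : MemLp A 2 P) (hB2 : MemLp B 2 P)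
    (hB'2 : MemLp B' 2 P) :
    |cov[A, B; P]| ≤ Real.sqrt (∫ ω, A ω ^ 2 ∂P) *
      (maxCorr P X n l u * Real.sqrt (∫ ω, B' ω ^ 2 ∂P)
        + Real.sqrt (∫ ω, (B ω - B' ω) ^ 2 ∂P)) := by
  have e : B = fun ω => B' ω + (B ω - B' ω) := by funext ω; ring
  have hd : MemLp (fun ω => B ω - B' ω) 2 P := hB2.sub hB'2
  have h1 := abs_covariance_le_maxCorr_integral_sq (P := P) hb le_rfl hbn hA hB' hA2 hB'2
  have h2 := abs_covariance_le_integral_sq hA2 hd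
  have h3 : cov[A, B; P] = cov[A, B'; P] + cov[A, fun ω => B ω - B' ω; P] := by
    rw [← covariance_add_right hA2 hB'2 hd]
    congr 1
  rw [h3]
  refine (abs_add_le _ _).trans ((add_le_add h1 h2).trans (le_of_eq ?_))
  ring

lemma abs_covariance_emp_le (hX : ∀ i, Measurable (X i)) (hstat : StrictlyStationary P X) {u : ℝ}
    {n l b c d : ℕ} (hb : 1 ≤ b) (hbc : b ≤ c) (hbn : b + l ≤ n) (hdn : d ≤ n)
    {A : Ω → ℝ} (hA : Measurable[sigmaField X u 1 b] A) (hA2 : MemLp A 2 P) :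
    |cov[A, fun ω => emp u c d (path X ω); P]| ≤ Real.sqrt (∫ ω, A ω ^ 2 ∂P) *
      (maxCorr P X n l u + Real.sqrt (∫ ω, exc u 0 l (path X ω) ^ 2 ∂P)) := by
  refine (abs_covariance_le_of_trim hb hbn hA
    (measurable_emp_sigmaField (a := c + l) (b := d) (by omega) hdn) hA2
    (memLp_emp hX c d 2) (memLp_emp hX (c + l) d 2)).trans
    (mul_le_mul_of_nonneg_left (add_le_add ?_ (Real.sqrt_le_sqrt ?_)) (Real.sqrt_nonneg _))
  · exact mul_le_of_le_one_right (maxCorr_nonneg _ _)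
      (Real.sqrt_le_one.2 (integral_emp_sq_le_one hX _ _ _))
  · rw [← integral_exc_sq hX hstat c l]
    refine integral_mono ((memLp_emp hX c d 2).sub (memLp_emp hX (c + l) d 2)).integrable_sq
      (integrable_exc_sq hX _ _) fun ω => ?_
    exact sq_le_sq' (abs_le.1 (abs_emp_sub_emp_le l)).1 (abs_le.1 (abs_emp_sub_emp_le l)).2

lemma abs_exc_sub_exc_le {u : ℝ} {c d l : ℕ} {x : ℕ → ℝ} :
    |exc u c d x - exc u (c + l) d x| ≤ exc u c (c + l) x := by
  rcases le_total (c + l) d with h | h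
  · rw [exc_add (b := c + l) (c := d) (by omega) h, add_sub_cancel_right, abs_of_nonneg exc_nonneg]
  · have : exc u (c + l) d x = 0 := by rw [exc, Finset.Ico_eq_empty (by omega), Finset.sum_empty]
    rw [this, sub_zero, abs_of_nonneg exc_nonneg]
    exact exc_mono le_rfl h

lemma abs_covariance_exc_le (hX : ∀ i, Measurable (X i)) (hstat : StrictlyStationary P X) {u : ℝ}
    {n l b c d : ℕ} (hb : 1 ≤ b) (hbc : b ≤ c) (hbn : b + l ≤ n) (hdn : d ≤ n)
    {A : Ω → ℝ} (hA : Measurable[sigmaField X u 1 b] A) (hA2 : MemLp A 2 P) :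
    |cov[A, fun ω => exc u c d (path X ω); P]| ≤ Real.sqrt (∫ ω, A ω ^ 2 ∂P) *
      (maxCorr P X n l u * Real.sqrt (∫ ω, exc u 0 d (path X ω) ^ 2 ∂P)
        + Real.sqrt (∫ ω, exc u 0 l (path X ω) ^ 2 ∂P)) := by
  refine (abs_covariance_le_of_trim hb hbn hA
    (measurable_exc_sigmaField (a := c + l) (b := d) (by omega) hdn) hA2
    (memLp_exc hX c d 2) (memLp_exc hX (c + l) d 2)).trans
    (mul_le_mul_of_nonneg_left (add_le_add ?_ (Real.sqrt_le_sqrt ?_)) (Real.sqrt_nonneg _))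
  · exact mul_le_mul_of_nonneg_left (Real.sqrt_le_sqrt (integral_exc_sq_mono hX (Nat.zero_le _)
      le_rfl)) (maxCorr_nonneg _ _)
  · rw [← integral_exc_sq hX hstat c l]
    refine integral_mono ((memLp_exc hX c d 2).sub (memLp_exc hX (c + l) d 2)).integrable_sq
      (integrable_exc_sq hX _ _) fun ω => ?_
    exact sq_le_sq' (abs_le.1 abs_exc_sub_exc_le).1 (abs_le.1 abs_exc_sub_exc_le).2

/-- A sharper bound for adjacent exceedance counts, linear in the second moment of the trimmed
part: trimming `l` indices on either side of the common end isolates one product of two trimmed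
parts. -/
lemma abs_covariance_exc_exc_le (hX : ∀ i, Measurable (X i)) (hstat : StrictlyStationary P X)
    {u : ℝ} {n l b d : ℕ} (hl : 1 ≤ l) (hlb : l + 1 ≤ b) (hbd : b + l ≤ d) (hdn : d ≤ n) :
    |cov[fun ω => exc u 0 b (path X ω), fun ω => exc u b d (path X ω); P]|
      ≤ 2 * (maxCorr P X n l u * ∫ ω, exc u 0 d (path X ω) ^ 2 ∂P)
        + ∫ ω, exc u 0 l (path X ω) ^ 2 ∂P := by
  set ρ := maxCorr P X n l u
  set M := ∫ ω, exc u 0 d (path X ω) ^ 2 ∂P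
  have hρ : 0 ≤ ρ := maxCorr_nonneg n l
  have hM : 0 ≤ M := integral_exc_sq_nonneg u 0 d
  have hle : ∀ a b, b ≤ d → Real.sqrt (∫ ω, exc u a b (path X ω) ^ 2 ∂P) ≤ Real.sqrt M :=
    fun a b hb => Real.sqrt_le_sqrt (integral_exc_sq_mono hX (Nat.zero_le _) hb)
  have hprod : ∀ a b c e, b ≤ d → e ≤ d → ρ * (Real.sqrt (∫ ω, exc u a b (path X ω) ^ 2 ∂P)
      * Real.sqrt (∫ ω, exc u c e (path X ω) ^ 2 ∂P)) ≤ ρ * M := by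
    intro a b c e hb he
    refine mul_le_mul_of_nonneg_left ?_ hρ
    rw [← Real.mul_self_sqrt hM]
    exact mul_le_mul (hle _ _ hb) (hle _ _ he) (Real.sqrt_nonneg _) (Real.sqrt_nonneg _)
  have h1 : |cov[fun ω => exc u 0 b (path X ω), fun ω => exc u (b + l) d (path X ω); P]| ≤ ρ * M :=
    (abs_covariance_le_maxCorr_integral_sq (t := b) (t' := b + l) (by omega) le_rfl (by omega)
      (measurable_exc_sigmaField (by omega) le_rfl) (measurable_exc_sigmaField (by omega) hdn)
      (memLp_exc hX _ _ 2) (memLp_exc hX _ _ 2)).trans (hprod _ _ _ _ (by omega) le_rfl)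
  have h2 : |cov[fun ω => exc u 0 (b - l) (path X ω), fun ω => exc u b (b + l) (path X ω); P]|
      ≤ ρ * M :=
    (abs_covariance_le_maxCorr_integral_sq (t := b - l) (t' := b) (by omega) (by omega) (by omega)
      (measurable_exc_sigmaField (by omega) le_rfl)
      (measurable_exc_sigmaField (by omega) (by omega))
      (memLp_exc hX _ _ 2) (memLp_exc hX _ _ 2)).trans (hprod _ _ _ _ (by omega) hbd)
  have h3 : |cov[fun ω => exc u (b - l) b (path X ω), fun ω => exc u b (b + l) (path X ω); P]|
      ≤ ∫ ω, exc u 0 l (path X ω) ^ 2 ∂P := by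
    refine (abs_covariance_le_integral_sq (memLp_exc hX _ _ 2) (memLp_exc hX _ _ 2)).trans ?_
    have e1 := integral_exc_sq (u := u) hX hstat (b - l) l
    rw [Nat.sub_add_cancel (by omega)] at e1
    rw [e1, integral_exc_sq hX hstat b l, Real.mul_self_sqrt (integral_exc_sq_nonneg u 0 l)]
  have e : cov[fun ω => exc u 0 b (path X ω), fun ω => exc u b d (path X ω); P]
      = cov[fun ω => exc u 0 b (path X ω), fun ω => exc u (b + l) d (path X ω); P]
        + (cov[fun ω => exc u 0 (b - l) (path X ω), fun ω => exc u b (b + l) (path X ω); P]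
          + cov[fun ω => exc u (b - l) b (path X ω), fun ω => exc u b (b + l) (path X ω); P]) := by
    rw [← covariance_add_left (memLp_exc hX _ _ 2) (memLp_exc hX _ _ 2) (memLp_exc hX _ _ 2)]
    have e1 : (fun ω => exc u 0 (b - l) (path X ω)) + (fun ω => exc u (b - l) b (path X ω))
        = fun ω => exc u 0 b (path X ω) := by
      funext ω
      exact (exc_add (Nat.zero_le _) (by omega)).symm
    have e2 : (fun ω => exc u (b + l) d (path X ω)) + (fun ω => exc u b (b + l) (path X ω))
        = fun ω => exc u b d (path X ω) := by
      funext ω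
      rw [Pi.add_apply, add_comm]
      exact (exc_add (by omega) hbd).symm
    rw [e1, ← covariance_add_right (memLp_exc hX _ _ 2) (memLp_exc hX _ _ 2)
      (memLp_exc hX _ _ 2), e2]
  rw [e]
  have := abs_add_le (cov[fun ω => exc u 0 b (path X ω), fun ω => exc u (b + l) d (path X ω); P])
    (cov[fun ω => exc u 0 (b - l) (path X ω), fun ω => exc u b (b + l) (path X ω); P]
          + cov[fun ω => exc u (b - l) b (path X ω), fun ω => exc u b (b + l) (path X ω); P])
  have := abs_add_le
    (cov[fun ω => exc u 0 (b - l) (path X ω), fun ω => exc u b (b + l) (path X ω); P])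
    (cov[fun ω => exc u (b - l) b (path X ω), fun ω => exc u b (b + l) (path X ω); P])
  linarith

/-! ### The number of exceedances in a block -/

/-- The asymptotic regime: block lengths `r`, intermediate lengths `s` and gaps `l` with
`l ≪ s ≪ r ≪ n`, thresholds `u` with limiting block intensity `τ` and empty-block probability
`exp (-α)`, mixing across gaps of length `l`, and the limit `m₂` of the second moment of the number
of exceedances in a block of length `s` that has some. The threshold is indexed by the sample size
`n`. -/
structure Regime (P : Measure Ω) (X : ℕ → Ω → ℝ) (u : ℕ → ℝ) (r l s : ℕ → ℕ) (τ α m₂ M : ℝ) :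
    Prop where
  meas : ∀ i, Measurable (X i)
  stat : StrictlyStationary P X
  r_pos : ∀ n, 0 < r n
  l_pos : ∀ n, 0 < l n
  s_pos : ∀ n, 0 < s n
  l_div : Tendsto (fun n => (l n : ℝ) / s n) atTop (𝓝 0)
  s_div : Tendsto (fun n => (s n : ℝ) / r n) atTop (𝓝 0)
  r_div : Tendsto (fun n => (r n : ℝ) / n) atTop (𝓝 0)
  α_pos : 0 < α
  tail_lim : Tendsto (fun n => r n * tail P X (u n)) atTop (𝓝 τ)
  emp_lim : ∀ (m : ℕ → ℕ) (y : ℝ), 0 ≤ y → Tendsto (fun n => (m n : ℝ) / r n) atTop (𝓝 y) →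
    Tendsto (fun n => ∫ ω, emp (u n) 0 (m n) (path X ω) ∂P) atTop (𝓝 (Real.exp (-(α * y))))
  mix : Tendsto (fun n : ℕ => n / s n * maxCorr P X n (l n) (u n)) atTop (𝓝 0)
  cluster : Tendsto (fun n => (∫ ω, exc (u n) 0 (s n) (path X ω) ^ 2 ∂P)
    / (1 - ∫ ω, emp (u n) 0 (s n) (path X ω) ∂P)) atTop (𝓝 m₂)
  sq_le : ∀ᶠ n in atTop, ∫ ω, exc (u n) 0 (r n) (path X ω) ^ 2 ∂P ≤ M

lemma eventually_mul_le_of_tendsto_div {a b : ℕ → ℕ} (hb : ∀ᶠ n in atTop, 0 < b n)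
    (h : Tendsto (fun n => (a n : ℝ) / b n) atTop (𝓝 0)) (c : ℕ) :
    ∀ᶠ n in atTop, c * a n ≤ b n := by
  have hc : (0 : ℝ) < 1 / (c + 1) := by positivity
  filter_upwards [h.eventually (gt_mem_nhds hc), hb] with n hn hbn
  have hb0 : (0 : ℝ) < b n := by exact_mod_cast hbn
  rw [div_lt_div_iff₀ hb0 (by positivity)] at hn
  have h1 : (a n : ℝ) * (c + 1) < b n := by linarith
  have h2 : a n * (c + 1) < b n := by exact_mod_cast h1
  nlinarith

lemma tendsto_div_natDiv {a b : ℕ → ℕ} (ha : ∀ n, 0 < a n) (hb : ∀ᶠ n in atTop, 0 < b n)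
    (h : Tendsto (fun n => (a n : ℝ) / b n) atTop (𝓝 0)) :
    Tendsto (fun n => b n / a n) atTop atTop := by
  rw [tendsto_atTop]
  intro c
  filter_upwards [eventually_mul_le_of_tendsto_div hb h c] with n hn
  exact (Nat.le_div_iff_mul_le (ha n)).2 hn

lemma tendsto_natDiv_mul_div {a b : ℕ → ℕ} (ha : ∀ n, 0 < a n) (hb : ∀ᶠ n in atTop, 0 < b n)
    (h : Tendsto (fun n => (a n : ℝ) / b n) atTop (𝓝 0)) :
    Tendsto (fun n => ((b n / a n : ℕ) : ℝ) * (a n / b n)) atTop (𝓝 1) := by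
  refine tendsto_of_tendsto_of_tendsto_of_le_of_le' (g := fun n => 1 - (a n : ℝ) / b n)
    (by simpa using h.const_sub 1) tendsto_const_nhds ?_ ?_
  · filter_upwards [hb] with n hn
    have hb0 : (0 : ℝ) < b n := by exact_mod_cast hn
    have ha0 : (0 : ℝ) < a n := by exact_mod_cast ha n
    have h1 : b n < (b n / a n + 1) * a n := by
      have := Nat.lt_div_mul_add (a := b n) (ha n); rw [add_mul, one_mul]; exact this
    have h2 : (b n : ℝ) < ((b n / a n : ℕ) + 1) * a n := by exact_mod_cast h1
    rw [← mul_div_assoc, sub_le_iff_le_add, ← add_div, le_div_iff₀ hb0]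
    linarith
  · filter_upwards [hb] with n hn
    have hb0 : (0 : ℝ) < b n := by exact_mod_cast hn
    have h1 : (((b n / a n : ℕ) : ℝ)) * a n ≤ b n := by exact_mod_cast Nat.div_mul_le_self _ _
    rw [← mul_div_assoc, div_le_one hb0]
    exact h1

namespace Regime
variable {u : ℕ → ℝ} {r l s : ℕ → ℕ} {τ α m₂ M : ℝ}

lemma two_l_le_s (h : Regime P X u r l s τ α m₂ M) : ∀ᶠ n in atTop, 2 * l n ≤ s n :=
  eventually_mul_le_of_tendsto_div (Eventually.of_forall h.s_pos) h.l_div 2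

lemma two_s_le_r (h : Regime P X u r l s τ α m₂ M) : ∀ᶠ n in atTop, 2 * s n ≤ r n :=
  eventually_mul_le_of_tendsto_div (Eventually.of_forall h.r_pos) h.s_div 2

lemma mul_r_le (h : Regime P X u r l s τ α m₂ M) (c : ℕ) : ∀ᶠ n in atTop, c * r n ≤ n :=
  eventually_mul_le_of_tendsto_div (a := r) (b := fun n => n) (eventually_gt_atTop 0) h.r_div c

lemma q_tendsto (h : Regime P X u r l s τ α m₂ M) : Tendsto (fun n => r n / s n) atTop atTop :=
  tendsto_div_natDiv h.s_pos (Eventually.of_forall h.r_pos) h.s_div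

lemma k_tendsto (h : Regime P X u r l s τ α m₂ M) : Tendsto (fun n => n / r n) atTop atTop :=
  tendsto_div_natDiv (b := fun n => n) h.r_pos (eventually_gt_atTop 0) h.r_div

lemma q_s_div_r (h : Regime P X u r l s τ α m₂ M) :
    Tendsto (fun n => ((r n / s n : ℕ) : ℝ) * (s n / r n)) atTop (𝓝 1) :=
  tendsto_natDiv_mul_div h.s_pos (Eventually.of_forall h.r_pos) h.s_div

lemma rho_mul_tendsto (h : Regime P X u r l s τ α m₂ M) {a : ℕ → ℝ} (ha : ∀ n, 0 ≤ a n)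
    (hle : ∀ᶠ n : ℕ in atTop, a n ≤ n / s n) :
    Tendsto (fun n => a n * maxCorr P X n (l n) (u n)) atTop (𝓝 0) := by
  refine squeeze_zero' (Eventually.of_forall fun n => mul_nonneg (ha n) (maxCorr_nonneg _ _)) ?_
    h.mix
  filter_upwards [hle] with n hn
  exact mul_le_mul_of_nonneg_right hn (maxCorr_nonneg _ _)

lemma q_rho (h : Regime P X u r l s τ α m₂ M) :
    Tendsto (fun n => ((r n / s n : ℕ) : ℝ) * maxCorr P X n (l n) (u n)) atTop (𝓝 0) := by
  refine h.rho_mul_tendsto (fun n => Nat.cast_nonneg _) ?_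
  filter_upwards [h.mul_r_le 1] with n hn
  refine Nat.cast_div_le.trans ?_
  have : (r n : ℝ) ≤ n := by exact_mod_cast (by omega : r n ≤ n)
  gcongr

lemma k_rho (h : Regime P X u r l s τ α m₂ M) :
    Tendsto (fun n => ((n / r n : ℕ) : ℝ) * maxCorr P X n (l n) (u n)) atTop (𝓝 0) := by
  refine h.rho_mul_tendsto (fun n => Nat.cast_nonneg _) ?_
  filter_upwards [h.two_s_le_r] with n hn
  refine Nat.cast_div_le.trans ?_
  have h1 : (s n : ℝ) ≤ r n := by exact_mod_cast (by omega : s n ≤ r n)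
  have h2 : (0 : ℝ) < s n := by exact_mod_cast h.s_pos n
  gcongr

lemma rho (h : Regime P X u r l s τ α m₂ M) :
    Tendsto (fun n => maxCorr P X n (l n) (u n)) atTop (𝓝 0) := by
  refine (h.rho_mul_tendsto (a := fun _ => 1) (fun n => zero_le_one) ?_).congr fun n => one_mul _
  filter_upwards [h.mul_r_le 1, h.two_s_le_r] with n hn hs
  have h2 : (0 : ℝ) < s n := by exact_mod_cast h.s_pos n
  rw [le_div_iff₀ h2, one_mul]
  exact_mod_cast (by omega : s n ≤ n)

lemma s_tail (h : Regime P X u r l s τ α m₂ M) :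
    Tendsto (fun n => s n * tail P X (u n)) atTop (𝓝 0) := by
  have := h.s_div.mul h.tail_lim
  rw [zero_mul] at this
  refine this.congr fun n => ?_
  have : (r n : ℝ) ≠ 0 := by exact_mod_cast (h.r_pos n).ne'
  field_simp

lemma q_s_tail (h : Regime P X u r l s τ α m₂ M) :
    Tendsto (fun n => ((r n / s n : ℕ) : ℝ) * (s n * tail P X (u n))) atTop (𝓝 τ) := by
  have := h.q_s_div_r.mul h.tail_lim
  rw [one_mul] at this
  refine this.congr fun n => ?_
  have : (r n : ℝ) ≠ 0 := by exact_mod_cast (h.r_pos n).ne'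
  field_simp

lemma q_l_tail (h : Regime P X u r l s τ α m₂ M) :
    Tendsto (fun n => ((r n / s n : ℕ) : ℝ) * (l n * tail P X (u n))) atTop (𝓝 0) := by
  have := h.l_div.mul h.q_s_tail
  rw [zero_mul] at this
  refine this.congr fun n => ?_
  have : (s n : ℝ) ≠ 0 := by exact_mod_cast (h.s_pos n).ne'
  field_simp

/-- An intermediate block has an exceedance with probability asymptotic to `α s / r`: the block of
length `r` splits into `r / s` blocks that are nearly independent. -/
lemma q_one_sub_emp (h : Regime P X u r l s τ α m₂ M) :
    Tendsto (fun n => ((r n / s n : ℕ) : ℝ) * (1 - ∫ ω, emp (u n) 0 (s n) (path X ω) ∂P)) atTop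
      (𝓝 α) := by
  set e := fun n => ∫ ω, emp (u n) 0 (s n) (path X ω) ∂P with he
  have he0 : ∀ n, 0 ≤ e n := fun n => integral_nonneg fun _ => emp_nonneg
  have he1 : ∀ n, e n ≤ 1 := fun n => by
    calc e n ≤ ∫ _, 1 ∂P := integral_mono (integrable_emp h.meas _ _) (integrable_const _)
          fun _ => emp_le_one
      _ = 1 := by simp
  have het : Tendsto e atTop (𝓝 1) := by
    refine tendsto_of_tendsto_of_tendsto_of_le_of_le (by simpa using h.s_tail.const_sub 1)
      tendsto_const_nhds (fun n => ?_) he1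
    have := integral_one_sub_emp_le (u := u n) h.meas h.stat (s n)
    simp only [he]; linarith
  have hpow : Tendsto (fun n => e n ^ (r n / s n)) atTop (𝓝 (Real.exp (-α))) := by
    have h1 := h.emp_lim (fun n => r n / s n * s n) 1 zero_le_one
      (h.q_s_div_r.congr fun n => by push_cast; ring)
    rw [mul_one] at h1
    have h2 := (h.q_rho.add (h.q_l_tail.const_mul 2))
    rw [mul_zero, add_zero] at h2
    refine (tendsto_iff_of_dist (squeeze_zero' (Eventually.of_forall fun _ => dist_nonneg) ?_ h2)).1
      h1
    filter_upwards [h.mul_r_le 2, h.two_s_le_r, h.two_l_le_s] with n hrn hsr hls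
    set ρ := maxCorr P X n (l n) (u n)
    set t := tail P X (u n)
    have ht : 0 ≤ t := tail_nonneg h.meas
    have hρ : 0 ≤ ρ := maxCorr_nonneg _ _
    have hlp := h.l_pos n
    have hsp := h.s_pos n
    have hl1 := integral_exc (u := u n) h.meas h.stat
    have key : ∀ j : ℕ, j * s n ≤ r n →
        |∫ ω, emp (u n) 0 (j * s n) (path X ω) ∂P - e n ^ j| ≤ j * (ρ + 2 * (l n * t)) := by
      intro j
      induction j with
      | zero => intro _; simp [emp_self]
      | succ j ih =>
        intro hj
        have hj' : j * s n + s n ≤ r n := by rw [add_mul, one_mul] at hj; exact hj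
        have ih := ih (by omega)
        rcases Nat.eq_zero_or_pos j with rfl | hj0
        · simp only [zero_add, one_mul, pow_one, Nat.cast_one]
          rw [sub_self, abs_zero]
          positivity
        have hjs : 1 ≤ j * s n := Nat.mul_pos hj0 hsp
        set A := fun ω => emp (u n) 0 (j * s n) (path X ω) with hA
        set B := fun ω => emp (u n) (j * s n) (j * s n + s n) (path X ω) with hB
        set B' := fun ω => emp (u n) (j * s n + l n) (j * s n + s n) (path X ω) with hB'
        have hAi : MemLp A 2 P := memLp_emp h.meas _ _ 2
        have hBi : MemLp B 2 P := memLp_emp h.meas _ _ 2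
        have hB'i : MemLp B' 2 P := memLp_emp h.meas _ _ 2
        have hcov : |cov[A, B'; P]| ≤ ρ :=
          abs_covariance_le_of_abs_le_one (t := j * s n) (t' := j * s n + l n) h.meas hjs le_rfl
            (by omega) (measurable_emp_sigmaField (by omega) le_rfl)
            (measurable_emp_sigmaField (by omega) (by omega)) (fun _ => abs_emp_le_one)
            (fun _ => abs_emp_le_one)
        rw [covariance_eq_sub hAi hB'i] at hcov
        have hdiff : ∀ C : Ω → ℝ, MemLp C 2 P → (∀ ω, |C ω| ≤ 1) →
            |∫ ω, C ω * B ω ∂P - ∫ ω, C ω * B' ω ∂P| ≤ l n * t := by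
          intro C hC hC1
          have i1 : Integrable (fun ω => C ω * B ω) P := hC.integrable_mul hBi
          have i2 : Integrable (fun ω => C ω * B' ω) P := hC.integrable_mul hB'i
          rw [← integral_sub i1 i2, ← hl1 (j * s n)]
          refine abs_integral_le_integral_abs.trans (integral_mono (i1.sub i2).abs
            (integrable_exc h.meas _ _) fun ω => ?_)
          simp only
          rw [← mul_sub, abs_mul]
          exact (mul_le_of_le_one_left (abs_nonneg _) (hC1 ω)).trans (abs_emp_sub_emp_le _)
        have hd1 := hdiff A hAi fun _ => abs_emp_le_one
        have hd2 := hdiff (fun _ => 1) (memLp_const 1) (by simp)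
        simp only [one_mul] at hd2
        have hBe : ∫ ω, B ω ∂P = e n := integral_emp h.meas h.stat _ _
        have hAB : ∫ ω, emp (u n) 0 ((j + 1) * s n) (path X ω) ∂P = ∫ ω, A ω * B ω ∂P := by
          congr 1
          funext ω
          rw [add_mul, one_mul]
          exact (emp_mul (Nat.zero_le _) (by omega)).symm
        have hA1 : |∫ ω, A ω ∂P| ≤ 1 := by
          refine abs_integral_le_integral_abs.trans ?_
          calc ∫ ω, |A ω| ∂P ≤ ∫ _, 1 ∂P := integral_mono (integrable_emp h.meas _ _).abs
                (integrable_const _) fun _ => abs_emp_le_one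
            _ = 1 := by simp
        rw [hAB]
        rw [hBe] at hd2
        simp only [Pi.mul_apply] at hcov
        set a := ∫ ω, A ω ∂P
        set b' := ∫ ω, B' ω ∂P
        have e1 : ∫ ω, A ω * B ω ∂P - e n ^ (j + 1)
            = (∫ ω, A ω * B ω ∂P - ∫ ω, A ω * B' ω ∂P) + (∫ ω, A ω * B' ω ∂P - a * b')
              + a * (b' - e n) + (a - e n ^ j) * e n := by ring
        have h5 : |a * (b' - e n)| ≤ l n * t := by
          rw [abs_mul, abs_sub_comm]
          exact (mul_le_of_le_one_left (abs_nonneg _) hA1).trans hd2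
        have h6 : |(a - e n ^ j) * e n| ≤ j * (ρ + 2 * (l n * t)) := by
          rw [abs_mul, abs_of_nonneg (he0 n)]
          exact (mul_le_of_le_one_right (abs_nonneg _) (he1 n)).trans ih
        rw [e1]
        have h7 := abs_add_le ((∫ ω, A ω * B ω ∂P - ∫ ω, A ω * B' ω ∂P)
          + (∫ ω, A ω * B' ω ∂P - a * b') + a * (b' - e n)) ((a - e n ^ j) * e n)
        have h8 := abs_add_le ((∫ ω, A ω * B ω ∂P - ∫ ω, A ω * B' ω ∂P)
          + (∫ ω, A ω * B' ω ∂P - a * b')) (a * (b' - e n))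
        have h9 := abs_add_le (∫ ω, A ω * B ω ∂P - ∫ ω, A ω * B' ω ∂P)
          (∫ ω, A ω * B' ω ∂P - a * b')
        push_cast
        linarith
    rw [Real.dist_eq]
    refine (key _ (Nat.div_mul_le_self _ _)).trans (le_of_eq ?_)
    ring
  -- taking logarithms, with `1 - x⁻¹ ≤ log x ≤ x - 1`
  have hlog : Tendsto (fun n => -(((r n / s n : ℕ) : ℝ) * Real.log (e n))) atTop (𝓝 α) := by
    have := (hpow.log (Real.exp_pos _).ne').neg
    rw [Real.log_exp, neg_neg] at this
    exact this.congr fun n => by rw [Real.log_pow]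
  have hlow := het.mul hlog
  rw [one_mul] at hlow
  refine tendsto_of_tendsto_of_tendsto_of_le_of_le' hlow hlog ?_ ?_
  · filter_upwards [het.eventually (lt_mem_nhds (show (0 : ℝ) < 1 by norm_num))] with n hn
    have h1 := Real.one_sub_inv_le_log_of_pos hn
    have h2 : e n * (-Real.log (e n)) ≤ 1 - e n := by
      have := mul_le_mul_of_nonneg_left h1 hn.le
      rw [mul_sub, mul_inv_cancel₀ hn.ne'] at this
      linarith
    calc e n * -(((r n / s n : ℕ) : ℝ) * Real.log (e n))
        = ((r n / s n : ℕ) : ℝ) * (e n * (-Real.log (e n))) := by ring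
      _ ≤ _ := mul_le_mul_of_nonneg_left h2 (Nat.cast_nonneg _)
  · filter_upwards [het.eventually (lt_mem_nhds (show (0 : ℝ) < 1 by norm_num))] with n hn
    have h1 := Real.log_le_sub_one_of_pos hn
    rw [← mul_neg]
    exact mul_le_mul_of_nonneg_left (by linarith) (Nat.cast_nonneg _)

lemma q_exc_s_sq (h : Regime P X u r l s τ α m₂ M) :
    Tendsto (fun n => ((r n / s n : ℕ) : ℝ) * ∫ ω, exc (u n) 0 (s n) (path X ω) ^ 2 ∂P) atTop
      (𝓝 (α * m₂)) := by
  refine (h.q_one_sub_emp.mul h.cluster).congr' ?_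
  filter_upwards [h.q_one_sub_emp.eventually (lt_mem_nhds h.α_pos)] with n hn
  have : (1 - ∫ ω, emp (u n) 0 (s n) (path X ω) ∂P) ≠ 0 := by
    intro h0
    rw [h0, mul_zero] at hn
    exact lt_irrefl _ hn
  field_simp

/-- Gaps contribute a negligible part to the second moment. -/
lemma q_exc_l_sq (h : Regime P X u r l s τ α m₂ M) :
    Tendsto (fun n => ((r n / s n : ℕ) : ℝ) * ∫ ω, exc (u n) 0 (l n) (path X ω) ^ 2 ∂P) atTop
      (𝓝 0) := by
  have hq : Tendsto (fun n => ((s n / l n : ℕ) : ℝ)) atTop atTop :=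
    tendsto_natCast_atTop_atTop.comp
      (tendsto_div_natDiv h.l_pos (Eventually.of_forall h.s_pos) h.l_div)
  have := h.q_exc_s_sq.mul (tendsto_inv_atTop_zero.comp hq)
  rw [mul_zero] at this
  refine squeeze_zero' (Eventually.of_forall fun n =>
    mul_nonneg (Nat.cast_nonneg _) (integral_exc_sq_nonneg _ _ _)) ?_ this
  filter_upwards [hq.eventually_gt_atTop 0] with n hn
  simp only [Function.comp]
  rw [mul_assoc]
  refine mul_le_mul_of_nonneg_left ?_ (Nat.cast_nonneg _)
  rw [← div_eq_mul_inv, le_div_iff₀ hn, mul_comm]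
  exact (mul_integral_exc_sq_le h.meas h.stat (u n) (l n) (s n / l n)).trans
    (integral_exc_sq_mono h.meas le_rfl (Nat.div_mul_le_self _ _))

lemma tendsto_zero_of_q_mul (h : Regime P X u r l s τ α m₂ M) {a : ℕ → ℝ} {b : ℝ}
    (ha : Tendsto (fun n => ((r n / s n : ℕ) : ℝ) * a n) atTop (𝓝 b)) :
    Tendsto a atTop (𝓝 0) := by
  have hq : Tendsto (fun n => ((r n / s n : ℕ) : ℝ)) atTop atTop :=
    tendsto_natCast_atTop_atTop.comp h.q_tendsto
  have := ha.mul (tendsto_inv_atTop_zero.comp hq)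
  rw [mul_zero] at this
  refine this.congr' ?_
  filter_upwards [hq.eventually_gt_atTop 0] with n hn
  simp only [Function.comp]
  field_simp

/-- The variance of the number of exceedances in a block is asymptotically the sum of the variances
over the intermediate blocks. -/
lemma variance_exc (h : Regime P X u r l s τ α m₂ M) :
    Tendsto (fun n => Var[fun ω => exc (u n) 0 (r n) (path X ω); P]) atTop (𝓝 (α * m₂)) := by
  have hm : ∀ n a b, MemLp (fun ω => exc (u n) a b (path X ω)) 2 P := fun n a b =>
    memLp_exc h.meas a b 2
  set V := fun (n : ℕ) (m : ℕ) => Var[fun ω => exc (u n) 0 m (path X ω); P] with hV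
  set S := fun n => ∫ ω, exc (u n) 0 (s n) (path X ω) ^ 2 ∂P with hS
  have hS0 : Tendsto S atTop (𝓝 0) := h.tendsto_zero_of_q_mul h.q_exc_s_sq
  have hqV : Tendsto (fun n => ((r n / s n : ℕ) : ℝ) * V n (s n)) atTop (𝓝 (α * m₂)) := by
    have := h.q_exc_s_sq.sub (h.q_s_tail.mul h.s_tail)
    rw [mul_zero, sub_zero] at this
    refine this.congr fun n => ?_
    simp only [hV]
    rw [variance_eq_sub (hm _ _ _)]
    have e := integral_exc (u := u n) h.meas h.stat 0 (s n)
    rw [zero_add] at e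
    rw [e]
    simp only [Pi.pow_apply]
    ring
  have hadd : ∀ n b d, b ≤ d → V n d = V n b + 2 * cov[fun ω => exc (u n) 0 b (path X ω),
      fun ω => exc (u n) b d (path X ω); P] + Var[fun ω => exc (u n) b d (path X ω); P] := by
    intro n b d hbd
    simp only [hV]
    rw [← variance_fun_add (hm _ _ _) (hm _ _ _)]
    congr 1
    funext ω
    exact exc_add (Nat.zero_le _) hbd
  have hM : 0 ≤ M := let ⟨_, hn⟩ := h.sq_le.exists; (integral_exc_sq_nonneg _ _ _).trans hn
  have hqs : Tendsto (fun n => V n (r n / s n * s n)) atTop (𝓝 (α * m₂)) := by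
    have hb := ((h.q_rho.mul_const M).const_mul 4).add (h.q_exc_l_sq.const_mul 2)
    rw [zero_mul, mul_zero, mul_zero, add_zero] at hb
    refine (tendsto_iff_of_dist (squeeze_zero' (Eventually.of_forall fun _ => dist_nonneg) ?_ hb)).1
      hqV
    filter_upwards [h.mul_r_le 2, h.two_s_le_r, h.two_l_le_s, h.sq_le] with n hrn hsr hls hMn
    set ρ := maxCorr P X n (l n) (u n)
    set ε := ∫ ω, exc (u n) 0 (l n) (path X ω) ^ 2 ∂P
    have hε : 0 ≤ ε := integral_exc_sq_nonneg _ _ _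
    have hρ : 0 ≤ ρ := maxCorr_nonneg _ _
    have hlp := h.l_pos n
    have key : ∀ j : ℕ, j * s n ≤ r n →
        |j * V n (s n) - V n (j * s n)| ≤ j * (4 * (ρ * M) + 2 * ε) := by
      intro j
      induction j with
      | zero => intro _; simp [hV, exc, ← Pi.zero_def]
      | succ j ih =>
        intro hj
        have hj' : j * s n + s n ≤ r n := by rw [add_mul, one_mul] at hj; exact hj
        have ih := ih (by omega)
        rcases Nat.eq_zero_or_pos j with rfl | hj0
        · simp only [zero_add, one_mul, Nat.cast_one]
          rw [sub_self, abs_zero]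
          positivity
        have hjs : s n ≤ j * s n := Nat.le_mul_of_pos_left _ hj0
        have hc := abs_covariance_exc_exc_le (P := P) (u := u n) (n := n) (l := l n) (b := j * s n)
          (d := j * s n + s n) h.meas h.stat (by omega) (by omega) (by omega) (by omega)
        have hd : ∫ ω, exc (u n) 0 (j * s n + s n) (path X ω) ^ 2 ∂P ≤ M :=
          (integral_exc_sq_mono h.meas le_rfl hj').trans hMn
        have hd' := mul_le_mul_of_nonneg_left hd hρ
        have hvar : Var[fun ω => exc (u n) (j * s n) (j * s n + s n) (path X ω); P]
            = V n (s n) := by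
          have hcs := covariance_shift h.meas h.stat (measurable_exc (u n) 0 (s n))
            (measurable_exc (u n) 0 (s n)) (j * s n)
          simp_rw [← exc_shift] at hcs
          rw [covariance_self, covariance_self, zero_add, add_comm (s n)] at hcs
          · exact hcs
          · exact (hm _ _ _).aestronglyMeasurable.aemeasurable
          · exact (hm _ _ _).aestronglyMeasurable.aemeasurable
        have ha := hadd n (j * s n) (j * s n + s n) (by omega)
        rw [add_mul, one_mul, ha, hvar]
        set cv := cov[fun ω => exc (u n) 0 (j * s n) (path X ω),
          fun ω => exc (u n) (j * s n) (j * s n + s n) (path X ω); P]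
        have e1 : ((j + 1 : ℕ) : ℝ) * V n (s n) - (V n (j * s n) + 2 * cv + V n (s n))
            = (j * V n (s n) - V n (j * s n)) - 2 * cv := by push_cast; ring
        rw [e1]
        refine (abs_sub _ _).trans ?_
        rw [abs_mul, abs_of_pos (by norm_num : (0 : ℝ) < 2)]
        push_cast
        linarith
    rw [Real.dist_eq]
    refine (key _ (Nat.div_mul_le_self _ _)).trans (le_of_eq ?_)
    ring
  have hrest : Tendsto (fun n => V n (r n) - V n (r n / s n * s n)) atTop (𝓝 0) := by
    have hb := ((hS0.sqrt.mul_const (Real.sqrt M)).const_mul 2).add hS0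
    rw [Real.sqrt_zero, zero_mul, mul_zero, add_zero] at hb
    refine squeeze_zero_norm' ?_ hb
    filter_upwards [h.sq_le] with n hMn
    have hle : r n / s n * s n ≤ r n := Nat.div_mul_le_self _ _
    have hlt : r n < r n / s n * s n + s n := Nat.lt_div_mul_add (h.s_pos n)
    rw [hadd n _ _ hle]
    have hR : ∫ ω, exc (u n) (r n / s n * s n) (r n) (path X ω) ^ 2 ∂P ≤ S n := by
      simp only [hS]
      rw [← integral_exc_sq h.meas h.stat (r n / s n * s n) (s n)]
      exact integral_exc_sq_mono h.meas le_rfl hlt.le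
    have hc := abs_covariance_le_integral_sq (hm n 0 (r n / s n * s n))
      (hm n (r n / s n * s n) (r n))
    have hM1 : ∫ ω, exc (u n) 0 (r n / s n * s n) (path X ω) ^ 2 ∂P ≤ M :=
      (integral_exc_sq_mono h.meas le_rfl hle).trans hMn
    have hc' := hc.trans (mul_le_mul (Real.sqrt_le_sqrt hM1) (Real.sqrt_le_sqrt hR)
      (Real.sqrt_nonneg _) (Real.sqrt_nonneg _))
    have hv := (variance_le_integral_sq (hm n (r n / s n * s n) (r n))).trans hR
    have hv0 := variance_nonneg (fun ω => exc (u n) (r n / s n * s n) (r n) (path X ω)) P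
    rw [Real.norm_eq_abs, abs_le]
    have := abs_le.1 hc'
    constructor <;> linarith
  have := hrest.add hqs
  rw [zero_add] at this
  exact this.congr fun n => by simp [hV]

end Regime
end

/-! ### Averages over a block as Riemann sums -/

lemma sum_div_eq_integral_floor {g : ℕ → ℝ} (hg : ∀ d, |g d| ≤ 1) {r : ℕ} (hr : 0 < r) :
    (1 / (r : ℝ)) * ∑ d ∈ Finset.range r, g d = ∫ x in (0 : ℝ)..1, g ⌊(r : ℝ) * x⌋₊ := by
  have hr0 : (r : ℝ) ≠ 0 := by exact_mod_cast hr.ne'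
  rw [intervalIntegral.integral_comp_mul_left (fun y => g ⌊y⌋₊) hr0, mul_zero, mul_one,
    smul_eq_mul, one_div]
  congr 1
  have hm : Measurable fun y : ℝ => g ⌊y⌋₊ := (Measurable.of_discrete (f := g)).comp
    Nat.measurable_floor
  have hint : ∀ a b : ℝ, IntervalIntegrable (fun y : ℝ => g ⌊y⌋₊) volume a b := fun a b =>
    (intervalIntegrable_const (c := (1 : ℝ))).mono_fun hm.aestronglyMeasurable
      (ae_of_all _ fun y => by simpa using hg _)
  have h := intervalIntegral.sum_integral_adjacent_intervals (f := fun y : ℝ => g ⌊y⌋₊)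
    (a := fun d : ℕ => (d : ℝ)) (n := r) (μ := volume) fun k _ => hint _ _
  simp only [Nat.cast_zero] at h
  rw [← h]
  refine Finset.sum_congr rfl fun d _ => ?_
  rw [intervalIntegral.integral_congr_Ioo_of_le (g := fun _ => g d) (by simp)]
  · simp
  · intro y hy
    have : ⌊y⌋₊ = d := by
      rw [Nat.floor_eq_iff (by linarith [hy.1, Nat.cast_nonneg (α := ℝ) d])]
      refine ⟨hy.1.le, ?_⟩
      have := hy.2
      push_cast at this
      exact this
    simp only [this]

lemma integral_exp_neg_mul_one_add {α : ℝ} (hα : 0 < α) :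
    ∫ x in (0 : ℝ)..1, Real.exp (-(α * (1 + x)))
      = α⁻¹ * Real.exp (-α) * (1 - Real.exp (-α)) := by
  have hd : ∀ x : ℝ, HasDerivAt (fun x => -(α⁻¹ * Real.exp (-(α * (1 + x)))))
      (Real.exp (-(α * (1 + x)))) x := by
    intro x
    have h1 : HasDerivAt (fun x : ℝ => -(α * (1 + x))) (-(α * 1)) x :=
      (((hasDerivAt_id x).const_add 1).const_mul α).neg
    convert! (h1.exp.const_mul α⁻¹).neg using 1
    field_simp
  rw [intervalIntegral.integral_eq_sub_of_hasDerivAt (fun x _ => hd x)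
    (Continuous.intervalIntegrable (by fun_prop) _ _)]
  have e : Real.exp (-(α * (1 + 1))) = Real.exp (-α) * Real.exp (-α) := by
    rw [← Real.exp_add]; congr 1; ring
  rw [e, add_zero, mul_one]
  ring

section
variable {Ω : Type*} [MeasurableSpace Ω] {P : Measure Ω} [IsProbabilityMeasure P]
  {X : ℕ → Ω → ℝ}

lemma covariance_fun_add_add_right {ξ η ζ κ : Ω → ℝ} (hξ : MemLp ξ 2 P) (hη : MemLp η 2 P)
    (hζ : MemLp ζ 2 P) (hκ : MemLp κ 2 P) :
    cov[ξ, fun ω => η ω + (ζ ω + κ ω); P] = cov[ξ, η; P] + (cov[ξ, ζ; P] + cov[ξ, κ; P]) := by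
  rw [← covariance_add_right hξ hζ hκ, ← covariance_add_right hξ hη (hζ.add hκ)]
  rfl

lemma integral_emp_mem (hX : ∀ i, Measurable (X i)) (u : ℝ) (a b : ℕ) :
    0 ≤ ∫ ω, emp u a b (path X ω) ∂P ∧ ∫ ω, emp u a b (path X ω) ∂P ≤ 1 := by
  refine ⟨integral_nonneg fun _ => emp_nonneg, ?_⟩
  calc _ ≤ ∫ _, 1 ∂P := integral_mono (integrable_emp hX _ _) (integrable_const _)
          fun _ => emp_le_one
    _ = 1 := by simp

/-- The covariance of the indicators of two empty windows of length `r` at distance `d < r`; zero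
for disjoint windows. -/
noncomputable def windowCov (P : Measure Ω) (X : ℕ → Ω → ℝ) (u : ℝ) (r d : ℕ) : ℝ :=
  if d < r then ∫ ω, emp u 0 (r + d) (path X ω) ∂P - (∫ ω, emp u 0 r (path X ω) ∂P) ^ 2 else 0

lemma sum_windowCov {u : ℝ} {r m : ℕ} (hm : r ≤ m) :
    ∑ d ∈ Finset.range m, windowCov P X u r d = ∑ d ∈ Finset.range r,
      (∫ ω, emp u 0 (r + d) (path X ω) ∂P - (∫ ω, emp u 0 r (path X ω) ∂P) ^ 2) := by
  rw [← Finset.sum_subset (Finset.range_subset_range.2 hm)]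
  · refine Finset.sum_congr rfl fun d hd => ?_
    rw [windowCov, if_pos (Finset.mem_range.1 hd)]
  · intro d _ hd
    rw [windowCov, if_neg (fun h => hd (Finset.mem_range.2 h))]

namespace Regime
variable {u : ℕ → ℝ} {r l s : ℕ → ℕ} {τ α m₂ M : ℝ}

lemma M_nonneg (h : Regime P X u r l s τ α m₂ M) : 0 ≤ M :=
  let ⟨_, hn⟩ := h.sq_le.exists; (integral_exc_sq_nonneg _ _ _).trans hn

lemma emp_r (h : Regime P X u r l s τ α m₂ M) :
    Tendsto (fun n => ∫ ω, emp (u n) 0 (r n) (path X ω) ∂P) atTop (𝓝 (Real.exp (-α))) := by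
  have := h.emp_lim r 1 zero_le_one (tendsto_const_nhds.congr fun n => by
    have : (r n : ℝ) ≠ 0 := by exact_mod_cast (h.r_pos n).ne'
    rw [div_self this])
  rwa [mul_one] at this

lemma r_tendsto (h : Regime P X u r l s τ α m₂ M) :
    Tendsto (fun n => (r n : ℝ)) atTop atTop := by
  refine tendsto_atTop_mono (fun n => ?_) (tendsto_natCast_atTop_atTop.comp h.q_tendsto)
  exact Nat.cast_le.2 (Nat.div_le_self _ _)

lemma average_emp (h : Regime P X u r l s τ α m₂ M) :
    Tendsto (fun n => (1 / (r n : ℝ)) * ∑ d ∈ Finset.range (r n),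
      ∫ ω, emp (u n) 0 (r n + d) (path X ω) ∂P) atTop
      (𝓝 (α⁻¹ * Real.exp (-α) * (1 - Real.exp (-α)))) := by
  have hb : ∀ n d, |∫ ω, emp (u n) 0 (r n + d) (path X ω) ∂P| ≤ 1 := fun n d => by
    have := integral_emp_mem (P := P) h.meas (u n) 0 (r n + d)
    rw [abs_of_nonneg this.1]
    exact this.2
  rw [← integral_exp_neg_mul_one_add h.α_pos]
  simp_rw [sum_div_eq_integral_floor (hb _) (h.r_pos _)]
  refine intervalIntegral.tendsto_integral_filter_of_dominated_convergence (fun _ => 1)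
    (Eventually.of_forall fun n => ?_) (Eventually.of_forall fun n => ae_of_all _ fun x _ => ?_)
    intervalIntegrable_const (ae_of_all _ fun x hx => ?_)
  · exact ((Measurable.of_discrete (f := fun d => ∫ ω, emp (u n) 0 (r n + d) (path X ω) ∂P)).comp
      (Nat.measurable_floor.comp (measurable_const.mul measurable_id))).aestronglyMeasurable
  · exact hb n _
  · rw [Set.uIoc_of_le zero_le_one] at hx
    refine h.emp_lim (fun n => r n + ⌊(r n : ℝ) * x⌋₊) (1 + x) (by linarith [hx.1]) ?_
    have h1 := ((tendsto_nat_floor_mul_div_atTop hx.1.le).comp h.r_tendsto).const_add 1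
    refine h1.congr fun n => ?_
    have : (r n : ℝ) ≠ 0 := by exact_mod_cast (h.r_pos n).ne'
    simp only [Function.comp]
    rw [mul_comm x]
    push_cast
    field_simp

/-- A window is nearly uncorrelated with everything before it, uniformly over windows among the
first six blocks. -/
lemma exists_adjacent_bound (h : Regime P X u r l s τ α m₂ M) :
    ∃ δ : ℕ → ℝ, Tendsto δ atTop (𝓝 0) ∧ ∀ᶠ n in atTop, ∀ (A : Ω → ℝ) (b c d : ℕ), 1 ≤ b →
      b ≤ c → b ≤ 6 * r n → d ≤ 6 * r n → Measurable[sigmaField X (u n) 1 b] A → MemLp A 2 P →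
      ∫ ω, A ω ^ 2 ∂P ≤ 1 + 36 * M →
      |cov[A, fun ω => emp (u n) c d (path X ω); P]| ≤ δ n ∧
      |cov[A, fun ω => exc (u n) c d (path X ω); P]| ≤ δ n := by
  have hM := h.M_nonneg
  set K := 1 + 36 * M
  have hK1 : 1 ≤ Real.sqrt K := Real.one_le_sqrt.2 (by simp only [K]; linarith)
  refine ⟨fun n => Real.sqrt K * (maxCorr P X n (l n) (u n) * Real.sqrt K
    + Real.sqrt (∫ ω, exc (u n) 0 (l n) (path X ω) ^ 2 ∂P)), ?_, ?_⟩
  · have hε := (h.tendsto_zero_of_q_mul h.q_exc_l_sq).sqrt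
    have := ((h.rho.mul_const (Real.sqrt K)).add hε).const_mul (Real.sqrt K)
    rwa [Real.sqrt_zero, zero_mul, add_zero, mul_zero] at this
  filter_upwards [h.mul_r_le 7, h.two_s_le_r, h.two_l_le_s, h.sq_le]
    with n hrn hsr hls hMn A b c d hb hbc hb6 hd6 hA hA2 hAK
  have hρ : 0 ≤ maxCorr P X n (l n) (u n) := maxCorr_nonneg _ _
  have hs := Real.sqrt_le_sqrt hAK
  have h1 := abs_covariance_emp_le (P := P) (l := l n) (n := n) h.meas h.stat hb hbc (by omega)
    (d := d) (by omega) hA hA2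
  have h2 := abs_covariance_exc_le (P := P) (l := l n) (n := n) h.meas h.stat hb hbc (by omega)
    (d := d) (by omega) hA hA2
  have hd : ∫ ω, exc (u n) 0 d (path X ω) ^ 2 ∂P ≤ K := by
    refine (integral_exc_sq_mono h.meas le_rfl hd6).trans ?_
    refine (integral_exc_sq_le_mul h.meas h.stat (u n) (r n) 6).trans ?_
    simp only [K]
    push_cast
    linarith
  have hε := Real.sqrt_nonneg (∫ ω, exc (u n) 0 (l n) (path X ω) ^ 2 ∂P)
  refine ⟨h1.trans (mul_le_mul hs (add_le_add ?_ le_rfl) (by positivity) (by positivity)),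
    h2.trans (mul_le_mul hs (add_le_add ?_ le_rfl) (by positivity) (by positivity))⟩
  · exact le_mul_of_one_le_right hρ hK1
  · exact mul_le_mul_of_nonneg_left (Real.sqrt_le_sqrt hd) hρ

/-- The covariances of the windows and exceedance counts inside the first five blocks, up to an
error that is uniform in the position of the windows. -/
lemma exists_window_bound (h : Regime P X u r l s τ α m₂ M) :
    ∃ δ : ℕ → ℝ, Tendsto δ atTop (𝓝 0) ∧ ∀ᶠ n in atTop,
      (∀ i j, i ≤ j → j ≤ 5 * r n → |cov[fun ω => emp (u n) i (i + r n) (path X ω),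
        fun ω => emp (u n) j (j + r n) (path X ω); P] - windowCov P X (u n) (r n) (j - i)| ≤ δ n) ∧
      (∀ i, 1 ≤ i → i + r n ≤ 5 * r n → |cov[fun ω => emp (u n) i (i + r n) (path X ω),
        fun ω => exc (u n) 0 (5 * r n) (path X ω); P]
        + (∫ ω, emp (u n) 0 (r n) (path X ω) ∂P) * (r n * tail P X (u n))| ≤ 2 * δ n) ∧
      |cov[fun ω => exc (u n) (2 * r n) (2 * r n + r n) (path X ω),
        fun ω => exc (u n) 0 (5 * r n) (path X ω); P]
        - Var[fun ω => exc (u n) 0 (r n) (path X ω); P]| ≤ 2 * δ n := by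
  obtain ⟨δ, hδ, hev⟩ := h.exists_adjacent_bound
  refine ⟨δ, hδ, ?_⟩
  filter_upwards [hev, h.sq_le] with n hn hMn
  have hM := h.M_nonneg
  have hr := h.r_pos n
  have me : ∀ a b, MemLp (fun ω => emp (u n) a b (path X ω)) 2 P := fun a b =>
    memLp_emp h.meas a b 2
  have mx : ∀ a b, MemLp (fun ω => exc (u n) a b (path X ω)) 2 P := fun a b =>
    memLp_exc h.meas a b 2
  have he2 : ∀ a b, ∫ ω, emp (u n) a b (path X ω) ^ 2 ∂P ≤ 1 + 36 * M := fun a b =>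
    (integral_emp_sq_le_one h.meas _ _ _).trans (by linarith)
  have hx2 : ∀ a b, b ≤ 6 * r n → ∫ ω, exc (u n) a b (path X ω) ^ 2 ∂P ≤ 1 + 36 * M := by
    intro a b hb
    refine (integral_exc_sq_mono h.meas (Nat.zero_le _) hb).trans ?_
    refine (integral_exc_sq_le_mul h.meas h.stat (u n) (r n) 6).trans ?_
    push_cast
    linarith
  refine ⟨?_, ?_, ?_⟩
  · intro i j hij hj
    by_cases hd : j - i < r n
    · have e : cov[fun ω => emp (u n) i (i + r n) (path X ω),
          fun ω => emp (u n) j (j + r n) (path X ω); P] = windowCov P X (u n) (r n) (j - i) := by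
        rw [windowCov, if_pos hd, covariance_eq_sub (me _ _) (me _ _), integral_emp h.meas h.stat,
          integral_emp h.meas h.stat, sq, ← integral_emp h.meas h.stat i (r n + (j - i))]
        congr 2
        funext ω
        rw [Pi.mul_apply, emp_mul_overlap hij (by omega) (by omega)]
        congr 1; omega
      rw [e, sub_self, abs_zero]
      exact (abs_nonneg _).trans
        (hn _ 1 1 1 le_rfl le_rfl (by omega) (by omega)
          (measurable_emp_sigmaField (a := 0) (b := 1) le_rfl le_rfl) (me _ _) (he2 _ _)).1
    · rw [windowCov, if_neg hd, sub_zero]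
      exact (hn _ (i + r n) j (j + r n) (by omega) (by omega) (by omega) (by omega)
        (measurable_emp_sigmaField (by omega) le_rfl) (me _ _) (he2 _ _)).1
  · intro i hi1 hi
    have e : (fun ω => exc (u n) 0 (5 * r n) (path X ω)) = fun ω => exc (u n) 0 i (path X ω)
        + (exc (u n) i (i + r n) (path X ω) + exc (u n) (i + r n) (5 * r n) (path X ω)) := by
      funext ω
      rw [← exc_add (by omega) hi, ← exc_add (by omega) (by omega)]
    rw [e, covariance_fun_add_add_right (me _ _) (mx _ _) (mx _ _) (mx _ _), covariance_comm,
      covariance_eq_sub (me i (i + r n)) (mx i (i + r n))]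
    have e0 : (fun ω => emp (u n) i (i + r n) (path X ω)) * (fun ω => exc (u n) i (i + r n)
        (path X ω)) = fun _ => (0 : ℝ) := by
      funext ω
      exact emp_mul_exc
    rw [e0, integral_zero, integral_emp h.meas h.stat, integral_exc h.meas h.stat]
    have h1 := abs_le.1 (hn _ i i (i + r n) hi1 le_rfl (by omega) (by omega)
      (measurable_exc_sigmaField (a := 0) (b := i) (by omega) le_rfl) (mx _ _)
      (hx2 _ _ (by omega))).1
    have h2 := abs_le.1 (hn _ (i + r n) (i + r n) (5 * r n) (by omega) le_rfl (by omega) (by omega)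
      (measurable_emp_sigmaField (a := i) (b := i + r n) (by omega) le_rfl) (me _ _)
      (he2 _ _)).2
    rw [abs_le]
    constructor <;> linarith
  · have e : (fun ω => exc (u n) 0 (5 * r n) (path X ω))
        = fun ω => exc (u n) 0 (2 * r n) (path X ω)
        + (exc (u n) (2 * r n) (2 * r n + r n) (path X ω)
          + exc (u n) (2 * r n + r n) (5 * r n) (path X ω)) := by
      funext ω
      rw [← exc_add (by omega) (by omega), ← exc_add (by omega) (by omega)]
    rw [e, covariance_fun_add_add_right (mx _ _) (mx _ _) (mx _ _) (mx _ _), covariance_comm]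
    have hvar : cov[fun ω => exc (u n) (2 * r n) (2 * r n + r n) (path X ω),
        fun ω => exc (u n) (2 * r n) (2 * r n + r n) (path X ω); P]
        = Var[fun ω => exc (u n) 0 (r n) (path X ω); P] := by
      have hcs := covariance_shift h.meas h.stat (measurable_exc (u n) 0 (r n))
        (measurable_exc (u n) 0 (r n)) (2 * r n)
      simp_rw [← exc_shift] at hcs
      rw [zero_add, add_comm (r n)] at hcs
      rw [hcs, covariance_self (mx _ _).aestronglyMeasurable.aemeasurable]
    rw [hvar]
    have h1 := abs_le.1 (hn _ (2 * r n) (2 * r n) (2 * r n + r n) (by omega) le_rfl (by omega)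
      (by omega) (measurable_exc_sigmaField (a := 0) (b := 2 * r n) (by omega) le_rfl) (mx _ _)
      (hx2 _ _ (by omega))).2
    have h2 := abs_le.1 (hn _ (2 * r n + r n) (2 * r n + r n) (5 * r n) (by omega) le_rfl
      (by omega) (by omega)
      (measurable_exc_sigmaField (a := 2 * r n) (b := 2 * r n + r n) (by omega) le_rfl) (mx _ _)
      (hx2 _ _ (by omega))).2
    rw [abs_le]
    constructor <;> linarith

end Regime

/-! ### Block statistics and their lagged covariances -/

/-- The three statistics of a block of length `r` at the start of a sequence: whether the block is
empty, the proportion of empty windows among the `r` windows that start in the block, and the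
number of exceedances. -/
noncomputable def blockStat (u : ℝ) (r : ℕ) : Fin 3 → (ℕ → ℝ) → ℝ :=
  ![emp u 0 r, fun x => (1 / (r : ℝ)) * ∑ i ∈ Finset.range r, emp u i (i + r) x, exc u 0 r]

lemma measurable_blockStat (u : ℝ) (r : ℕ) (a : Fin 3) : Measurable (blockStat u r a) := by
  fin_cases a
  · exact measurable_emp u 0 r
  · exact (Finset.measurable_fun_sum _ fun i _ => measurable_emp u i (i + r)).const_mul _
  · exact measurable_exc u 0 r

lemma abs_average_emp_le_one (u : ℝ) (r : ℕ) (x : ℕ → ℝ) :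
    |(1 / (r : ℝ)) * ∑ i ∈ Finset.range r, emp u i (i + r) x| ≤ 1 := by
  rw [abs_of_nonneg (mul_nonneg (by positivity) (Finset.sum_nonneg fun _ _ => emp_nonneg))]
  have : ∑ i ∈ Finset.range r, emp u i (i + r) x ≤ r := by
    refine (Finset.sum_le_card_nsmul _ _ 1 fun _ _ => emp_le_one).trans (by simp)
  rw [one_div_mul_eq_div]
  exact div_le_one_of_le₀ this (Nat.cast_nonneg _)

lemma abs_blockStat_le (u : ℝ) (r : ℕ) (a : Fin 3) (x : ℕ → ℝ) :
    |blockStat u r a x| ≤ 1 + exc u 0 r x := by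
  have h0 := exc_nonneg (u := u) (a := 0) (b := r) (x := x)
  fin_cases a
  · exact abs_emp_le_one.trans (by linarith)
  · exact (abs_average_emp_le_one u r x).trans (by linarith)
  · change |exc u 0 r x| ≤ _
    rw [abs_of_nonneg h0]; linarith

lemma memLp_blockStat (hX : ∀ i, Measurable (X i)) (u : ℝ) (r h : ℕ) (a : Fin 3) (p : ENNReal) :
    MemLp (fun ω => blockStat u r a (shiftSeq h (path X ω))) p P := by
  refine MemLp.of_bound ((measurable_blockStat u r a).comp
    ((measurable_shiftSeq h).comp (measurable_path hX))).aestronglyMeasurable (1 + r)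
    (ae_of_all _ fun ω => (abs_blockStat_le u r a _).trans ?_)
  have := exc_le (u := u) (a := 0) (b := r) (x := shiftSeq h (path X ω))
  simp only [Nat.sub_zero] at this
  linarith

/-- The sum of the covariances of `F` on block `2` with `G` on the blocks `0, …, 4`. -/
noncomputable def lagCov (P : Measure Ω) (X : ℕ → Ω → ℝ) (r : ℕ) (F G : (ℕ → ℝ) → ℝ) : ℝ :=
  ∑ j ∈ Finset.range 5, cov[fun ω => F (shiftSeq (2 * r) (path X ω)),
    fun ω => G (shiftSeq (j * r) (path X ω)); P]

lemma covariance_shift_add (hX : ∀ i, Measurable (X i)) (hstat : StrictlyStationary P X)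
    {F G : (ℕ → ℝ) → ℝ} (hF : Measurable F) (hG : Measurable G) (a b h : ℕ) :
    cov[fun ω => F (shiftSeq (a + h) (path X ω)), fun ω => G (shiftSeq (b + h) (path X ω)); P]
      = cov[fun ω => F (shiftSeq a (path X ω)), fun ω => G (shiftSeq b (path X ω)); P] := by
  have := covariance_shift hX hstat (hF.comp (measurable_shiftSeq a))
    (hG.comp (measurable_shiftSeq b)) h
  simpa only [Function.comp, shiftSeq_shiftSeq] using this

lemma lagCov_comm (hX : ∀ i, Measurable (X i)) (hstat : StrictlyStationary P X) (r : ℕ)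
    {F G : (ℕ → ℝ) → ℝ} (hF : Measurable F) (hG : Measurable G) :
    lagCov P X r F G = lagCov P X r G F := by
  have hs : ∀ a b h, cov[fun ω => F (shiftSeq ((a + h) * r) (path X ω)),
      fun ω => G (shiftSeq ((b + h) * r) (path X ω)); P]
      = cov[fun ω => G (shiftSeq (b * r) (path X ω)), fun ω => F (shiftSeq (a * r) (path X ω)); P]
      := by
    intro a b h
    rw [covariance_comm (fun ω => G (shiftSeq (b * r) (path X ω))), add_mul, add_mul]
    exact covariance_shift_add hX hstat hF hG _ _ _
  simp only [lagCov, Finset.sum_range_succ, Finset.range_zero, Finset.sum_empty, zero_add]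
  have h3 := hs 1 2 1
  have h4 := hs 0 2 2
  have h2 := hs 2 2 0
  have h1 : cov[fun ω => F (shiftSeq (2 * r) (path X ω)), fun ω => G (shiftSeq (1 * r)
      (path X ω)); P] = cov[fun ω => G (shiftSeq (2 * r) (path X ω)),
        fun ω => F (shiftSeq (3 * r) (path X ω)); P] :=
    (covariance_comm _ _).trans ((hs 2 1 1).symm.trans (covariance_comm _ _))
  have h0 : cov[fun ω => F (shiftSeq (2 * r) (path X ω)), fun ω => G (shiftSeq (0 * r)
      (path X ω)); P] = cov[fun ω => G (shiftSeq (2 * r) (path X ω)),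
        fun ω => F (shiftSeq (4 * r) (path X ω)); P] :=
    (covariance_comm _ _).trans ((hs 2 0 2).symm.trans (covariance_comm _ _))
  norm_num only at h2 h3 h4
  rw [h0, h1, h2, h3, h4]
  ring

lemma lagCov_eq_cov_sum {r : ℕ} {F G : (ℕ → ℝ) → ℝ}
    (hF : MemLp (fun ω => F (shiftSeq (2 * r) (path X ω))) 2 P)
    (hG : ∀ j, MemLp (fun ω => G (shiftSeq (j * r) (path X ω))) 2 P) :
    lagCov P X r F G = cov[fun ω => F (shiftSeq (2 * r) (path X ω)),
      fun ω => ∑ j ∈ Finset.range 5, G (shiftSeq (j * r) (path X ω)); P] := by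
  rw [lagCov, covariance_fun_sum_right' (fun j _ => hG j) hF]

lemma average_emp_shift (u : ℝ) (r h : ℕ) (x : ℕ → ℝ) :
    blockStat u r 1 (shiftSeq h x)
      = (1 / (r : ℝ)) * ∑ i ∈ Finset.range r, emp u (h + i) (h + i + r) x := by
  change (1 / (r : ℝ)) * ∑ i ∈ Finset.range r, emp u i (i + r) (shiftSeq h x) = _
  congr 1
  refine Finset.sum_congr rfl fun i _ => ?_
  rw [← emp_shift]
  congr 1 <;> omega

lemma emp_block_shift (u : ℝ) (r h : ℕ) (x : ℕ → ℝ) :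
    blockStat u r 0 (shiftSeq h x) = emp u h (h + r) x := by
  change emp u 0 r (shiftSeq h x) = _
  rw [← emp_shift, zero_add, add_comm]

lemma exc_block_shift (u : ℝ) (r h : ℕ) (x : ℕ → ℝ) :
    blockStat u r 2 (shiftSeq h x) = exc u h (h + r) x := by
  change exc u 0 r (shiftSeq h x) = _
  rw [← exc_shift, zero_add, add_comm]

lemma sum_range_mul_blocks (f : ℕ → ℝ) (r g : ℕ) :
    ∑ j ∈ Finset.range g, ∑ i ∈ Finset.range r, f (j * r + i) = ∑ i ∈ Finset.range (g * r), f i := by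
  induction g with
  | zero => simp
  | succ g ih => rw [Finset.sum_range_succ, ih, add_mul, one_mul, Finset.sum_range_add]

lemma sum_average_emp_shift (u : ℝ) (r g : ℕ) (x : ℕ → ℝ) :
    ∑ j ∈ Finset.range g, blockStat u r 1 (shiftSeq (j * r) x)
      = (1 / (r : ℝ)) * ∑ i ∈ Finset.range (g * r), emp u i (i + r) x := by
  simp_rw [average_emp_shift, ← Finset.mul_sum]
  rw [sum_range_mul_blocks (fun i => emp u i (i + r) x)]

lemma sum_exc_shift (u : ℝ) (r g : ℕ) (x : ℕ → ℝ) :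
    ∑ j ∈ Finset.range g, blockStat u r 2 (shiftSeq (j * r) x) = exc u 0 (g * r) x := by
  simp_rw [exc_block_shift]
  induction g with
  | zero => simp [exc]
  | succ g ih =>
    rw [Finset.sum_range_succ, ih, add_mul, one_mul, ← exc_add (Nat.zero_le _) (by omega)]

namespace Regime
variable {u : ℕ → ℝ} {r l s : ℕ → ℕ} {τ α m₂ M : ℝ}

/-- The average over windows of the covariance with a fixed window of the central block, with an
error that is uniform in that window. -/
lemma exists_average_bound (h : Regime P X u r l s τ α m₂ M) :
    ∃ v : ℕ → ℝ, Tendsto v atTop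
      (𝓝 (2 * α⁻¹ * Real.exp (-α) * (1 - (1 + α) * Real.exp (-α)))) ∧
    ∃ δ : ℕ → ℝ, Tendsto δ atTop (𝓝 0) ∧ ∀ᶠ n in atTop, ∀ i, 2 * r n ≤ i → i ≤ 3 * r n →
      |(1 / (r n : ℝ)) * ∑ j ∈ Finset.range (5 * r n),
        cov[fun ω => emp (u n) i (i + r n) (path X ω),
          fun ω => emp (u n) j (j + r n) (path X ω); P] - v n| ≤ δ n := by
  obtain ⟨δ, hδ, hev⟩ := h.exists_window_bound
  refine ⟨fun n => (1 / (r n : ℝ)) * (2 * ∑ d ∈ Finset.range (r n), (∫ ω, emp (u n) 0 (r n + d)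
    (path X ω) ∂P - (∫ ω, emp (u n) 0 (r n) (path X ω) ∂P) ^ 2)
    - windowCov P X (u n) (r n) 0), ?_, fun n => 5 * δ n, by simpa using hδ.const_mul 5, ?_⟩
  · have h1 : Tendsto (fun n => (1 / (r n : ℝ)) * windowCov P X (u n) (r n) 0) atTop (𝓝 0) := by
      have hF := h.emp_r
      have := (tendsto_inv_atTop_zero.comp h.r_tendsto).mul (hF.sub (hF.pow 2))
      rw [zero_mul] at this
      refine this.congr fun n => ?_
      simp only [Function.comp]
      rw [windowCov, if_pos (h.r_pos n), one_div, add_zero]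
    have h2 := ((h.average_emp.sub (h.emp_r.pow 2)).const_mul 2).sub h1
    have e : 2 * (α⁻¹ * Real.exp (-α) * (1 - Real.exp (-α)) - Real.exp (-α) ^ 2) - 0
        = 2 * α⁻¹ * Real.exp (-α) * (1 - (1 + α) * Real.exp (-α)) := by
      have := h.α_pos.ne'
      field_simp
      ring
    rw [e] at h2
    refine h2.congr fun n => ?_
    have : (r n : ℝ) ≠ 0 := by exact_mod_cast (h.r_pos n).ne'
    rw [Finset.sum_sub_distrib, Finset.sum_const, Finset.card_range, nsmul_eq_mul]
    field_simp
  · filter_upwards [hev] with n ⟨hn, _, _⟩ i hi2 hi3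
    have hr := h.r_pos n
    have hr0 : (0 : ℝ) < r n := by exact_mod_cast hr
    set w := windowCov P X (u n) (r n) with hw
    have hterm : ∀ j ∈ Finset.range (5 * r n),
        |cov[fun ω => emp (u n) i (i + r n) (path X ω),
          fun ω => emp (u n) j (j + r n) (path X ω); P]
          - (if j < i then w (i - j) else w (j - i))| ≤ δ n := by
      intro j hj
      rw [Finset.mem_range] at hj
      split_ifs with hji
      · rw [covariance_comm]
        exact hn j i hji.le (by omega)
      · exact hn i j (by omega) hj.le
    have hsum : ∑ j ∈ Finset.range (5 * r n), (if j < i then w (i - j) else w (j - i))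
        = 2 * ∑ d ∈ Finset.range (r n), (∫ ω, emp (u n) 0 (r n + d)
          (path X ω) ∂P - (∫ ω, emp (u n) 0 (r n) (path X ω) ∂P) ^ 2) - w 0 := by
      have e5 : 5 * r n = i + (5 * r n - i) := by omega
      rw [e5, Finset.sum_range_add]
      have s1 : ∑ j ∈ Finset.range i, (if j < i then w (i - j) else w (j - i))
          = ∑ d ∈ Finset.range (i + 1), w d - w 0 := by
        rw [Finset.sum_range_succ', add_sub_cancel_right, ← Finset.sum_range_reflect]
        refine Finset.sum_congr rfl fun j hj => ?_
        rw [Finset.mem_range] at hj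
        rw [if_pos (by omega)]
        congr 1; omega
      have s2 : ∑ j ∈ Finset.range (5 * r n - i),
          (if i + j < i then w (i - (i + j)) else w (i + j - i))
          = ∑ d ∈ Finset.range (5 * r n - i), w d := by
        refine Finset.sum_congr rfl fun j _ => ?_
        rw [if_neg (by omega)]
        congr 1; omega
      rw [s1, s2, sum_windowCov (by omega), sum_windowCov (by omega)]
      ring
    rw [← hsum, ← mul_sub, ← Finset.sum_sub_distrib, abs_mul, abs_of_pos (by positivity)]
    have := (Finset.abs_sum_le_sum_abs _ _).trans (Finset.sum_le_card_nsmul _ _ _ hterm)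
    rw [Finset.card_range, nsmul_eq_mul] at this
    push_cast at this
    rw [one_div_mul_eq_div, div_le_iff₀ hr0]
    linarith

/-- The lagged covariances of the block statistics converge to the entries of the limit
covariance matrix. -/
lemma tendsto_lagCov {θ : ℝ} (h : Regime P X u r l s τ (τ * θ) m₂ M) (a b : Fin 3) :
    Tendsto (fun n => lagCov P X (r n) (blockStat (u n) (r n) a) (blockStat (u n) (r n) b)) atTop
      (𝓝 (asympCov θ τ m₂ a b)) := by
  set α := τ * θ with hα
  have hmem : ∀ n a j, MemLp (fun ω => blockStat (u n) (r n) a (shiftSeq j (path X ω))) 2 P :=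
    fun n a j => memLp_blockStat h.meas _ _ _ _ _
  have me : ∀ n a b, MemLp (fun ω => emp (u n) a b (path X ω)) 2 P := fun n a b =>
    memLp_emp h.meas a b 2
  have heq := fun n a b => lagCov_eq_cov_sum (r := r n) (F := blockStat (u n) (r n) a)
    (G := blockStat (u n) (r n) b) (hmem n a _) (fun j => hmem n b _)
  obtain ⟨δ, hδ, hev⟩ := h.exists_window_bound
  obtain ⟨v, hv, δ', hδ', hev'⟩ := h.exists_average_bound
  have hFτ := h.emp_r.mul h.tail_lim
  have close : ∀ {f g e : ℕ → ℝ} {L : ℝ}, Tendsto g atTop (𝓝 L) → Tendsto e atTop (𝓝 0) →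
      (∀ᶠ n in atTop, |f n - g n| ≤ e n) → Tendsto f atTop (𝓝 L) := by
    intro f g e L hg he hfg
    have h0 : Tendsto (fun n => f n - g n) atTop (𝓝 0) := squeeze_zero_norm' hfg he
    have := h0.add hg
    rw [zero_add] at this
    exact this.congr fun n => by ring
  -- averaging a uniform bound over the windows starting in the central block
  have average : ∀ n (T : Ω → ℝ), MemLp T 2 P → ∀ c e : ℝ,
      (∀ i, 2 * r n ≤ i → i ≤ 3 * r n →
        |cov[fun ω => emp (u n) i (i + r n) (path X ω), T; P] - c| ≤ e) →
      |cov[fun ω => blockStat (u n) (r n) 1 (shiftSeq (2 * r n) (path X ω)), T; P] - c| ≤ e := by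
    intro n T hT c e hi
    have hr0 : (0 : ℝ) < r n := by exact_mod_cast h.r_pos n
    simp_rw [average_emp_shift]
    rw [covariance_const_mul_left, covariance_fun_sum_left' (fun i _ => me _ _ _) hT]
    have e1 : (1 / (r n : ℝ)) * ∑ i ∈ Finset.range (r n),
        cov[fun ω => emp (u n) (2 * r n + i) (2 * r n + i + r n) (path X ω), T; P] - c
        = (1 / (r n : ℝ)) * ∑ i ∈ Finset.range (r n),
        (cov[fun ω => emp (u n) (2 * r n + i) (2 * r n + i + r n) (path X ω), T; P] - c) := by
      rw [Finset.sum_sub_distrib, Finset.sum_const, Finset.card_range, nsmul_eq_mul]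
      field_simp
    rw [e1, abs_mul, abs_of_pos (by positivity), one_div_mul_eq_div, div_le_iff₀ hr0]
    refine (Finset.abs_sum_le_sum_abs _ _).trans ((Finset.sum_le_card_nsmul _ _ e
      fun i hi' => ?_).trans (le_of_eq ?_))
    · rw [Finset.mem_range] at hi'
      exact hi _ (by omega) (by omega)
    · rw [Finset.card_range, nsmul_eq_mul, mul_comm]
  have h00 : Tendsto (fun n => lagCov P X (r n) (blockStat (u n) (r n) 0)
      (blockStat (u n) (r n) 0)) atTop (𝓝 (Real.exp (-α) * (1 - Real.exp (-α)))) := by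
    have hg := h.emp_r.mul (h.emp_r.const_sub 1)
    refine close hg (e := fun n => 5 * δ n) (by simpa using hδ.const_mul 5) ?_
    filter_upwards [hev] with n ⟨hn, _, _⟩
    have hr := h.r_pos n
    rw [lagCov]
    simp_rw [emp_block_shift]
    have hj : ∀ j ∈ Finset.range 5, |cov[fun ω => emp (u n) (2 * r n) (2 * r n + r n) (path X ω),
        fun ω => emp (u n) (j * r n) (j * r n + r n) (path X ω); P]
        - (if j = 2 then windowCov P X (u n) (r n) 0 else 0)| ≤ δ n := by
      intro j hj
      rw [Finset.mem_range] at hj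
      have hzero : ∀ d, r n ≤ d → windowCov P X (u n) (r n) d = 0 := fun d hd => by
        rw [windowCov, if_neg (by omega)]
      rcases lt_trichotomy j 2 with hj2 | rfl | hj2
      · rw [if_neg (by omega), covariance_comm]
        have h1 : (j + 1) * r n ≤ 2 * r n := Nat.mul_le_mul_right _ (by omega)
        rw [add_mul, one_mul] at h1
        have := hn (j * r n) (2 * r n) (by omega) (by omega)
        rwa [hzero _ (by omega)] at this
      · rw [if_pos rfl]
        have := hn (2 * r n) (2 * r n) le_rfl (by omega)
        rwa [Nat.sub_self] at this
      · rw [if_neg (by omega)]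
        have h1 : 3 * r n ≤ j * r n := Nat.mul_le_mul_right _ (by omega)
        have h2 : j * r n ≤ 5 * r n := Nat.mul_le_mul_right _ (by omega)
        have := hn (2 * r n) (j * r n) (by omega) h2
        rwa [hzero _ (by omega)] at this
    have hs := (Finset.abs_sum_le_sum_abs _ _).trans (Finset.sum_le_card_nsmul _ _ _ hj)
    rw [Finset.sum_sub_distrib, Finset.sum_ite_eq' (Finset.range 5) 2, if_pos (by simp),
      Finset.card_range, nsmul_eq_mul, windowCov, if_pos hr, add_zero] at hs
    push_cast at hs
    refine le_trans (le_of_eq ?_) hs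
    congr 1
    ring
  have h01 : Tendsto (fun n => lagCov P X (r n) (blockStat (u n) (r n) 0)
      (blockStat (u n) (r n) 1)) atTop
      (𝓝 (2 * α⁻¹ * Real.exp (-α) * (1 - (1 + α) * Real.exp (-α)))) := by
    refine close hv hδ' ?_
    filter_upwards [hev'] with n hn
    rw [heq]
    simp_rw [sum_average_emp_shift, emp_block_shift]
    rw [covariance_const_mul_right, covariance_fun_sum_right' (fun i _ => me _ _ _) (me _ _ _)]
    exact hn _ le_rfl (by omega)
  have h11 : Tendsto (fun n => lagCov P X (r n) (blockStat (u n) (r n) 1)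
      (blockStat (u n) (r n) 1)) atTop
      (𝓝 (2 * α⁻¹ * Real.exp (-α) * (1 - (1 + α) * Real.exp (-α)))) := by
    refine close hv hδ' ?_
    filter_upwards [hev'] with n hn
    rw [heq]
    simp_rw [sum_average_emp_shift]
    refine average n _ ((memLp_finsetSum _ fun i _ => me _ _ _).const_mul _) _ _ fun i h2 h3 => ?_
    rw [covariance_const_mul_right, covariance_fun_sum_right' (fun i _ => me _ _ _) (me _ _ _)]
    exact hn i h2 h3
  have hneg : Tendsto (fun n => -((∫ ω, emp (u n) 0 (r n) (path X ω) ∂P)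
      * (r n * tail P X (u n)))) atTop (𝓝 (-(τ * Real.exp (-α)))) := by
    rw [mul_comm τ]; exact hFτ.neg
  have h02 : Tendsto (fun n => lagCov P X (r n) (blockStat (u n) (r n) 0)
      (blockStat (u n) (r n) 2)) atTop (𝓝 (-(τ * Real.exp (-α)))) := by
    refine close hneg (e := fun n => 2 * δ n) (by simpa using hδ.const_mul 2) ?_
    filter_upwards [hev] with n ⟨_, hn, _⟩
    have hr := h.r_pos n
    rw [heq]
    simp_rw [sum_exc_shift, emp_block_shift]
    rw [sub_neg_eq_add]
    exact hn _ (by omega) (by omega)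
  have h12 : Tendsto (fun n => lagCov P X (r n) (blockStat (u n) (r n) 1)
      (blockStat (u n) (r n) 2)) atTop (𝓝 (-(τ * Real.exp (-α)))) := by
    refine close hneg (e := fun n => 2 * δ n) (by simpa using hδ.const_mul 2) ?_
    filter_upwards [hev] with n ⟨_, hn, _⟩
    have hr := h.r_pos n
    rw [heq]
    simp_rw [sum_exc_shift]
    refine average n _ (memLp_exc h.meas _ _ _) _ _ fun i h2 h3 => ?_
    rw [sub_neg_eq_add]
    exact hn _ (by omega) (by omega)
  have h22 : Tendsto (fun n => lagCov P X (r n) (blockStat (u n) (r n) 2)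
      (blockStat (u n) (r n) 2)) atTop (𝓝 (α * m₂)) := by
    refine close h.variance_exc (e := fun n => 2 * δ n) (by simpa using hδ.const_mul 2) ?_
    filter_upwards [hev] with n ⟨_, _, hn⟩
    rw [heq]
    simp_rw [sum_exc_shift, exc_block_shift]
    exact hn
  have hc : ∀ n a b, lagCov P X (r n) (blockStat (u n) (r n) a) (blockStat (u n) (r n) b)
      = lagCov P X (r n) (blockStat (u n) (r n) b) (blockStat (u n) (r n) a) := fun n a b =>
    lagCov_comm h.meas h.stat _ (measurable_blockStat _ _ _) (measurable_blockStat _ _ _)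
  have h10 := h01.congr fun n => hc n 0 1
  have h20 := h02.congr fun n => hc n 0 2
  have h21 := h12.congr fun n => hc n 1 2
  fin_cases a <;> fin_cases b
  · exact h00
  · exact h01
  · exact h02
  · exact h10
  · exact h11
  · exact h12
  · exact h20
  · exact h21
  · exact h22

end Regime
end

section
variable {Ω : Type*} [MeasurableSpace Ω] {P : Measure Ω} [IsProbabilityMeasure P]
  {X : ℕ → Ω → ℝ}

/-! ### The central limit theorem for the block statistics -/

/-- The linear combination with weights `w` of the three statistics of a block. -/
noncomputable def blockSum (w : Fin 3 → ℝ) (u : ℝ) (r : ℕ) (x : ℕ → ℝ) : ℝ :=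
  ∑ a, w a * blockStat u r a x

/-- The centred weighted statistic of block `j`. -/
noncomputable def centredBlock (P : Measure Ω) (X : ℕ → Ω → ℝ) (w : Fin 3 → ℝ) (u : ℝ) (r j : ℕ)
    (ω : Ω) : ℝ :=
  blockSum w u r (shiftSeq (j * r) (path X ω)) - ∫ ω, blockSum w u r (path X ω) ∂P

/-- The covariance of the weighted statistics of two blocks at lag `h`. -/
noncomputable def blockCov (P : Measure Ω) (X : ℕ → Ω → ℝ) (w : Fin 3 → ℝ) (u : ℝ) (r h : ℕ) : ℝ :=
  cov[fun ω => blockSum w u r (path X ω),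
    fun ω => blockSum w u r (shiftSeq (h * r) (path X ω)); P]

lemma measurable_blockSum (w : Fin 3 → ℝ) (u : ℝ) (r : ℕ) : Measurable (blockSum w u r) :=
  Finset.measurable_fun_sum _ fun a _ => (measurable_blockStat u r a).const_mul (w a)

lemma abs_blockSum_le (w : Fin 3 → ℝ) (u : ℝ) (r : ℕ) (x : ℕ → ℝ) :
    |blockSum w u r x| ≤ (∑ a, |w a|) * (1 + exc u 0 r x) := by
  rw [Finset.sum_mul]
  refine (Finset.abs_sum_le_sum_abs _ _).trans (Finset.sum_le_sum fun a _ => ?_)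
  rw [abs_mul]
  exact mul_le_mul_of_nonneg_left (abs_blockStat_le u r a x) (abs_nonneg _)

lemma memLp_blockSum (hX : ∀ i, Measurable (X i)) (w : Fin 3 → ℝ) (u : ℝ) (r h : ℕ)
    (p : ENNReal) : MemLp (fun ω => blockSum w u r (shiftSeq h (path X ω))) p P :=
  memLp_finsetSum _ fun a _ => (memLp_blockStat hX u r h a p).const_mul (w a)

lemma measurable_blockSum_sigmaField (w : Fin 3 → ℝ) {u : ℝ} {r j c d : ℕ} (hc : c ≤ j * r + 1)
    (hd : (j + 2) * r ≤ d) :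
    Measurable[sigmaField X u c d] fun ω => blockSum w u r (shiftSeq (j * r) (path X ω)) := by
  have hd' : j * r + 2 * r ≤ d := by rwa [add_mul] at hd
  refine Finset.measurable_fun_sum _ fun a _ => Measurable.const_mul ?_ (w a)
  fin_cases a
  · change Measurable[sigmaField X u c d] fun ω => blockStat u r 0 (shiftSeq (j * r) (path X ω))
    simp_rw [emp_block_shift]
    exact measurable_emp_sigmaField hc (by omega)
  · change Measurable[sigmaField X u c d] fun ω => blockStat u r 1 (shiftSeq (j * r) (path X ω))
    simp_rw [average_emp_shift]
    refine Measurable.const_mul (Finset.measurable_fun_sum _ fun i hi => ?_) _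
    rw [Finset.mem_range] at hi
    exact measurable_emp_sigmaField (by omega) (by omega)
  · change Measurable[sigmaField X u c d] fun ω => blockStat u r 2 (shiftSeq (j * r) (path X ω))
    simp_rw [exc_block_shift]
    exact measurable_exc_sigmaField hc (by omega)

lemma integral_blockSum_shift (hX : ∀ i, Measurable (X i)) (hstat : StrictlyStationary P X)
    (w : Fin 3 → ℝ) (u : ℝ) (r h : ℕ) :
    ∫ ω, blockSum w u r (shiftSeq h (path X ω)) ∂P = ∫ ω, blockSum w u r (path X ω) ∂P :=
  integral_shift hX hstat (measurable_blockSum w u r).stronglyMeasurable h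

lemma integral_blockSum_sq_le (hX : ∀ i, Measurable (X i)) (w : Fin 3 → ℝ) {u M : ℝ} {r : ℕ}
    (hM : ∫ ω, exc u 0 r (path X ω) ^ 2 ∂P ≤ M) :
    ∫ ω, blockSum w u r (path X ω) ^ 2 ∂P ≤ 2 * (∑ a, |w a|) ^ 2 * (1 + M) := by
  set W := ∑ a, |w a|
  have hB := (memLp_blockSum (P := P) hX w u r 0 2).integrable_sq
  calc ∫ ω, blockSum w u r (path X ω) ^ 2 ∂P
      ≤ ∫ ω, 2 * W ^ 2 * (1 + exc u 0 r (path X ω) ^ 2) ∂P := by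
        refine integral_mono hB
          (((integrable_const _).add (integrable_exc_sq hX 0 r)).const_mul _) fun ω => ?_
        have h1 := abs_blockSum_le w u r (path X ω)
        have h2 := sq_le_sq' (by linarith [abs_nonneg (blockSum w u r (path X ω))]) h1
        rw [sq_abs] at h2
        refine h2.trans ?_
        rw [mul_pow]
        nlinarith [sq_nonneg W, mul_nonneg (sq_nonneg W)
          (sq_nonneg (1 - exc u 0 r (path X ω)))]
    _ ≤ _ := by
        rw [integral_const_mul, integral_add (integrable_const _) (integrable_exc_sq hX 0 r)]
        simp only [integral_const, probReal_univ, smul_eq_mul, mul_one]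
        have : 0 ≤ 2 * W ^ 2 := by positivity
        gcongr

lemma abs_integral_blockSum_le (hX : ∀ i, Measurable (X i)) (w : Fin 3 → ℝ) {u M : ℝ} {r : ℕ}
    (hM : ∫ ω, exc u 0 r (path X ω) ^ 2 ∂P ≤ M) :
    |∫ ω, blockSum w u r (path X ω) ∂P| ≤ (∑ a, |w a|) * (1 + M) := by
  set W := ∑ a, |w a|
  have hW : 0 ≤ W := Finset.sum_nonneg fun _ _ => abs_nonneg _
  have hB : Integrable (fun ω => blockSum w u r (path X ω)) P :=
    (memLp_blockSum (P := P) hX w u r 0 2).integrable (by norm_num)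
  refine abs_integral_le_integral_abs.trans ?_
  calc ∫ ω, |blockSum w u r (path X ω)| ∂P
      ≤ ∫ ω, W * (1 + exc u 0 r (path X ω) ^ 2) ∂P := by
        refine integral_mono hB.abs
          (((integrable_const _).add (integrable_exc_sq hX 0 r)).const_mul _) fun ω => ?_
        refine (abs_blockSum_le w u r (path X ω)).trans ?_
        exact mul_le_mul_of_nonneg_left (add_le_add le_rfl exc_le_sq) hW
    _ ≤ _ := by
        rw [integral_const_mul, integral_add (integrable_const _) (integrable_exc_sq hX 0 r)]
        simp only [integral_const, probReal_univ, smul_eq_mul, mul_one]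
        gcongr

lemma measurable_centredBlock (hX : ∀ i, Measurable (X i)) (w : Fin 3 → ℝ) (u : ℝ) (r j : ℕ) :
    Measurable (centredBlock P X w u r j) :=
  ((measurable_blockSum w u r).comp ((measurable_shiftSeq _).comp (measurable_path hX))).sub_const
    _

lemma integrable_centredBlock (hX : ∀ i, Measurable (X i)) (w : Fin 3 → ℝ) (u : ℝ) (r j : ℕ) :
    Integrable (centredBlock P X w u r j) P :=
  (memLp_one_iff_integrable.1 (memLp_blockSum hX w u r (j * r) 1)).sub (integrable_const _)

lemma integrable_exc_rpow {u : ℝ} (hX : ∀ i, Measurable (X i)) (r : ℕ) {p' : ℝ} (hp' : 0 ≤ p') :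
    Integrable (fun ω => exc u 0 r (path X ω) ^ p') P := by
  refine Integrable.of_bound
    ((measurable_exc_path hX 0 r).pow_const p').aestronglyMeasurable ((r : ℝ) ^ p')
    (ae_of_all _ fun ω => ?_)
  rw [Real.norm_eq_abs, abs_of_nonneg (Real.rpow_nonneg exc_nonneg _)]
  exact Real.rpow_le_rpow exc_nonneg (by simpa using exc_le (u := u) (a := 0) (b := r)) hp'

lemma integral_abs_centredBlock_rpow_le (hX : ∀ i, Measurable (X i))
    (hstat : StrictlyStationary P X) (w : Fin 3 → ℝ) {u M M' q p' : ℝ} {r : ℕ} (j : ℕ)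
    (hq : 0 ≤ q) (hqp : q ≤ p') (hM : ∫ ω, exc u 0 r (path X ω) ^ 2 ∂P ≤ M)
    (hM' : ∫ ω, exc u 0 r (path X ω) ^ p' ∂P ≤ M') :
    ∫ ω, |centredBlock P X w u r j ω| ^ q ∂P
      ≤ ((∑ a, |w a|) * (2 + M)) ^ q * (2 ^ p' * (1 + M')) := by
  set W := ∑ a, |w a|
  have hW : 0 ≤ W := Finset.sum_nonneg fun _ _ => abs_nonneg _
  have hM0 : 0 ≤ M := (integral_exc_sq_nonneg _ _ _).trans hM
  set m := ∫ ω, blockSum w u r (path X ω) ∂P with hm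
  have hmle : |m| ≤ W * (1 + M) := abs_integral_blockSum_le hX w hM
  have hp0 : 0 ≤ p' := hq.trans hqp
  have hshift := integral_shift hX hstat (F := fun x => |blockSum w u r x - m| ^ q)
    ((((measurable_blockSum w u r).sub_const m).norm.pow_const q).stronglyMeasurable) (j * r)
  simp only [centredBlock]
  rw [← hm, hshift]
  have hint := integrable_exc_rpow (u := u) (P := P) hX r hp0
  have hpt : ∀ ω, |blockSum w u r (path X ω) - m| ^ q
      ≤ (W * (2 + M)) ^ q * (2 ^ p' * (1 + exc u 0 r (path X ω) ^ p')) := by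
    intro ω
    set N := exc u 0 r (path X ω) with hN
    have hN0 : 0 ≤ N := exc_nonneg
    have h1 : |blockSum w u r (path X ω) - m| ≤ W * (2 + M) * (1 + N) := by
      refine (abs_sub _ _).trans ((add_le_add (abs_blockSum_le w u r _) hmle).trans ?_)
      rw [← hN]
      have : 0 ≤ W * (N * (1 + M)) := by positivity
      nlinarith
    have h2 : (1 + N) ^ p' ≤ 2 ^ p' * (1 + N ^ p') := by
      rcases le_total N 1 with h | h
      · calc (1 + N) ^ p' ≤ 2 ^ p' := Real.rpow_le_rpow (by linarith) (by linarith) hp0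
          _ ≤ 2 ^ p' * (1 + N ^ p') := le_mul_of_one_le_right (by positivity)
            (by linarith [Real.rpow_nonneg hN0 p'])
      · calc (1 + N) ^ p' ≤ (2 * N) ^ p' := Real.rpow_le_rpow (by linarith) (by linarith) hp0
          _ = 2 ^ p' * N ^ p' := Real.mul_rpow (by norm_num) hN0
          _ ≤ _ := mul_le_mul_of_nonneg_left (by linarith) (by positivity)
    calc |blockSum w u r (path X ω) - m| ^ q ≤ (W * (2 + M) * (1 + N)) ^ q :=
          Real.rpow_le_rpow (abs_nonneg _) h1 hq
      _ = (W * (2 + M)) ^ q * (1 + N) ^ q := Real.mul_rpow (by positivity) (by positivity)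
      _ ≤ (W * (2 + M)) ^ q * (1 + N) ^ p' := mul_le_mul_of_nonneg_left
          (Real.rpow_le_rpow_of_exponent_le (by linarith) hqp) (by positivity)
      _ ≤ _ := mul_le_mul_of_nonneg_left h2 (by positivity)
  have hR : Integrable (fun ω => (W * (2 + M)) ^ q * (2 ^ p' * (1 + exc u 0 r (path X ω) ^ p')))
      P := (((integrable_const _).add hint).const_mul _).const_mul _
  calc _ ≤ ∫ ω, (W * (2 + M)) ^ q * (2 ^ p' * (1 + exc u 0 r (path X ω) ^ p')) ∂P :=
        integral_mono_of_nonneg (ae_of_all _ fun ω => by positivity) hR (ae_of_all _ hpt)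
    _ ≤ _ := by
        rw [integral_const_mul, integral_const_mul, integral_add (integrable_const _) hint]
        simp only [integral_const, probReal_univ, smul_eq_mul, mul_one]
        gcongr

/-- The centred block statistics form a weakly dependent row: blocks at lag `3` are separated by a
full block, so that the maximal correlation coefficient controls their dependence. -/
lemma weaklyDependentRow_centredBlock (hX : ∀ i, Measurable (X i))
    (hstat : StrictlyStationary P X) (w : Fin 3 → ℝ) {u M M' q p' C : ℝ} {n r l : ℕ}
    (hr : 0 < r) (hlr : l ≤ r)
    (hq : 0 ≤ q) (hqp : q ≤ p') (hM : ∫ ω, exc u 0 r (path X ω) ^ 2 ∂P ≤ M)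
    (hM' : ∫ ω, exc u 0 r (path X ω) ^ p' ∂P ≤ M')
    (hC : 2 * (∑ a, |w a|) ^ 2 * (1 + M) ≤ C)
    (hC' : ((∑ a, |w a|) * (2 + M)) ^ q * (2 ^ p' * (1 + M')) ≤ C) :
    WeaklyDependentRow P (centredBlock P X w u r) (blockCov P X w u r) (n / r - 1)
      ((4 + C) * maxCorr P X n l u) C q := by
  have hM0 : 0 ≤ M := (integral_exc_sq_nonneg _ _ _).trans hM
  have hC0 : 0 ≤ C := le_trans (by positivity) hC
  have hρ : 0 ≤ maxCorr P X n l u := maxCorr_nonneg n l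
  have hmean := integral_blockSum_shift hX hstat w u r
  have hmem := fun h => memLp_blockSum (P := P) hX w u r h 2
  have hblock := fun j => measurable_centredBlock (P := P) hX w u r j
  have hsq : ∀ h, ∫ ω, blockSum w u r (shiftSeq h (path X ω)) ^ 2 ∂P ≤ C := fun h => by
    rw [integral_shift hX hstat (F := fun x => blockSum w u r x ^ 2)
      ((measurable_blockSum w u r).pow_const 2).stronglyMeasurable h]
    exact (integral_blockSum_sq_le hX w hM).trans hC
  have hloc : ∀ (A : Finset ℕ) (t : ℝ) (c d : ℕ), (∀ j ∈ A, c ≤ j * r + 1) →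
      (∀ j ∈ A, (j + 2) * r ≤ d) →
      Measurable[sigmaField X u c d] fun ω => t * ∑ j ∈ A, centredBlock P X w u r j ω :=
    fun A t c d hc hd => Measurable.const_mul (Finset.measurable_fun_sum _ fun j hj =>
      (measurable_blockSum_sigmaField w (hc j hj) (hd j hj)).sub_const _) t
  have hlast : ∀ j, j < n / r - 1 → (j + 2) * r ≤ n := fun j hj =>
    (Nat.mul_le_mul_right r (by omega)).trans (Nat.div_mul_le_self n r)
  refine ⟨hblock, ?_, ?_, ?_, ?_, ?_, ?_, by positivity, ?_, ?_⟩
  · refine ⟨(∑ a, |w a|) * (1 + r) + |∫ ω, blockSum w u r (path X ω) ∂P|, fun j ω => ?_⟩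
    refine (abs_sub _ _).trans (add_le_add ((abs_blockSum_le _ _ _ _).trans ?_) le_rfl)
    refine mul_le_mul_of_nonneg_left (add_le_add le_rfl ?_)
      (Finset.sum_nonneg fun _ _ => abs_nonneg _)
    simpa using exc_le (u := u) (a := 0) (b := r)
  · intro j
    simp only [centredBlock]
    rw [integral_sub ((hmem _).integrable (by norm_num)) (integrable_const _), hmean]
    simp
  · intro i h
    have e := covariance_shift_add hX hstat (measurable_blockSum w u r) (measurable_blockSum w u r)
      0 (h * r) (i * r)
    rw [blockCov]
    rw [zero_add, ← add_mul, add_comm h i] at e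
    refine Eq.trans ?_ e
    simp only [covariance, centredBlock, hmean]
  · intro b h t
    have e := integral_shift hX hstat (F := fun x => Complex.exp (((t * ∑ j ∈ Finset.range b,
      (blockSum w u r (shiftSeq (j * r) x) - ∫ ω, blockSum w u r (path X ω) ∂P) : ℝ) : ℂ)
        * Complex.I)) (measurable_exp_mul_I (Measurable.const_mul
          (Finset.measurable_fun_sum _ fun j _ => ((measurable_blockSum w u r).comp
            (measurable_shiftSeq (j * r))).sub_const _) t)).stronglyMeasurable (h * r)
    simp only [shiftSeq_shiftSeq] at e
    simp only [expect, centredBlock]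
    rw [← e]
    congr 1
    funext ω
    rw [Finset.sum_Ico_eq_sum_range, Nat.add_sub_cancel_left]
    simp_rw [← add_mul, add_comm h]
  · intro j
    exact (integral_abs_centredBlock_rpow_le hX hstat w j hq hqp hM hM').trans hC'
  · intro h
    refine (abs_covariance_le_integral_sq (hmem 0) (hmem _)).trans ?_
    rw [← Real.mul_self_sqrt hC0]
    exact mul_le_mul (Real.sqrt_le_sqrt (hsq 0)) (Real.sqrt_le_sqrt (hsq _)) (Real.sqrt_nonneg _)
      (Real.sqrt_nonneg _)
  · intro h h3 hN
    have h1 : 3 * r ≤ h * r := Nat.mul_le_mul_right _ h3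
    have h2 := hlast h hN
    have hn : h * r + 2 * r ≤ n := by rwa [add_mul] at h2
    have hm0 := measurable_blockSum_sigmaField (X := X) w (u := u) (r := r) (j := 0) (c := 1)
      (d := 2 * r) (by omega) (by omega)
    rw [zero_mul] at hm0
    have := abs_covariance_le_maxCorr_integral_sq (P := P) (n := n) (l := l) (t := 2 * r)
      (t' := h * r + 1) (by omega) (by omega) (by omega) hm0
      (measurable_blockSum_sigmaField w le_rfl h2) (hmem 0) (hmem (h * r))
    refine this.trans ?_
    rw [mul_comm]
    refine mul_le_mul_of_nonneg_right ?_ hρ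
    have h5 : Real.sqrt (∫ ω, blockSum w u r (shiftSeq 0 (path X ω)) ^ 2 ∂P)
        * Real.sqrt (∫ ω, blockSum w u r (shiftSeq (h * r) (path X ω)) ^ 2 ∂P) ≤ C := by
      rw [← Real.mul_self_sqrt hC0]
      exact mul_le_mul (Real.sqrt_le_sqrt (hsq 0)) (Real.sqrt_le_sqrt (hsq _)) (Real.sqrt_nonneg _)
        (Real.sqrt_nonneg _)
    linarith
  · intro A B t hAB hB
    have hρ' : 4 * maxCorr P X n l u ≤ (4 + C) * maxCorr P X n l u :=
      mul_le_mul_of_nonneg_right (by linarith) hρ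
    rcases B.eq_empty_or_nonempty with rfl | hBne
    · simp only [Finset.sum_empty, add_zero, mul_zero]
      have : expect P (fun _ : Ω => (0 : ℝ)) = 1 := by simp [expect]
      rw [this, mul_one, sub_self, norm_zero]
      positivity
    rcases A.eq_empty_or_nonempty with rfl | ⟨i₀, hi₀⟩
    · simp only [Finset.sum_empty, zero_add, mul_zero]
      have : expect P (fun _ : Ω => (0 : ℝ)) = 1 := by simp [expect]
      rw [this, one_mul, sub_self, norm_zero]
      positivity
    set j₀ := B.min' hBne with hj₀
    have hj₀B : j₀ ∈ B := B.min'_mem hBne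
    have h3 : ∀ i ∈ A, i + 3 ≤ j₀ := fun i hi => hAB i hi j₀ hj₀B
    have h30 := h3 i₀ hi₀
    have hj1 : (j₀ - 1) * r + r = j₀ * r := by
      rw [← Nat.succ_mul]; congr 1; omega
    have hj1pos : r ≤ (j₀ - 1) * r := Nat.le_mul_of_pos_left _ (by omega)
    have hn0 := hlast j₀ (hB j₀ hj₀B)
    rw [add_mul] at hn0
    have := norm_expect_add_sub_mul_le (P := P) (n := n) (l := l) (t := (j₀ - 1) * r)
      (t' := j₀ * r + 1) hX (by omega) (by omega) (by omega)
      (hloc A t 1 _ (fun j _ => by omega) (fun j hj => Nat.mul_le_mul_right _ (by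
        have := h3 j hj; omega)))
      (hloc B t _ n (fun j hj => Nat.succ_le_succ (Nat.mul_le_mul_right _ (B.min'_le j hj)))
        (fun j hj => hlast j (hB j hj)))
    simp_rw [mul_add]
    exact this.trans hρ'

lemma blockCov_sum_eq (hX : ∀ i, Measurable (X i)) (hstat : StrictlyStationary P X)
    (w : Fin 3 → ℝ) (u : ℝ) (r : ℕ) :
    blockCov P X w u r 0 + 2 * blockCov P X w u r 1 + 2 * blockCov P X w u r 2
      = ∑ a, ∑ b, w a * w b * lagCov P X r (blockStat u r a) (blockStat u r b) := by
  have hB := measurable_blockSum w u r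
  have hs : ∀ i h, cov[fun ω => blockSum w u r (shiftSeq (i * r) (path X ω)),
      fun ω => blockSum w u r (shiftSeq ((i + h) * r) (path X ω)); P] = blockCov P X w u r h := by
    intro i h
    have e := covariance_shift_add hX hstat hB hB 0 (h * r) (i * r)
    rw [zero_add, ← add_mul, add_comm h i] at e
    exact e
  have hlag : lagCov P X r (blockSum w u r) (blockSum w u r)
      = blockCov P X w u r 0 + 2 * blockCov P X w u r 1 + 2 * blockCov P X w u r 2 := by
    simp only [lagCov, Finset.sum_range_succ, Finset.range_zero, Finset.sum_empty, zero_add]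
    have h0 := (covariance_comm _ _).trans (hs 0 2)
    have h1 := (covariance_comm _ _).trans (hs 1 1)
    have h2 := hs 2 0
    have h3 := hs 2 1
    have h4 := hs 2 2
    norm_num only at h0 h1 h2 h3 h4
    rw [h0, h1, h2, h3, h4]
    ring
  rw [← hlag, lagCov]
  simp only [lagCov, Finset.mul_sum]
  have hc : ∀ j, cov[fun ω => blockSum w u r (shiftSeq (2 * r) (path X ω)),
      fun ω => blockSum w u r (shiftSeq (j * r) (path X ω)); P]
      = ∑ a, ∑ b, w a * w b * cov[fun ω => blockStat u r a (shiftSeq (2 * r) (path X ω)),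
        fun ω => blockStat u r b (shiftSeq (j * r) (path X ω)); P] := by
    intro j
    simp only [blockSum]
    rw [covariance_fun_sum_fun_sum (fun a => (memLp_blockStat hX u r _ a 2).const_mul (w a))
      (fun a => (memLp_blockStat hX u r _ a 2).const_mul (w a))]
    refine Finset.sum_congr rfl fun a _ => Finset.sum_congr rfl fun b _ => ?_
    rw [covariance_const_mul_left, covariance_const_mul_right]
    ring
  simp_rw [hc]
  rw [Finset.sum_comm]
  refine Finset.sum_congr rfl fun a _ => ?_
  rw [Finset.sum_comm]

/-- Asymptotic normality of the normalized sum of the weighted block statistics. -/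
theorem Regime.tendsto_expect_centredBlock {u : ℕ → ℝ} {r l s : ℕ → ℕ} {τ θ m₂ M : ℝ}
    (h : Regime P X u r l s τ (τ * θ) m₂ M) {p M' : ℝ} (hp : 1 < p)
    (hM' : ∀ᶠ n in atTop, ∫ ω, exc (u n) 0 (r n) (path X ω) ^ (2 * p) ∂P ≤ M') (w : Fin 3 → ℝ) :
    0 ≤ ∑ a, ∑ b, w a * w b * asympCov θ τ m₂ a b ∧
    Tendsto (fun n => expect P (fun ω => (1 / Real.sqrt ((n / r n : ℕ) : ℝ)) *
      ∑ j ∈ Finset.range (n / r n - 1), centredBlock P X w (u n) (r n) j ω)) atTop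
      (𝓝 ((Real.exp (-(∑ a, ∑ b, w a * w b * asympCov θ τ m₂ a b) / 2) : ℝ) : ℂ)) := by
  set q := min (2 * p) 3
  set C := max (2 * (∑ a, |w a|) ^ 2 * (1 + M))
    (((∑ a, |w a|) * (2 + M)) ^ q * (2 ^ (2 * p) * (1 + M')))
  have hq2 : 2 < q := lt_min (by linarith) (by norm_num)
  have hk : Tendsto (fun n => ((n / r n : ℕ) : ℝ)) atTop atTop :=
    tendsto_natCast_atTop_atTop.comp h.k_tendsto
  refine tendsto_expect_sum (q := q) (C := C)
    (γ := fun n => blockCov P X w (u n) (r n))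
    (ρ := fun n => (4 + C) * maxCorr P X n (l n) (u n)) hq2 (min_le_right _ _)
    ?_ (fun n => by positivity) ?_ ?_ ?_ ?_
  · exact (tendsto_sub_atTop_nat 1).comp h.k_tendsto
  · have := (tendsto_inv_atTop_zero.comp hk).const_sub 1
    rw [sub_zero] at this
    refine this.congr' ?_
    filter_upwards [h.k_tendsto.eventually_ge_atTop 1] with n hn
    have h0 : (0 : ℝ) < ((n / r n : ℕ) : ℝ) := by exact_mod_cast hn
    rw [div_pow, Real.sq_sqrt h0.le, one_pow, Nat.cast_sub hn]
    simp only [Function.comp]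
    field_simp
    simp
  · have := h.k_rho.const_mul (4 + C)
    rw [mul_zero] at this
    refine squeeze_zero_norm' ?_ this
    have hC0 : 0 ≤ C := by
      refine le_trans ?_ (le_max_left _ _)
      have := h.M_nonneg
      positivity
    refine Eventually.of_forall fun n => ?_
    have hρ : 0 ≤ maxCorr P X n (l n) (u n) := maxCorr_nonneg _ _
    rw [Real.norm_eq_abs, abs_of_nonneg (by positivity)]
    have : ((n / r n - 1 : ℕ) : ℝ) ≤ ((n / r n : ℕ) : ℝ) := Nat.cast_le.2 (Nat.sub_le _ _)
    calc ((n / r n - 1 : ℕ) : ℝ) * ((4 + C) * maxCorr P X n (l n) (u n))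
        ≤ ((n / r n : ℕ) : ℝ) * ((4 + C) * maxCorr P X n (l n) (u n)) :=
          mul_le_mul_of_nonneg_right this (by positivity)
      _ = _ := by ring
  · have : Tendsto (fun n => ∑ a, ∑ b, w a * w b
        * lagCov P X (r n) (blockStat (u n) (r n) a) (blockStat (u n) (r n) b)) atTop
        (𝓝 (∑ a, ∑ b, w a * w b * asympCov θ τ m₂ a b)) :=
      tendsto_finsetSum _ fun a _ => tendsto_finsetSum _ fun b _ =>
        (h.tendsto_lagCov a b).const_mul _
    exact this.congr fun n => (blockCov_sum_eq h.meas h.stat w (u n) (r n)).symm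
  · filter_upwards [hM', h.sq_le, h.two_l_le_s, h.two_s_le_r] with n h1 h2 h3 h4
    exact weaklyDependentRow_centredBlock h.meas h.stat w (h.r_pos n) (by omega) (by linarith)
      (min_le_left _ _) h2 h1 (le_max_left _ _) (le_max_right _ _)

end

section
variable {Ω : Type*} [MeasurableSpace Ω] {P : Measure Ω} [IsProbabilityMeasure P]
  {X : ℕ → Ω → ℝ}

/-! ### The estimators as averages of block statistics -/

lemma sum_Icc_one_eq (f : ℕ → ℝ) (k : ℕ) :
    ∑ i ∈ Finset.Icc 1 k, f i = ∑ j ∈ Finset.range k, f (j + 1) := by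
  rw [Finset.range_eq_Ico]
  exact (Finset.sum_Ico_add' f 0 k 1).symm

lemma estDisjoint_eq {n r : ℕ} (hr : 0 < r) (u : ℝ) (ω : Ω) :
    estDisjoint X n r u ω = (1 / ((n / r : ℕ) : ℝ)) *
      ∑ j ∈ Finset.range (n / r), emp u (j * r) (j * r + r) (path X ω) := by
  rw [estDisjoint, sum_Icc_one_eq]
  congr 1
  refine Finset.sum_congr rfl fun j _ => ?_
  rw [Nat.add_sub_cancel, add_mul, one_mul, ind_blockMax_eq (by omega)]

lemma estSliding_eq {n r : ℕ} (hr : 0 < r) (u : ℝ) (ω : Ω) :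
    estSliding X n r u ω = (1 / ((n - r + 1 : ℕ) : ℝ)) *
      ∑ i ∈ Finset.range (n - r + 1), emp u i (i + r) (path X ω) := by
  rw [estSliding, Finset.range_eq_Ico]
  congr 1
  refine Finset.sum_congr rfl fun i _ => ?_
  rw [ind_blockMax_eq (by omega)]

lemma estTau_eq (n r : ℕ) (u : ℝ) (ω : Ω) :
    estTau X n r u ω = (1 / ((n / r : ℕ) : ℝ)) *
      ∑ j ∈ Finset.range (n / r), exc u (j * r) (j * r + r) (path X ω) := by
  rw [estTau, exceedances_eq, mul_comm r, ← sum_exc_shift]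
  simp_rw [exc_block_shift]

lemma measurable_scaledVector (hX : ∀ i, Measurable (X i)) (n : ℕ) {r : ℕ} (hr : 0 < r) (u : ℝ) :
    Measurable (scaledVector P X n r u) := by
  have h1 : Measurable (estDisjoint X n r u) := by
    simp_rw [funext (estDisjoint_eq (X := X) (n := n) hr u)]
    exact (Finset.measurable_fun_sum _ fun j _ => measurable_emp_path hX _ _).const_mul _
  have h2 : Measurable (estSliding X n r u) := by
    simp_rw [funext (estSliding_eq (X := X) (n := n) hr u)]
    exact (Finset.measurable_fun_sum _ fun j _ => measurable_emp_path hX _ _).const_mul _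
  have h3 : Measurable (estTau X n r u) := by
    simp_rw [funext (estTau_eq (X := X) n r u)]
    exact (Finset.measurable_fun_sum _ fun j _ => measurable_exc_path hX _ _).const_mul _
  have h4 : Measurable fun ω => (![estDisjoint X n r u ω - maxCDF P X r u,
      estSliding X n r u ω - maxCDF P X r u, estTau X n r u ω - tauBlock P X r u] :
      Fin 3 → ℝ) := by
    refine measurable_pi_iff.2 fun i => ?_
    fin_cases i
    · exact h1.sub_const _
    · exact h2.sub_const _
    · exact h3.sub_const _
  exact ((WithLp.measurable_toLp 2 (Fin 3 → ℝ)).comp h4).const_smul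
    (Real.sqrt ((n / r : ℕ) : ℝ))

lemma inner_scaledVector (n r : ℕ) (u : ℝ) (ω : Ω) (w : EuclideanSpace ℝ (Fin 3)) :
    inner ℝ (scaledVector P X n r u ω) w = Real.sqrt ((n / r : ℕ) : ℝ) *
      (w 0 * (estDisjoint X n r u ω - maxCDF P X r u)
        + w 1 * (estSliding X n r u ω - maxCDF P X r u)
        + w 2 * (estTau X n r u ω - tauBlock P X r u)) := by
  simp only [scaledVector, PiLp.inner_apply, Fin.sum_univ_three, PiLp.smul_apply, smul_eq_mul]
  simp
  ring

/-- Passing from the windows that start in the first `k - 1` blocks to the `Q` windows that fit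
into the sample changes the normalized average by at most `1 / √k`. -/
lemma abs_sliding_remainder_le {g : ℕ → ℝ} (hg : ∀ i, |g i| ≤ 1) {k r Q : ℕ} (hk : 1 ≤ k)
    (hr : 0 < r) (hQ : (k - 1) * r ≤ Q) (hQ' : Q ≤ k * r) (hQ0 : 0 < Q) :
    |Real.sqrt k * ((1 / (Q : ℝ)) * ∑ i ∈ Finset.range Q, g i)
      - (1 / Real.sqrt k) * ((1 / (r : ℝ)) * ∑ i ∈ Finset.range ((k - 1) * r), g i)|
      ≤ 1 / Real.sqrt k := by
  have hk0 : (0 : ℝ) < k := by exact_mod_cast hk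
  have hr0 : (0 : ℝ) < r := by exact_mod_cast hr
  have hQ0' : (0 : ℝ) < Q := by exact_mod_cast hQ0
  have hs : 0 < Real.sqrt k := Real.sqrt_pos.2 hk0
  have hss : Real.sqrt k * Real.sqrt k = k := Real.mul_self_sqrt hk0.le
  have hsum : ∀ m, |∑ i ∈ Finset.range m, g i| ≤ m := fun m => by
    refine (Finset.abs_sum_le_sum_abs _ _).trans
      ((Finset.sum_le_card_nsmul _ _ 1 fun i _ => hg i).trans (by simp))
  obtain ⟨e, rfl⟩ := Nat.exists_eq_add_of_le hQ
  have htail : |∑ i ∈ Finset.range e, g ((k - 1) * r + i)| ≤ e := by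
    refine (Finset.abs_sum_le_sum_abs _ _).trans
      ((Finset.sum_le_card_nsmul _ _ 1 fun i _ => hg _).trans (by simp))
  have hA := hsum ((k - 1) * r + e)
  have hsplit := Finset.sum_range_add g ((k - 1) * r) e
  set A := ∑ i ∈ Finset.range ((k - 1) * r + e), g i
  set B := ∑ i ∈ Finset.range ((k - 1) * r), g i
  set T := ∑ i ∈ Finset.range e, g ((k - 1) * r + i)
  set Q := (((k - 1) * r + e : ℕ) : ℝ) with hQdef
  have hQk : Q ≤ k * r := by rw [hQdef]; exact_mod_cast hQ'
  have hQe : Q = (k - 1) * r + e := by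
    rw [hQdef]; push_cast [Nat.cast_sub hk]; ring
  have hB : B = A - T := by linarith
  have e1 : Real.sqrt k * ((1 / Q) * A) - (1 / Real.sqrt k) * ((1 / (r : ℝ)) * B)
      = (1 / Real.sqrt k) * (1 / r) * (((k * r - Q) / Q) * A + T) := by
    rw [hB]
    field_simp
    rw [sq, hss]
    ring
  rw [e1, abs_mul, abs_of_pos (by positivity)]
  have h1 : |((k * r - Q) / Q) * A| ≤ k * r - Q := by
    rw [abs_mul, abs_of_nonneg (div_nonneg (by linarith) hQ0'.le), div_mul_eq_mul_div,
      div_le_iff₀ hQ0']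
    exact mul_le_mul_of_nonneg_left hA (by linarith)
  have h2 : |((k * r - Q) / Q) * A + T| ≤ r := by
    refine (abs_add_le _ _).trans ((add_le_add h1 htail).trans (le_of_eq ?_))
    rw [hQe]; ring
  calc 1 / Real.sqrt k * (1 / r) * |((k * r - Q) / Q) * A + T|
      ≤ 1 / Real.sqrt k * (1 / r) * r := mul_le_mul_of_nonneg_left h2 (by positivity)
    _ = 1 / Real.sqrt k := by field_simp

lemma integral_blockSum_eq (hX : ∀ i, Measurable (X i)) (hstat : StrictlyStationary P X)
    (w : Fin 3 → ℝ) (u : ℝ) {r : ℕ} (hr : 0 < r) :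
    ∫ ω, blockSum w u r (path X ω) ∂P = w 0 * maxCDF P X r u + w 1 * maxCDF P X r u
      + w 2 * tauBlock P X r u := by
  have hi : ∀ a, Integrable (fun ω => w a * blockStat u r a (path X ω)) P := fun a =>
    ((memLp_blockStat (P := P) hX u r 0 a 1).integrable le_rfl).const_mul (w a)
  have h1 : ∫ ω, blockStat u r 1 (path X ω) ∂P = maxCDF P X r u := by
    change ∫ ω, (1 / (r : ℝ)) * ∑ i ∈ Finset.range r, emp u i (i + r) (path X ω) ∂P = _
    rw [integral_const_mul, integral_finsetSum _ fun i _ => integrable_emp hX _ _]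
    simp_rw [integral_emp hX hstat]
    rw [Finset.sum_const, Finset.card_range, nsmul_eq_mul, maxCDF_eq hX hr]
    field_simp
  have h2 : ∫ ω, blockStat u r 2 (path X ω) ∂P = tauBlock P X r u := by
    have := integral_exc (u := u) hX hstat 0 r
    rw [zero_add] at this
    exact this
  simp only [blockSum]
  rw [integral_finsetSum _ fun a _ => hi a]
  simp_rw [integral_const_mul]
  rw [Fin.sum_univ_three, h1, h2, maxCDF_eq hX hr]
  rfl

lemma sum_blockSum_shift (w : Fin 3 → ℝ) (u : ℝ) (r g : ℕ) (x : ℕ → ℝ) :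
    ∑ j ∈ Finset.range g, blockSum w u r (shiftSeq (j * r) x)
      = w 0 * ∑ j ∈ Finset.range g, emp u (j * r) (j * r + r) x
        + w 1 * ((1 / (r : ℝ)) * ∑ i ∈ Finset.range (g * r), emp u i (i + r) x)
        + w 2 * ∑ j ∈ Finset.range g, exc u (j * r) (j * r + r) x := by
  simp only [blockSum, Fin.sum_univ_three, Finset.sum_add_distrib, ← Finset.mul_sum,
    sum_average_emp_shift, emp_block_shift, exc_block_shift]

/-- The linear combination of the scaled estimators is a normalized sum of centred block statistics
up to terms of order `1 / √k`. -/
lemma integral_abs_inner_sub_le (hX : ∀ i, Measurable (X i)) (hstat : StrictlyStationary P X)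
    (w : EuclideanSpace ℝ (Fin 3)) (u : ℝ) {n r : ℕ} (hr : 0 < r) (hn : 1 ≤ n / r) :
    ∫ ω, |inner ℝ (scaledVector P X n r u ω) w - (1 / Real.sqrt ((n / r : ℕ) : ℝ)) *
      ∑ j ∈ Finset.range (n / r - 1), centredBlock P X (fun a => w a) u r j ω| ∂P
      ≤ (1 / Real.sqrt ((n / r : ℕ) : ℝ)) * (|w 0| + |w 1| + |w 2| * (2 * tauBlock P X r u)) := by
  obtain ⟨k, hk⟩ : ∃ k, n / r = k := ⟨_, rfl⟩
  rw [hk] at hn ⊢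
  have hk0 : (0 : ℝ) < k := by exact_mod_cast hn
  have hs : 0 < Real.sqrt k := Real.sqrt_pos.2 hk0
  have hss : Real.sqrt k * Real.sqrt k = k := Real.mul_self_sqrt hk0.le
  have hr0 : (0 : ℝ) < r := by exact_mod_cast hr
  have hkr : k * r ≤ n := by rw [← hk]; exact Nat.div_mul_le_self _ _
  have hkr' : n < k * r + r := by rw [← hk]; exact Nat.lt_div_mul_add hr
  have hk1 : (k - 1) * r + r = k * r := by rw [← Nat.succ_mul]; congr 1; omega
  set F := maxCDF P X r u with hF
  set T := tauBlock P X r u with hT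
  have hT0 : 0 ≤ T := mul_nonneg (Nat.cast_nonneg _) (tail_nonneg hX)
  have hF01 : 0 ≤ F ∧ F ≤ 1 := by rw [hF, maxCDF_eq hX hr]; exact integral_emp_mem hX u 0 r
  have hdev : ∀ a b ω, |emp u a b (path X ω) - F| ≤ 1 := fun a b ω => by
    have h1 := emp_nonneg (u := u) (a := a) (b := b) (x := path X ω)
    have h2 := emp_le_one (u := u) (a := a) (b := b) (x := path X ω)
    rw [abs_le]; constructor <;> linarith [hF01.1, hF01.2]
  have hlastN : Integrable (fun ω => exc u ((k - 1) * r) ((k - 1) * r + r) (path X ω)) P :=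
    integrable_exc hX _ _
  -- the three parts of the remainder: the last disjoint block, the windows, the last count
  have hpt : ∀ ω, |inner ℝ (scaledVector P X n r u ω) w - (1 / Real.sqrt k) *
      ∑ j ∈ Finset.range (k - 1), centredBlock P X (fun a => w a) u r j ω|
      ≤ (1 / Real.sqrt k) * (|w 0| + |w 1|
        + |w 2| * (exc u ((k - 1) * r) ((k - 1) * r + r) (path X ω) + T)) := by
    intro ω
    set x := path X ω with hx
    set Q := n - r + 1 with hQ
    have hsl := abs_sliding_remainder_le (g := fun i => emp u i (i + r) x - F)
      (fun i => hdev _ _ ω) hn hr (Q := Q) (by omega) (by omega) (by omega)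
    have hQ0 : (0 : ℝ) < Q := by rw [hQ]; positivity
    have hcb : ∑ j ∈ Finset.range (k - 1), centredBlock P X (fun a => w a) u r j ω
        = w 0 * (∑ j ∈ Finset.range (k - 1), emp u (j * r) (j * r + r) x - (k - 1) * F)
        + w 1 * ((1 / (r : ℝ)) * ∑ i ∈ Finset.range ((k - 1) * r), (emp u i (i + r) x - F))
        + w 2 * (∑ j ∈ Finset.range (k - 1), exc u (j * r) (j * r + r) x - (k - 1) * T) := by
      simp only [centredBlock]
      rw [Finset.sum_sub_distrib, sum_blockSum_shift, integral_blockSum_eq hX hstat _ _ hr,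
        Finset.sum_sub_distrib, Finset.sum_const, Finset.sum_const, Finset.card_range,
        Finset.card_range, nsmul_eq_mul, nsmul_eq_mul, ← hF, ← hT]
      push_cast [Nat.cast_sub hn]
      field_simp
      ring
    have hD : ∑ j ∈ Finset.range k, emp u (j * r) (j * r + r) x
        = ∑ j ∈ Finset.range (k - 1), emp u (j * r) (j * r + r) x
          + emp u ((k - 1) * r) ((k - 1) * r + r) x := by
      rw [← Finset.sum_range_succ]; congr 2; omega
    have hN : ∑ j ∈ Finset.range k, exc u (j * r) (j * r + r) x
        = ∑ j ∈ Finset.range (k - 1), exc u (j * r) (j * r + r) x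
          + exc u ((k - 1) * r) ((k - 1) * r + r) x := by
      rw [← Finset.sum_range_succ]; congr 2; omega
    have hSl : (1 / (Q : ℝ)) * ∑ i ∈ Finset.range Q, (emp u i (i + r) x - F)
        = (1 / (Q : ℝ)) * ∑ i ∈ Finset.range Q, emp u i (i + r) x - F := by
      rw [Finset.sum_sub_distrib, Finset.sum_const, Finset.card_range, nsmul_eq_mul]
      field_simp
    have hkk : Real.sqrt k * (1 / (k : ℝ)) = 1 / Real.sqrt k := by
      field_simp
      rw [sq, hss]
    rw [inner_scaledVector, estDisjoint_eq hr, estSliding_eq hr, estTau_eq, hk, hcb, ← hx, ← hQ,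
      ← hF, ← hT, ← hSl, hD, hN]
    set D := ∑ j ∈ Finset.range (k - 1), emp u (j * r) (j * r + r) x
    set N := ∑ j ∈ Finset.range (k - 1), exc u (j * r) (j * r + r) x
    set S₁ := (1 / (Q : ℝ)) * ∑ i ∈ Finset.range Q, (emp u i (i + r) x - F)
    set S₂ := (1 / (r : ℝ)) * ∑ i ∈ Finset.range ((k - 1) * r), (emp u i (i + r) x - F)
    have hdl := hdev ((k - 1) * r) ((k - 1) * r + r) ω
    rw [← hx] at hdl
    set d := emp u ((k - 1) * r) ((k - 1) * r + r) x
    have hnn : 0 ≤ exc u ((k - 1) * r) ((k - 1) * r + r) x := exc_nonneg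
    set ν := exc u ((k - 1) * r) ((k - 1) * r + r) x
    have hF' : Real.sqrt k * F = (1 / Real.sqrt k) * (k * F) := by
      rw [← hkk]; field_simp
    have hT' : Real.sqrt k * T = (1 / Real.sqrt k) * (k * T) := by
      rw [← hkk]; field_simp
    have e1 : Real.sqrt k * (w 0 * (1 / (k : ℝ) * (D + d) - F) + w 1 * S₁
          + w 2 * (1 / (k : ℝ) * (N + ν) - T))
        - 1 / Real.sqrt k * (w 0 * (D - (k - 1) * F) + w 1 * S₂ + w 2 * (N - (k - 1) * T))
        = (1 / Real.sqrt k) * (w 0 * (d - F))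
          + w 1 * (Real.sqrt k * S₁ - 1 / Real.sqrt k * S₂)
          + (1 / Real.sqrt k) * (w 2 * (ν - T)) := by
      linear_combination (w 0 * (D + d) + w 2 * (N + ν)) * hkk - w 0 * hF' - w 2 * hT'
    rw [e1]
    have hs1 : 0 < 1 / Real.sqrt k := by positivity
    have b0 : |(1 / Real.sqrt k) * (w 0 * (d - F))| ≤ (1 / Real.sqrt k) * |w 0| := by
      rw [abs_mul, abs_of_pos hs1, abs_mul]
      exact mul_le_mul_of_nonneg_left (mul_le_of_le_one_right (abs_nonneg _) hdl) hs1.le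
    have b1 : |w 1 * (Real.sqrt k * S₁ - 1 / Real.sqrt k * S₂)| ≤ (1 / Real.sqrt k) * |w 1| := by
      rw [abs_mul, mul_comm]
      exact mul_le_mul_of_nonneg_right hsl (abs_nonneg _)
    have b2 : |(1 / Real.sqrt k) * (w 2 * (ν - T))| ≤ (1 / Real.sqrt k) * (|w 2| * (ν + T)) := by
      rw [abs_mul, abs_of_pos hs1, abs_mul]
      refine mul_le_mul_of_nonneg_left (mul_le_mul_of_nonneg_left ?_ (abs_nonneg _)) hs1.le
      rw [abs_le]; constructor <;> linarith
    have c1 := abs_add_le ((1 / Real.sqrt k) * (w 0 * (d - F))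
      + w 1 * (Real.sqrt k * S₁ - 1 / Real.sqrt k * S₂)) ((1 / Real.sqrt k) * (w 2 * (ν - T)))
    have c2 := abs_add_le ((1 / Real.sqrt k) * (w 0 * (d - F)))
      (w 1 * (Real.sqrt k * S₁ - 1 / Real.sqrt k * S₂))
    linarith
  have hR : Integrable (fun ω => (1 / Real.sqrt k) * (|w 0| + |w 1|
        + |w 2| * (exc u ((k - 1) * r) ((k - 1) * r + r) (path X ω) + T))) P :=
    ((integrable_const _).add ((hlastN.add (integrable_const _)).const_mul _)).const_mul _
  refine (integral_mono_of_nonneg (ae_of_all _ fun _ => abs_nonneg _) hR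
    (ae_of_all _ hpt)).trans (le_of_eq ?_)
  have i1 : Integrable (fun ω => exc u ((k - 1) * r) ((k - 1) * r + r) (path X ω) + T) P :=
    hlastN.add (integrable_const _)
  rw [integral_const_mul, integral_add (integrable_const _) (i1.const_mul _), integral_const_mul,
    integral_add hlastN (integrable_const _), integral_exc hX hstat]
  simp only [integral_const, probReal_univ, smul_eq_mul, one_mul]
  rw [hT, tauBlock]
  ring

/-! ### The extremal index -/

lemma abs_integral_emp_sub_le (hX : ∀ i, Measurable (X i)) (hstat : StrictlyStationary P X)
    (u v : ℝ) (m : ℕ) :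
    |∫ ω, emp u 0 m (path X ω) ∂P - ∫ ω, emp v 0 m (path X ω) ∂P|
      ≤ |m * tail P X u - m * tail P X v| := by
  wlog huv : u ≤ v generalizing u v
  · rw [abs_sub_comm, abs_sub_comm (m * tail P X u)]
    exact this v u (le_of_not_ge huv)
  have hpt : ∀ x : ℕ → ℝ, |emp u 0 m x - emp v 0 m x| ≤ exc u 0 m x - exc v 0 m x := by
    intro x
    have hmono : exc v 0 m x ≤ exc u 0 m x := by
      refine Finset.sum_le_sum fun i _ => ?_
      split_ifs with h1 h2 h2
      · exact le_rfl
      · exact absurd (huv.trans_lt h1) h2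
      · exact zero_le_one
      · exact le_rfl
    by_cases hv : ∀ i ∈ Finset.Ico 0 m, x i ≤ v
    · have h1 : exc v 0 m x = 0 := Finset.sum_eq_zero fun i hi => if_neg (not_lt.2 (hv i hi))
      have h2 : emp v 0 m x = 1 := by rw [emp_eq_ite, if_pos hv]
      rw [h1, h2, sub_zero, abs_sub_comm, abs_of_nonneg (sub_nonneg.2 emp_le_one)]
      exact one_sub_emp_le_exc
    · have h1 : emp v 0 m x = 0 := by rw [emp_eq_ite, if_neg hv]
      have h2 : emp u 0 m x = 0 := by
        rw [emp_eq_ite, if_neg fun h => hv fun i hi => (h i hi).trans huv]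
      rw [h1, h2, sub_self, abs_zero]
      linarith
  have e : ∀ t : ℝ, m * tail P X t = ∫ ω, exc t 0 m (path X ω) ∂P := fun t => by
    have := integral_exc (u := t) hX hstat 0 m
    rw [zero_add] at this
    exact this.symm
  rw [e, e, ← integral_sub (integrable_emp hX _ _) (integrable_emp hX _ _),
    ← integral_sub (integrable_exc hX _ _) (integrable_exc hX _ _)]
  refine abs_integral_le_integral_abs.trans (le_trans ?_ (le_abs_self _))
  exact integral_mono ((integrable_emp hX _ _).sub (integrable_emp hX _ _)).abs
    ((integrable_exc hX _ _).sub (integrable_exc hX _ _)) fun ω => hpt _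

/-- The extremal index gives the limit of the probability that a window of length `m ~ y r` is
empty: changing the threshold changes this probability by at most the change in the expected number
of exceedances, so the thresholds may be replaced by the levels from the definition, taken at `m`. -/
lemma HasExtremalIndex.tendsto_integral_emp {θ τ : ℝ} (hθ : HasExtremalIndex P X θ)
    (hX : ∀ i, Measurable (X i)) (hstat : StrictlyStationary P X) (hτ : 0 < τ) {u : ℕ → ℝ}
    {r : ℕ → ℕ} (hr : ∀ n, 0 < r n) (hr' : Tendsto (fun n => (r n : ℝ)) atTop atTop)
    (hu : Tendsto (fun n => r n * tail P X (u n)) atTop (𝓝 τ)) (m : ℕ → ℕ) (y : ℝ) (hy : 0 ≤ y)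
    (hm : Tendsto (fun n => (m n : ℝ) / r n) atTop (𝓝 y)) :
    Tendsto (fun n => ∫ ω, emp (u n) 0 (m n) (path X ω) ∂P) atTop
      (𝓝 (Real.exp (-(τ * θ * y)))) := by
  have hmt : Tendsto (fun n => m n * tail P X (u n)) atTop (𝓝 (y * τ)) := by
    refine (hm.mul hu).congr fun n => ?_
    have : (r n : ℝ) ≠ 0 := by exact_mod_cast (hr n).ne'
    field_simp
  rcases eq_or_lt_of_le hy with rfl | hy0
  · rw [mul_zero, neg_zero, Real.exp_zero]
    rw [zero_mul] at hmt
    refine tendsto_of_tendsto_of_tendsto_of_le_of_le (by simpa using hmt.const_sub 1)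
      tendsto_const_nhds (fun n => ?_) fun n => (integral_emp_mem hX _ _ _).2
    have := integral_one_sub_emp_le (u := u n) hX hstat (m n)
    linarith
  · obtain ⟨v, hv, hv'⟩ := hθ.2.2 (y * τ) (by positivity)
    have hmr : Tendsto (fun n => (m n : ℝ)) atTop atTop := by
      refine (hm.pos_mul_atTop hy0 hr').congr fun n => ?_
      have : (r n : ℝ) ≠ 0 := by exact_mod_cast (hr n).ne'
      field_simp
    have hmn : Tendsto m atTop atTop := tendsto_natCast_atTop_iff.1 hmr
    have h1 := hv'.comp hmn
    have h2 := (hmt.sub (hv.comp hmn)).abs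
    rw [sub_self, abs_zero] at h2
    have e : θ * (y * τ) = τ * θ * y := by ring
    rw [e] at h1
    have h3 : Tendsto (fun n => ∫ ω, emp (u n) 0 (m n) (path X ω) ∂P
        - maxCDF P X (m n) (v (m n))) atTop (𝓝 0) := by
      refine squeeze_zero_norm' ?_ h2
      filter_upwards [hmn.eventually_gt_atTop 0] with n hn
      rw [maxCDF_eq hX hn]
      exact abs_integral_emp_sub_le hX hstat _ _ _
    have := h3.add h1
    rw [zero_add] at this
    exact this.congr fun n => by simp [Function.comp]

/-- The second moment of the exceedance count given an exceedance. -/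
lemma integral_cond_exceedances_sq (hX : ∀ i, Measurable (X i)) {s : ℕ} (hs : 0 < s) (u : ℝ) :
    ∫ ω, exceedances X s u ω ^ 2 ∂(P[|{ω | u < blockMax X 0 s ω}])
      = (∫ ω, exc u 0 s (path X ω) ^ 2 ∂P) / (1 - ∫ ω, emp u 0 s (path X ω) ∂P) := by
  set A := {ω | u < blockMax X 0 s ω} with hA
  have hAe : A = {ω | emp u 0 s (path X ω) = 0} := by
    ext ω
    simp only [hA, Set.mem_ofPred_eq]
    rw [emp_eq_ite, ← not_le, blockMax_le_iff hs]
    split_ifs with h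
    · exact iff_of_false (not_not.2 h) one_ne_zero
    · exact iff_of_true h rfl
  have hAm : MeasurableSet A := by
    rw [hAe]; exact measurable_emp_path hX 0 s (measurableSet_singleton 0)
  have hPA : P.real A = 1 - ∫ ω, emp u 0 s (path X ω) ∂P := by
    rw [← integral_indicator_one hAm]
    have : ∀ ω, A.indicator (1 : Ω → ℝ) ω = 1 - emp u 0 s (path X ω) := by
      intro ω
      rw [hAe, Set.indicator_apply]
      simp only [Set.mem_ofPred_eq, emp_eq_ite]
      split_ifs <;> simp_all
    simp_rw [this]
    rw [integral_sub (integrable_const _) (integrable_emp hX 0 s)]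
    simp
  have hset : ∫ ω in A, exc u 0 s (path X ω) ^ 2 ∂P = ∫ ω, exc u 0 s (path X ω) ^ 2 ∂P := by
    refine setIntegral_eq_integral_of_forall_compl_eq_zero fun ω hω => ?_
    have h1 : emp u 0 s (path X ω) = 1 := by
      rw [hAe] at hω
      simp only [Set.mem_ofPred_eq] at hω
      rw [emp_eq_ite] at hω ⊢
      split_ifs at hω ⊢ with h
      · rfl
      · exact absurd rfl hω
    have h2 := emp_mul_exc (u := u) (a := 0) (b := s) (x := path X ω)
    rw [h1, one_mul] at h2
    rw [h2]; norm_num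
  simp_rw [exceedances_eq]
  rw [ProbabilityTheory.cond, integral_smul_measure, hset, ← hPA, ENNReal.toReal_inv, smul_eq_mul,
    measureReal_def]
  ring

end

/-! ### Convergence in distribution -/

section
variable {Ω : Type*} [MeasurableSpace Ω] {P : Measure Ω} [IsProbabilityMeasure P]
  {X : ℕ → Ω → ℝ}

lemma integrable_inner_scaledVector (hX : ∀ i, Measurable (X i)) (n : ℕ) {r : ℕ} (hr : 0 < r)
    (u : ℝ) (w : EuclideanSpace ℝ (Fin 3)) :
    Integrable (fun ω => inner ℝ (scaledVector P X n r u ω) w) P := by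
  simp_rw [inner_scaledVector, estDisjoint_eq hr, estSliding_eq hr, estTau_eq]
  refine Integrable.const_mul (((Integrable.const_mul ?_ _).add (Integrable.const_mul ?_ _)).add
    (Integrable.const_mul ?_ _)) _
  · exact ((integrable_finsetSum _ fun j _ => integrable_emp hX _ _).const_mul _).sub
      (integrable_const _)
  · exact ((integrable_finsetSum _ fun j _ => integrable_emp hX _ _).const_mul _).sub
      (integrable_const _)
  · exact ((integrable_finsetSum _ fun j _ => integrable_exc hX _ _).const_mul _).sub
      (integrable_const _)

/-- The linear combinations of the scaled vector have the characteristic functions of the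
normalized sums of centred block statistics, in the limit. -/
lemma Regime.tendsto_expect_inner_scaledVector {u : ℕ → ℝ} {r l s : ℕ → ℕ} {τ θ m₂ M : ℝ}
    (h : Regime P X u r l s τ (τ * θ) m₂ M) {p M' : ℝ} (hp : 1 < p)
    (hM' : ∀ᶠ n in atTop, ∫ ω, exc (u n) 0 (r n) (path X ω) ^ (2 * p) ∂P ≤ M')
    (w : EuclideanSpace ℝ (Fin 3)) :
    Tendsto (fun n => expect P fun ω => inner ℝ (scaledVector P X n (r n) (u n) ω) w) atTop
      (𝓝 ((Real.exp (-(∑ a, ∑ b, w a * w b * asympCov θ τ m₂ a b) / 2) : ℝ) : ℂ)) := by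
  have h1 := (h.tendsto_expect_centredBlock hp hM' fun a => w a).2
  have hk : Tendsto (fun n => 1 / Real.sqrt ((n / r n : ℕ) : ℝ)) atTop (𝓝 0) := by
    simp_rw [one_div]
    exact (Real.tendsto_sqrt_atTop.comp
      (tendsto_natCast_atTop_atTop.comp h.k_tendsto)).inv_tendsto_atTop
  have hB : Tendsto (fun n => 1 / Real.sqrt ((n / r n : ℕ) : ℝ)
      * (|w 0| + |w 1| + |w 2| * (2 * tauBlock P X (r n) (u n)))) atTop (𝓝 0) := by
    have := hk.mul (((h.tail_lim.const_mul 2).const_mul |w 2|).const_add (|w 0| + |w 1|))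
    rwa [zero_mul] at this
  have h2 : Tendsto (fun n => expect P (fun ω => inner ℝ (scaledVector P X n (r n) (u n) ω) w)
      - expect P (fun ω => (1 / Real.sqrt ((n / r n : ℕ) : ℝ)) *
        ∑ j ∈ Finset.range (n / r n - 1), centredBlock P X (fun a => w a) (u n) (r n) j ω))
      atTop (𝓝 0) := by
    refine squeeze_zero_norm' ?_ hB
    filter_upwards [h.k_tendsto.eventually_ge_atTop 1] with n hn
    refine (norm_expect_sub_le ?_ ?_ ?_).trans
      (integral_abs_inner_sub_le h.meas h.stat w (u n) (h.r_pos n) hn)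
    · exact (measurable_scaledVector h.meas n (h.r_pos n) (u n)).inner_const
    · exact (Finset.measurable_fun_sum _ fun j _ =>
        measurable_centredBlock h.meas _ _ _ j).const_mul _
    · exact (integrable_inner_scaledVector h.meas n (h.r_pos n) (u n) w).sub
        ((integrable_finsetSum _ fun j _ =>
          integrable_centredBlock h.meas _ _ _ j).const_mul _)
  simpa using h2.add h1

lemma dotProduct_mulVec_eq_sum (S : Matrix (Fin 3) (Fin 3) ℝ) (w : Fin 3 → ℝ) :
    w ⬝ᵥ S.mulVec w = ∑ a, ∑ b, w a * w b * S a b := by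
  simp only [dotProduct, Matrix.mulVec, Finset.mul_sum]
  exact Finset.sum_congr rfl fun a _ => Finset.sum_congr rfl fun b _ => by ring

lemma Regime.posSemidef_asympCov {u : ℕ → ℝ} {r l s : ℕ → ℕ} {τ θ m₂ M : ℝ}
    (h : Regime P X u r l s τ (τ * θ) m₂ M) {p M' : ℝ} (hp : 1 < p)
    (hM' : ∀ᶠ n in atTop, ∫ ω, exc (u n) 0 (r n) (path X ω) ^ (2 * p) ∂P ≤ M') :
    (asympCov θ τ m₂).PosSemidef := by
  refine Matrix.PosSemidef.of_dotProduct_mulVec_nonneg ?_ fun w => ?_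
  · ext i j
    fin_cases i <;> fin_cases j <;> simp [asympCov]
  · rw [star_trivial, dotProduct_mulVec_eq_sum]
    exact (h.tendsto_expect_centredBlock hp hM' w).1

/-- Lévy's continuity theorem turns the convergence of the characteristic functions of the linear
combinations into convergence in distribution of the vector. -/
lemma Regime.tendstoInDistribution_scaledVector {u : ℕ → ℝ} {r l s : ℕ → ℕ} {τ θ m₂ M : ℝ}
    (h : Regime P X u r l s τ (τ * θ) m₂ M) {p M' : ℝ} (hp : 1 < p)
    (hM' : ∀ᶠ n in atTop, ∫ ω, exc (u n) 0 (r n) (path X ω) ^ (2 * p) ∂P ≤ M') :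
    TendstoInDistribution (fun n => scaledVector P X n (r n) (u n)) atTop
      (id : EuclideanSpace ℝ (Fin 3) → EuclideanSpace ℝ (Fin 3)) (fun _ => P)
      (multivariateGaussian 0 (asympCov θ τ m₂)) where
  forall_aemeasurable n := (measurable_scaledVector h.meas n (h.r_pos n) (u n)).aemeasurable
  tendsto := by
    refine ProbabilityMeasure.tendsto_iff_tendsto_charFun.2 fun w => ?_
    have h1 := h.tendsto_expect_inner_scaledVector hp hM' w
    simp only [ProbabilityMeasure.coe_mk, Measure.map_id]
    rw [charFun_multivariateGaussian (h.posSemidef_asympCov hp hM')]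
    have e : Complex.exp ((inner ℝ w (0 : EuclideanSpace ℝ (Fin 3)) : ℝ) * Complex.I
        - ((WithLp.ofLp w ⬝ᵥ (asympCov θ τ m₂).mulVec (WithLp.ofLp w) : ℝ) : ℂ) / 2)
        = ((Real.exp (-(∑ a, ∑ b, w a * w b * asympCov θ τ m₂ a b) / 2) : ℝ) : ℂ) := by
      rw [dotProduct_mulVec_eq_sum, inner_zero_right]
      push_cast
      congr 1
      ring
    rw [e]
    refine h1.congr fun n => ?_
    rw [charFun_apply, integral_map (measurable_scaledVector h.meas n (h.r_pos n)
      (u n)).aemeasurable (by fun_prop)]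
    rfl

end

end ExtremalBlocks

theorem theorem4p2 {Ω : Type*} [MeasurableSpace Ω] (P : Measure Ω) [IsProbabilityMeasure P]
    (X : ℕ → Ω → ℝ) (hX : ∀ i, Measurable (X i)) (hstat : StrictlyStationary P X)
    (θ : ℝ) (hθ : HasExtremalIndex P X θ)
    (τ : ℝ) (hτ : 0 < τ) (u : ℕ → ℝ)
    (hu : Tendsto (fun r : ℕ => (r : ℝ) * tail P X (u r)) atTop (𝓝 τ))
    (r l s : ℕ → ℕ) (hr : ∀ n, 0 < r n) (hl : ∀ n, 0 < l n) (hs : ∀ n, 0 < s n)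
    -- condition on block sizes and mixing
    (hlr : (fun n => (l n : ℝ)) =o[atTop] (fun n => (r n : ℝ)))
    (hrn : (fun n => (r n : ℝ)) =o[atTop] (fun n : ℕ => (n : ℝ)))
    (hmix : (fun n => ∑ j ∈ Finset.Icc (l n) n, maxCorr P X n j (u (r n)))
      =o[atTop] (fun n => (r n : ℝ)))
    -- stronger summability of the maximal correlation coefficients
    (hmix' : (fun n => ∑ j ∈ Finset.Icc 1 n, maxCorr P X n j (u (r n)))
      =o[atTop] (fun n => Real.sqrt (r n : ℝ)))
    -- intermediate sequence
    (hls : (fun n => (l n : ℝ)) =o[atTop] (fun n => (s n : ℝ)))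
    (hsr : (fun n => (s n : ℝ)) =o[atTop] (fun n => (r n : ℝ)))
    (hmixs : (fun n => maxCorr P X n (l n) (u (r n)))
      =o[atTop] (fun n : ℕ => (s n : ℝ) / (n : ℝ)))
    -- cluster size distribution
    (π : ℕ → ℝ) (hπ : IsPosIntDistribution π)
    (hcluster : ∀ j : ℕ, 1 ≤ j →
      Tendsto (fun n => (P[|{ω | u (r n) < blockMax X 0 (s n) ω}]).real
        {ω | exceedances X (s n) (u (r n)) ω = (j : ℝ)}) atTop (𝓝 (π j)))
    (hπ2 : Summable (fun j : ℕ => (j : ℝ) ^ 2 * π j))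
    (hcluster2 : Tendsto
      (fun n => ∫ ω, exceedances X (s n) (u (r n)) ω ^ 2
        ∂(P[|{ω | u (r n) < blockMax X 0 (s n) ω}]))
      atTop (𝓝 (∑' j : ℕ, (j : ℝ) ^ 2 * π j)))
    -- moment bound
    (p : ℝ) (hp : 1 < p)
    (hmom : (fun n => ∫ ω, exceedances X (r n) (u (r n)) ω ^ (2 * p) ∂P)
      =O[atTop] (fun _ : ℕ => (1 : ℝ))) :
    (asympCov θ τ (∑' j : ℕ, (j : ℝ) ^ 2 * π j)).PosSemidef ∧
    TendstoInDistribution (fun n => scaledVector P X n (r n) (u (r n))) atTop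
      (id : EuclideanSpace ℝ (Fin 3) → EuclideanSpace ℝ (Fin 3)) (fun _ => P)
      (multivariateGaussian 0 (asympCov θ τ (∑' j : ℕ, (j : ℝ) ^ 2 * π j))) := by
  set m₂ := ∑' j : ℕ, (j : ℝ) ^ 2 * π j
  have hr0 : ∀ n, (0 : ℝ) < r n := fun n => by exact_mod_cast hr n
  -- the block length diverges because `1 ≤ l n = o(r n)`
  have hrt : Tendsto (fun n => (r n : ℝ)) atTop atTop := by
    have h1 : (fun _ : ℕ => (1 : ℝ)) =o[atTop] fun n => (r n : ℝ) := by
      refine IsBigO.trans_isLittleO (IsBigO.of_bound 1 (Eventually.of_forall fun n => ?_)) hlr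
      have : (1 : ℝ) ≤ l n := by exact_mod_cast hl n
      simpa using this
    refine ((isLittleO_one_left_iff ℝ).1 h1).congr fun n => ?_
    rw [Real.norm_eq_abs, abs_of_pos (hr0 n)]
  have hrt' : Tendsto r atTop atTop := tendsto_natCast_atTop_iff.1 hrt
  have hul : Tendsto (fun n => r n * tail P X (u (r n))) atTop (𝓝 τ) := hu.comp hrt'
  obtain ⟨C, hC⟩ := hmom.bound
  have hM' : ∀ᶠ n in atTop, ∫ ω, exc (u (r n)) 0 (r n) (path X ω) ^ (2 * p) ∂P ≤ C := by
    filter_upwards [hC] with n hn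
    simp_rw [exceedances_eq] at hn
    rw [norm_one, mul_one] at hn
    exact (Real.le_norm_self _).trans hn
  have hM : ∀ᶠ n in atTop, ∫ ω, exc (u (r n)) 0 (r n) (path X ω) ^ 2 ∂P ≤ 1 + C := by
    filter_upwards [hM'] with n hn
    have hi := integrable_exc_rpow (u := u (r n)) (P := P) hX (r n) (p' := 2 * p) (by linarith)
    calc ∫ ω, exc (u (r n)) 0 (r n) (path X ω) ^ 2 ∂P
        ≤ ∫ ω, (1 + exc (u (r n)) 0 (r n) (path X ω) ^ (2 * p)) ∂P := by
          refine integral_mono (integrable_exc_sq hX _ _) ((integrable_const _).add hi) fun ω => ?_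
          have h0 : 0 ≤ exc (u (r n)) 0 (r n) (path X ω) := exc_nonneg
          rcases le_total (exc (u (r n)) 0 (r n) (path X ω)) 1 with h1 | h1
          · exact (pow_le_one₀ h0 h1).trans (le_add_of_nonneg_right (Real.rpow_nonneg h0 _))
          · have := Real.rpow_le_rpow_of_exponent_le h1 (show (2 : ℝ) ≤ 2 * p by linarith)
            rw [Real.rpow_two] at this
            exact this.trans (le_add_of_nonneg_left zero_le_one)
      _ = 1 + ∫ ω, exc (u (r n)) 0 (r n) (path X ω) ^ (2 * p) ∂P := by
          rw [integral_add (integrable_const _) hi]; simp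
      _ ≤ 1 + C := by linarith
  have h : Regime P X (fun n => u (r n)) r l s τ (τ * θ) m₂ (1 + C) :=
    { meas := hX
      stat := hstat
      r_pos := hr
      l_pos := hl
      s_pos := hs
      l_div := hls.tendsto_div_nhds_zero
      s_div := hsr.tendsto_div_nhds_zero
      r_div := hrn.tendsto_div_nhds_zero
      α_pos := mul_pos hτ hθ.1
      tail_lim := hul
      emp_lim := hθ.tendsto_integral_emp hX hstat hτ hr hrt hul
      mix := by
        refine hmixs.tendsto_div_nhds_zero.congr fun n => ?_
        rw [div_div_eq_mul_div]
        ring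
      cluster := hcluster2.congr fun n => integral_cond_exceedances_sq hX (hs n) _
      sq_le := hM }
  exact ⟨h.posSemidef_asympCov hp hM', h.tendstoInDistribution_scaledVector hp hM'⟩
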